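/- **Model.** In the coordinator model there are $k\ge 1$ players, player $i$ holding a private input $X^i$, and a coordinator without input; each participant uses private coins. The protocol proceeds in rounds: given everything it has seen, the coordinator either stops and outputs a bit, or sends a message to one player, who replies with a message depending on its input, on the previous communication on its own channel and on its coins. Messages are nonempty self-delimiting bit strings, and the protocol stops with probability $1$ on every input. Let $\Pi(X)$ be the transcript seen by the coordinator on input $X=(X^1,\dots,X^k)$, and $\Pi^i(X)$ the part exchanged with player $i$. The protocol is a $\delta$-error protocol for $f$ if on every input the output differs from $f(X)$ with probability at most $\delta$. $CC_\delta(f)$ is the minimum, over $\delta$-error protocols for $f$, of the maximal total number of bits exchanged over all inputs and executions. For a distribution $\zeta$ of $X$, $$IC_{\zeta,\delta}(f)=\inf_{\Pi}\Big( I(X;\Pi(X))+\sum_{i=1}^k I(X^{-i};\Pi^i(X)\mid X^i)\Big),\qquad X\sim\zeta,$$ where the infimum is over all $\delta$-error protocols $\Pi$ for $f$ and $X^{-i}$ denotes the inputs of the players other than $i$. **Problem and hard distribution.** For $X^1,\dots,X^k\in\{0,1\}^n$ let $DISJ_{n,k}(X^1,\dots,X^k)=\bigvee_{j=1}^n\bigwedge_{i=1}^k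 X^i_j$. Let $\xi$ be the following distribution of triples $(x,M,Z)\in\{0,1\}^k\times\{0,1\}\times[k]$: $Z$ is uniform and, independently, $\Pr[M=0]=2/3$, $\Pr[M=1]=1/3$; if $M=0$, then $x$ is uniform in $\{0,1\}^k$, and if $M=1$, then $x$ has a $0$ in position $Z$ and $1$ in all other positions. Let $\eta=\xi^n$ be the distribution of $n$ independent such triples $(X_j,M_j,Z_j)_{j\in[n]}$, and let $\zeta$ be its marginal on the input, where player $i$ receives $X^i=(X^i_1,\dots,X^i_n)$. **Theorem.** There is an absolute constant $a>0$ such that for every $0<\delta<1/2$ there is a constant $c>0$, depending only on $\delta$, such that for all $n\ge 1$ and $k\ge 1$ with $k\ge a\log_2 n$, $$IC_{\zeta,\delta}(DISJ_{n,k})\ \ge\ c\,nk\qquad\text{and}\qquad CC_\delta(DISJ_{n,k})\ \ge\ c\,nk .$$ -/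

import Mathlib

open scoped ENNReal

noncomputable section

/-! ## Entropy and mutual information (in bits) of discrete random variables

`A`, `B`, `C` are random variables on a discrete probability space `(Ω, μ)`; the variable whose
entropy is taken has finite range, the conditioning variables may have countable range. -/

namespace Info

variable {Ω α β γ : Type}

/-- The conditional probability `Pr[A = a | B = b]` (it is `0` if `Pr[B = b] = 0`). -/
def condProb (μ : PMF Ω) (A : Ω → α) (B : Ω → β) (a : α) (b : β) : ℝ :=
  (μ.map (fun ω => (A ω, B ω)) (a, b)).toReal / (μ.map B b).toReal

/-- The entropy `H(A) = ∑ₐ Pr[A = a] log₂ (1 / Pr[A = a])`. -/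
def entropy [Fintype α] (μ : PMF Ω) (A : Ω → α) : ℝ :=
  ∑ a, Real.negMulLog (μ.map A a).toReal / Real.log 2

/-- The conditional entropy `H(A | B) = ∑_b Pr[B = b] H(A | B = b)`.  The series converges, since
`H(A | B = b) ≤ log₂ |α|`. -/
def condEntropy [Fintype α] (μ : PMF Ω) (A : Ω → α) (B : Ω → β) : ℝ :=
  ∑' b, (μ.map B b).toReal * ∑ a, Real.negMulLog (condProb μ A B a b) / Real.log 2

/-- The mutual information `I(A ; B) = H(A) - H(A | B)`. -/
def mutualInfo [Fintype α] (μ : PMF Ω) (A : Ω → α) (B : Ω → β) : ℝ :=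
  entropy μ A - condEntropy μ A B

/-- The conditional mutual information `I(A ; B | C) = H(A | C) - H(A | B, C)`. -/
def condMutualInfo [Fintype α] (μ : PMF Ω) (A : Ω → α) (B : Ω → β) (C : Ω → γ) : ℝ :=
  condEntropy μ A C - condEntropy μ A (fun ω => (B ω, C ω))

end Info

/-! ## The coordinator model -/

namespace Coordinator

/-- What has been said on the channel of one player: the list of pairs (message of the coordinator,
reply of the player), latest pair first. -/
abbrev Channel : Type := List (List Bool × List Bool)

/-- The transcript as seen by the coordinator: the list of rounds `(i, m, r)`, latest round first.
In such a round the coordinator sends `m` to player `i`, who replies `r`. -/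
abbrev History (k : ℕ) : Type := List (Fin k × List Bool × List Bool)

/-- The part of a transcript that was exchanged between player `i` and the coordinator. -/
def chan {k : ℕ} (i : Fin k) (h : History k) : Channel :=
  h.filterMap fun e => if e.1 = i then some e.2 else none

/-- The total number of bits sent on all channels. -/
def bits {k : ℕ} (h : History k) : ℕ :=
  (h.map fun e => e.2.1.length + e.2.2.length).sum

/-- The behaviour of the `k` players, whose inputs come from `D`, and of the coordinator, who has no
input.  Everybody uses private coins only: a move is drawn with fresh randomness from a
distribution that depends on what the mover knows.

Given the transcript, the coordinator either stops with an output bit (`Sum.inl`) or sends a message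
to one player (`Sum.inr`).  A player knows its input and the communication on its own channel,
including the message it has to answer.

Messages are nonempty and self-delimiting: given the previous communication on the channel, the
possible messages form a prefix-free set. -/
structure Strategy (k : ℕ) (D : Type) where
  coord : History k → PMF (Bool ⊕ (Fin k × List Bool))
  player : Fin k → D → Channel → List Bool → PMF (List Bool)
  coord_ne_nil : ∀ h i m, coord h (Sum.inr (i, m)) ≠ 0 → m ≠ []
  player_ne_nil : ∀ i x c m r, player i x c m r ≠ 0 → r ≠ []
  coord_prefix_free : ∀ i h h' m m', chan i h = chan i h' →
    coord h (Sum.inr (i, m)) ≠ 0 → coord h' (Sum.inr (i, m')) ≠ 0 → m <+: m' → m = m'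
  player_prefix_free : ∀ i x x' c m r r',
    player i x c m r ≠ 0 → player i x' c m r' ≠ 0 → r <+: r' → r = r'

namespace Strategy

variable {k : ℕ} {D : Type}

/-- The probability that, on input `X`, the execution starts with the rounds in `h`. -/
def reach (S : Strategy k D) (X : Fin k → D) : History k → ℝ≥0∞
  | [] => 1
  | (i, m, r) :: h => reach S X h * S.coord h (Sum.inr (i, m)) * S.player i (X i) (chan i h) m r

/-- The probability that, on input `X`, the execution has the complete transcript `t.1` and
output `t.2`. -/
def prob (S : Strategy k D) (X : Fin k → D) (t : History k × Bool) : ℝ≥0∞ :=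
  S.reach X t.1 * S.coord t.1 (Sum.inl t.2)

end Strategy

/-- A private-coin randomized protocol in the coordinator model with a Boolean output: on every
input the execution stops with probability `1`. -/
structure Protocol (k : ℕ) (D : Type) extends Strategy k D where
  halts : ∀ X : Fin k → D, ∑' t, toStrategy.prob X t = 1

namespace Protocol

variable {k : ℕ} {D : Type}

/-- The joint distribution of the transcript and the output on input `X`. -/
def law (P : Protocol k D) (X : Fin k → D) : PMF (History k × Bool) :=
  ⟨P.prob X, ENNReal.summable.hasSum_iff.2 (P.halts X)⟩

/-- `P` computes `f` with error at most `δ`: on every input, the coordinator outputs a wrong answer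
with probability at most `δ`. -/
def HasError (P : Protocol k D) (f : (Fin k → D) → Bool) (δ : ℝ) : Prop :=
  ∀ X, (P.law X).map Prod.snd (!(f X)) ≤ ENNReal.ofReal δ

/-- The communication complexity of a protocol: the maximal number of bits exchanged, over all
inputs and all executions of positive probability. -/
def cost (P : Protocol k D) : ℕ∞ :=
  ⨆ X : Fin k → D, ⨆ t ∈ (P.law X).support, (bits t.1 : ℕ∞)

/-- The joint distribution of the input, drawn from `ζ`, and of the transcript. -/
def joint (P : Protocol k D) (ζ : PMF (Fin k → D)) : PMF ((Fin k → D) × History k) :=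
  ζ.bind fun X => (P.law X).map fun t => (X, t.1)

/-- The internal information cost
`I(X ; Π(X)) + ∑ᵢ I(X⁻ⁱ ; Πⁱ(X) | Xⁱ)` of a protocol `Π` with respect to `ζ`. -/
def infoCost [Fintype D] (P : Protocol k D) (ζ : PMF (Fin k → D)) : ℝ :=
  Info.mutualInfo (P.joint ζ) (fun ω => ω.1) (fun ω => ω.2) +
    ∑ i : Fin k, Info.condMutualInfo (P.joint ζ)
      (fun ω => fun l : {l : Fin k // l ≠ i} => ω.1 l) (fun ω => chan i ω.2) (fun ω => ω.1 i)

end Protocol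

/-- The `δ`-error randomized communication complexity of `f` in the coordinator model. -/
def CC {k : ℕ} {D : Type} (δ : ℝ) (f : (Fin k → D) → Bool) : ℕ∞ :=
  ⨅ (P : Protocol k D) (_ : P.HasError f δ), P.cost

/-- The internal information complexity of `f` with respect to `ζ`: the infimum of the internal
information cost over all `δ`-error protocols. -/
def IC {k : ℕ} {D : Type} [Fintype D] (ζ : PMF (Fin k → D)) (δ : ℝ)
    (f : (Fin k → D) → Bool) : EReal :=
  ⨅ (P : Protocol k D) (_ : P.HasError f δ), (P.infoCost ζ : EReal)

end Coordinator

/-! ## Set Disjointness and its hard distribution -/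

/-- `DISJ_{n,k}(X¹, …, Xᵏ) = ⋁ⱼ ⋀ᵢ Xⁱⱼ`. -/
def disj (n k : ℕ) (X : Fin k → Fin n → Bool) : Bool :=
  decide (∃ j, ∀ i, X i j = true)

namespace HardDist

/-- The mode `M`, with `Pr[M = 0] = 2/3` and `Pr[M = 1] = 1/3`. -/
def mode : PMF Bool :=
  PMF.ofFintype (fun m => if m then 1 / 3 else 2 / 3) (by
    rw [Fintype.sum_bool]
    simp only [if_true, Bool.false_eq_true, if_false]
    rw [← ENNReal.add_div, show (1 : ℝ≥0∞) + 2 = 3 by norm_num]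
    exact ENNReal.div_self (by norm_num) (by norm_num))

/-- The distribution of the `k` input bits of one coordinate given `M = m` and `Z = z`: uniform if
`m = 0`; if `m = 1`, player `z` has the bit `0` and all others have `1`. -/
def bitsGiven (k : ℕ) (m : Bool) (z : Fin k) : PMF (Fin k → Bool) :=
  if m then PMF.pure (fun i => decide (i ≠ z)) else PMF.uniformOfFintype (Fin k → Bool)

/-- The distribution `ξ` of `(X, M, Z)` for one coordinate: `M` and the uniformly distributed `Z`
are independent, and `X` is drawn given them. -/
def xi (k : ℕ) [NeZero k] : PMF ((Fin k → Bool) × Bool × Fin k) :=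
  mode.bind fun m => (PMF.uniformOfFintype (Fin k)).bind fun z =>
    (bitsGiven k m z).map fun x => (x, m, z)

/-- The product distribution `p ^ n`. -/
def iid {α : Type} [Fintype α] (p : PMF α) (n : ℕ) : PMF (Fin n → α) :=
  PMF.ofFintype (fun w => ∏ j, p (w j)) (by
    rw [← Fintype.prod_sum (fun (_ : Fin n) a => p a), ← tsum_fintype (L := .unconditional _),
      p.tsum_coe, Finset.prod_const_one])

/-- The hard distribution `η = ξ ^ n` of the triples `(X_j, M_j, Z_j)`, `j ∈ [n]`. -/
def eta (n k : ℕ) [NeZero k] : PMF (Fin n → (Fin k → Bool) × Bool × Fin k) :=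
  iid (xi k) n

/-- The marginal `ζ` of `η` on the inputs; player `i` receives the `i`-th bits of all `X_j`. -/
def zeta (n k : ℕ) [NeZero k] : PMF (Fin k → Fin n → Bool) :=
  (eta n k).map fun w i j => (w j).1 i

end HardDist

end

/-! A protocol for `disj` must, in a constant fraction of the coordinates, tell the column of ones
from every other column. Each such coordinate forces information of order `k`, and information is
superadditive over coordinates.

One coordinate. The law of the transcript given the column factors over the players (`Rectangular`),
and the squared Hellinger distance of two distributions depends only on their pointwise product. Let
`e_z` be the column with its only `0` at `z`, and `e_iz` the one with zeros at `i` and `z`. The laws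
at `1` and `e_iz` have the same product as those at `e_i` and `e_z`, so the distance of the first
pair equals that of the second, which is bounded by passing through `e_iz`. Changing bit `i` of
`e_z` is seen by player `i`; cut-and-paste on its views bounds the effect by `inputDist` (its own
bit changes, the others are uniform) and `modeDist` (its bit is `1`, the others change from uniform
to `e_z`). Summing over pairs `i ≠ z` gives `card_mul_le`. The first quantity is paid for by `I(X ;
Π)`. The second is paid for by `I(X⁻ⁱ ; Πⁱ | Xⁱ)`, because the mode is a fair bit given `X_i = 1`
and `Z = z ≠ i`.

Direct sum. For coordinate `j` the transcript is extended by the earlier modes, the special players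
of the other coordinates and all later input bits. Its law still factors over the players: hidden
earlier bits are independent given mode and special player, and later bits are in the view of their
owner. The chain rule runs downwards in `j` for the bits (`superadditivity_bits`) and upwards for
the modes (`superadditivity_modes`); both follow from Gibbs' inequality in the form
`natEntropy_add_sum_le`.

Gap. Consider the event that the output is `true` and no later column is all ones. If column `j` is
all ones, the output is right to be `true`. Otherwise it is wrong unless an earlier column is all
ones, which is unlikely for `j` below a constant times `2 ^ k`. As `n ≤ 2 ^ k`, this covers a
constant fraction of the coordinates (`coordInfo_ge`).

Communication. By Kraft's inequality the information cost is at most a constant times the number of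
bits, up to an additive `k s` with `s > 0` arbitrarily small (`infoCost_mul_log_le`). -/

noncomputable section

/-! ## Entropy as an expectation with values in `ℝ≥0∞` -/

namespace Info

variable {Ω α β γ ι : Type}

/-- The expectation of a nonnegative function. -/
def expect (μ : PMF Ω) (f : Ω → ℝ≥0∞) : ℝ≥0∞ := ∑' ω, μ ω * f ω

lemma expect_comp (μ : PMF Ω) (A : Ω → α) (g : α → ℝ≥0∞) :
    expect μ (fun ω => g (A ω)) = ∑' a, μ.map A a * g a := by
  classical
  simp only [expect, PMF.map_apply, ← ENNReal.tsum_mul_right]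
  rw [ENNReal.tsum_comm]
  refine tsum_congr fun ω => ?_
  rw [tsum_eq_single (A ω)]
  · simp
  · intro a ha
    simp [ha]

lemma expect_add (μ : PMF Ω) (f g : Ω → ℝ≥0∞) :
    expect μ (fun ω => f ω + g ω) = expect μ f + expect μ g := by
  simp only [expect, mul_add, ENNReal.tsum_add]

lemma expect_sum (μ : PMF Ω) (s : Finset ι) (f : ι → Ω → ℝ≥0∞) :
    expect μ (fun ω => ∑ i ∈ s, f i ω) = ∑ i ∈ s, expect μ (f i) := by
  simp only [expect, Finset.mul_sum]
  exact Summable.tsum_finsetSum fun _ _ => ENNReal.summable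

lemma expect_const (μ : PMF Ω) (c : ℝ≥0∞) : expect μ (fun _ => c) = c := by
  simp [expect, ENNReal.tsum_mul_right, μ.tsum_coe]

lemma expect_mono {μ : PMF Ω} {f g : Ω → ℝ≥0∞} (h : ∀ ω, μ ω ≠ 0 → f ω ≤ g ω) :
    expect μ f ≤ expect μ g := by
  refine ENNReal.tsum_le_tsum fun ω => ?_
  by_cases hω : μ ω = 0
  · simp [hω]
  · gcongr
    exact h ω hω

/-- Gibbs' inequality, in the form of a comparison of expectations. -/
lemma expect_le_of_ratio {μ : PMF Ω} {f g r : Ω → ℝ≥0∞} (h : ∀ ω, μ ω ≠ 0 → f ω + 1 ≤ g ω + r ω)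
    (hr : expect μ r ≤ 1) : expect μ f ≤ expect μ g := by
  -- The hypothesis is `f ≤ g + log r` weakened by `1 + log r ≤ r`, in a form without subtraction;
  -- `r` is a likelihood ratio of mean at most `1`.
  have h1 : expect μ f + 1 ≤ expect μ g + 1 := by
    calc expect μ f + 1 = expect μ (fun ω => f ω + 1) := by rw [expect_add, expect_const]
      _ ≤ expect μ (fun ω => g ω + r ω) := expect_mono h
      _ = expect μ g + expect μ r := expect_add _ _ _
      _ ≤ expect μ g + 1 := by gcongr
  exact (ENNReal.add_le_add_iff_right ENNReal.one_ne_top).1 h1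

lemma map_apply_ne_zero {μ : PMF Ω} (A : Ω → α) {ω : Ω} (h : μ ω ≠ 0) : μ.map A (A ω) ≠ 0 := by
  have : A ω ∈ (μ.map A).support :=
    (PMF.mem_support_map_iff _ _ _).2 ⟨ω, (PMF.mem_support_iff _ _).2 h, rfl⟩
  exact (PMF.mem_support_iff _ _).1 this

lemma map_apply_comp [DecidableEq β] (μ : PMF Ω) (A : Ω → α) (f : α → β) (b : β) :
    μ.map (fun ω => f (A ω)) b = ∑' a, if f a = b then μ.map A a else 0 := by
  have : μ.map (fun ω => f (A ω)) = (μ.map A).map f := by rw [PMF.map_comp]; rfl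
  rw [this, PMF.map_apply]
  refine tsum_congr fun a => ?_
  by_cases h : f a = b
  · rw [if_pos h.symm, if_pos h]
  · rw [if_neg (Ne.symm h), if_neg h]

lemma map_apply_le_comp (μ : PMF Ω) (A : Ω → α) (f : α → β) (a : α) :
    μ.map A a ≤ μ.map (fun ω => f (A ω)) (f a) := by
  classical
  rw [map_apply_comp μ A f]
  refine le_trans ?_ (ENNReal.le_tsum a)
  simp

lemma tsum_map_pair_left (μ : PMF Ω) (A : Ω → α) (B : Ω → β) (b : β) :
    ∑' a, μ.map (fun ω => (A ω, B ω)) (a, b) = μ.map B b := by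
  classical
  have := map_apply_comp μ (fun ω => (A ω, B ω)) Prod.snd b
  simp only at this
  rw [this, ENNReal.tsum_prod']
  refine tsum_congr fun a => ?_
  rw [tsum_eq_single b]
  · simp
  · intro b' hb
    simp [hb]

lemma map_pair_le_right (μ : PMF Ω) (A : Ω → α) (B : Ω → β) (a : α) (b : β) :
    μ.map (fun ω => (A ω, B ω)) (a, b) ≤ μ.map B b :=
  map_apply_le_comp μ (fun ω => (A ω, B ω)) Prod.snd (a, b)

/-- The conditional probability with values in `ℝ≥0∞`. -/
def cprob (μ : PMF Ω) (A : Ω → α) (B : Ω → β) (a : α) (b : β) : ℝ≥0∞ :=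
  μ.map (fun ω => (A ω, B ω)) (a, b) / μ.map B b

lemma condProb_eq (μ : PMF Ω) (A : Ω → α) (B : Ω → β) (a : α) (b : β) :
    condProb μ A B a b = (cprob μ A B a b).toReal := by
  rw [condProb, cprob, ENNReal.toReal_div]

lemma cprob_le_one (μ : PMF Ω) (A : Ω → α) (B : Ω → β) (a : α) (b : β) : cprob μ A B a b ≤ 1 :=
  ENNReal.div_le_of_le_mul (by simpa using map_pair_le_right μ A B a b)

lemma cprob_ne_top (μ : PMF Ω) (A : Ω → α) (B : Ω → β) (a : α) (b : β) : cprob μ A B a b ≠ ∞ :=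
  ne_top_of_le_ne_top ENNReal.one_ne_top (cprob_le_one μ A B a b)

lemma tsum_cprob_le_one (μ : PMF Ω) (A : Ω → α) (B : Ω → β) (b : β) :
    ∑' a, cprob μ A B a b ≤ 1 := by
  simp only [cprob, div_eq_mul_inv, ENNReal.tsum_mul_right, tsum_map_pair_left]
  exact ENNReal.mul_inv_le_one _

lemma mul_cprob (μ : PMF Ω) (A : Ω → α) (B : Ω → β) (a : α) (b : β) :
    μ.map B b * cprob μ A B a b = μ.map (fun ω => (A ω, B ω)) (a, b) := by
  by_cases h : μ.map B b = 0
  · have := map_pair_le_right μ A B a b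
    rw [h, nonpos_iff_eq_zero] at this
    rw [h, this, zero_mul]
  · exact ENNReal.mul_div_cancel h (PMF.apply_ne_top _ _)

lemma cprob_ne_zero {μ : PMF Ω} {A : Ω → α} {B : Ω → β} {a : α} {b : β}
    (h : μ.map (fun ω => (A ω, B ω)) (a, b) ≠ 0) : cprob μ A B a b ≠ 0 := by
  intro h0
  apply h
  rw [← mul_cprob, h0, mul_zero]

/-- The self-information of the value `a` of `A` given `B = b`, in nats. -/
def surprisal (μ : PMF Ω) (A : Ω → α) (B : Ω → β) (a : α) (b : β) : ℝ≥0∞ :=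
  ENNReal.ofReal (-Real.log (cprob μ A B a b).toReal)

lemma neg_log_cprob_nonneg (μ : PMF Ω) (A : Ω → α) (B : Ω → β) (a : α) (b : β) :
    0 ≤ -Real.log (cprob μ A B a b).toReal := by
  rw [neg_nonneg]
  refine Real.log_nonpos ENNReal.toReal_nonneg ?_
  exact ENNReal.toReal_le_of_le_ofReal zero_le_one (by simpa using cprob_le_one μ A B a b)

/-- The conditional entropy in nats. -/
def natEntropy (μ : PMF Ω) (A : Ω → α) (B : Ω → β) : ℝ≥0∞ :=
  expect μ fun ω => surprisal μ A B (A ω) (B ω)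

lemma natEntropy_eq_tsum (μ : PMF Ω) (A : Ω → α) (B : Ω → β) :
    natEntropy μ A B =
      ∑' v : α × β, μ.map (fun ω => (A ω, B ω)) v * surprisal μ A B v.1 v.2 :=
  expect_comp μ (fun ω => (A ω, B ω)) (fun v => surprisal μ A B v.1 v.2)

lemma natEntropy_eq_tsum_sum [Fintype α] (μ : PMF Ω) (A : Ω → α) (B : Ω → β) :
    natEntropy μ A B =
      ∑' b, ENNReal.ofReal ((μ.map B b).toReal * ∑ a, Real.negMulLog (condProb μ A B a b)) := by
  rw [natEntropy_eq_tsum, ENNReal.tsum_prod', ENNReal.tsum_comm]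
  refine tsum_congr fun b => ?_
  rw [tsum_fintype, Finset.mul_sum, ENNReal.ofReal_sum_of_nonneg]
  · refine Finset.sum_congr rfl fun a _ => ?_
    rw [← mul_cprob, surprisal, condProb_eq, Real.negMulLog, ENNReal.ofReal_mul ENNReal.toReal_nonneg,
      ENNReal.ofReal_toReal (PMF.apply_ne_top _ _), neg_mul, ← mul_neg,
      ENNReal.ofReal_mul ENNReal.toReal_nonneg, ENNReal.ofReal_toReal (cprob_ne_top _ _ _ _ _),
      mul_assoc]
  · intro a _
    refine mul_nonneg ENNReal.toReal_nonneg (Real.negMulLog_nonneg ?_ ?_)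
    · rw [condProb_eq]; exact ENNReal.toReal_nonneg
    · rw [condProb_eq]
      exact ENNReal.toReal_le_of_le_ofReal zero_le_one (by simpa using cprob_le_one μ A B a b)

/-- Each term `-x log x` is at most `1`. Finiteness is what allows entropies to be cancelled and
moved to `ℝ`. -/
lemma natEntropy_ne_top [Fintype α] (μ : PMF Ω) (A : Ω → α) (B : Ω → β) :
    natEntropy μ A B ≠ ∞ := by
  rw [natEntropy_eq_tsum_sum]
  refine ne_top_of_le_ne_top (b := (Fintype.card α : ℝ≥0∞)) (ENNReal.natCast_ne_top _) ?_
  calc ∑' b, ENNReal.ofReal ((μ.map B b).toReal * ∑ a, Real.negMulLog (condProb μ A B a b))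
      ≤ ∑' b, μ.map B b * (Fintype.card α : ℝ≥0∞) := by
        refine ENNReal.tsum_le_tsum fun b => ?_
        rw [ENNReal.ofReal_mul ENNReal.toReal_nonneg, ENNReal.ofReal_toReal (PMF.apply_ne_top _ _)]
        gcongr
        rw [← ENNReal.ofReal_natCast]
        refine ENNReal.ofReal_le_ofReal ?_
        refine (Finset.sum_le_sum (g := fun _ => (1 : ℝ)) fun a _ => ?_).trans (by simp)
        rw [condProb_eq]
        have := Real.negMulLog_le_one_sub_self (x := (cprob μ A B a b).toReal)
          ENNReal.toReal_nonneg
        linarith [ENNReal.toReal_nonneg (a := cprob μ A B a b)]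
    _ = Fintype.card α := by rw [ENNReal.tsum_mul_right, PMF.tsum_coe, one_mul]

lemma condEntropy_eq [Fintype α] (μ : PMF Ω) (A : Ω → α) (B : Ω → β) :
    condEntropy μ A B = (natEntropy μ A B).toReal / Real.log 2 := by
  rw [natEntropy_eq_tsum_sum, ENNReal.tsum_toReal_eq (fun _ => ENNReal.ofReal_ne_top), condEntropy,
    ← tsum_div_const]
  refine tsum_congr fun b => ?_
  rw [ENNReal.toReal_ofReal, ← Finset.sum_div, mul_div_assoc]
  refine mul_nonneg ENNReal.toReal_nonneg (Finset.sum_nonneg fun a _ => Real.negMulLog_nonneg ?_ ?_)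
  · rw [condProb_eq]; exact ENNReal.toReal_nonneg
  · rw [condProb_eq]
    exact ENNReal.toReal_le_of_le_ofReal zero_le_one (by simpa using cprob_le_one μ A B a b)

lemma map_unit (μ : PMF Ω) : μ.map (fun _ => ()) () = 1 := by
  simp

lemma map_pair_unit (μ : PMF Ω) (A : Ω → α) (a : α) :
    μ.map (fun ω => (A ω, ())) (a, ()) = μ.map A a := by
  classical
  rw [map_apply_comp μ A (fun a => (a, ()))]
  rw [tsum_eq_single a]
  · simp
  · intro b hb
    simp [hb]

lemma cprob_unit (μ : PMF Ω) (A : Ω → α) (a : α) :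
    cprob μ A (fun _ => ()) a () = μ.map A a := by
  rw [cprob, map_pair_unit, map_unit, div_one]

lemma entropy_eq [Fintype α] (μ : PMF Ω) (A : Ω → α) :
    entropy μ A = (natEntropy μ A (fun _ => ())).toReal / Real.log 2 := by
  rw [← condEntropy_eq, condEntropy, tsum_fintype]
  simp [entropy, condProb_eq, cprob_unit]

/-- The variables may be moved along a map of probability spaces. -/
lemma natEntropy_map {Ω' : Type} (μ : PMF Ω) (φ : Ω → Ω') (A : Ω' → α) (B : Ω' → β) :
    natEntropy (μ.map φ) A B = natEntropy μ (fun ω => A (φ ω)) (fun ω => B (φ ω)) := by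
  rw [natEntropy_eq_tsum, natEntropy_eq_tsum]
  simp only [surprisal, cprob, PMF.map_comp]
  rfl

/-! ## Hellinger distance -/

/-- The contribution of one point to the squared Hellinger distance. -/
def hell (p q : ℝ≥0∞) : ℝ≥0∞ := ENNReal.ofReal ((√p.toReal - √q.toReal) ^ 2)

lemma hell_zero_left {q : ℝ≥0∞} (hq : q ≠ ∞) : hell 0 q = q := by
  simp [hell, Real.sq_sqrt ENNReal.toReal_nonneg, ENNReal.ofReal_toReal hq]

/-- Pointwise form of the fact that divergence dominates squared Hellinger distance: `p log (p / s)
≥ (√p - √s)² + p - s` follows from `log t ≤ t - 1` at `t = √s / √p`. -/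
lemma add_hell_le {p s L L' : ℝ} (hp : 0 < p) (hs : 0 < s)
    (h : L' = L + Real.log (p / s)) :
    p * L + (√p - √s) ^ 2 + p ≤ p * L' + s := by
  have hsp := Real.sqrt_pos.2 hp
  have hss := Real.sqrt_pos.2 hs
  have h1 : Real.log (s / p) = 2 * Real.log (√s / √p) := by
    rw [← Real.sqrt_div hs.le, Real.log_sqrt (div_pos hs hp).le]; ring
  have h2 : Real.log (√s / √p) ≤ √s / √p - 1 := Real.log_le_sub_one_of_pos (div_pos hss hsp)
  have h3 : Real.log (p / s) = - Real.log (s / p) := by rw [← Real.log_inv, inv_div]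
  have h4 : p * (√s / √p) = √s * √p := by
    have : p = √p * √p := (Real.mul_self_sqrt hp.le).symm
    calc p * (√s / √p) = (√p * √p) * (√s / √p) := by rw [← this]
      _ = √s * √p := by field_simp
  rw [h, h3, h1]
  have h5 : (√p - √s) ^ 2 = p + s - 2 * (√s * √p) := by
    rw [sub_sq, Real.sq_sqrt hp.le, Real.sq_sqrt hs.le]; ring
  rw [h5]
  nlinarith [mul_le_mul_of_nonneg_left h2 hp.le]

/-- Conditioning on less increases entropy, with a lower bound for the increase. -/
theorem natEntropy_add_hell_le (μ : PMF Ω) (A : Ω → α) (B : Ω → β) (f : β → γ) :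
    natEntropy μ A B + ∑' v : α × β, hell (μ.map (fun ω => (A ω, B ω)) v)
        (μ.map B v.2 * cprob μ A (fun ω => f (B ω)) v.1 (f v.2)) ≤
      natEntropy μ A (fun ω => f (B ω)) := by
  -- `s` is the law that `(A, B)` would have if `A` depended on `B` only through `f B`; the entropy
  -- difference is the divergence of the true law from it.
  set s : α × β → ℝ≥0∞ := fun v => μ.map B v.2 * cprob μ A (fun ω => f (B ω)) v.1 (f v.2) with hs
  have hsum : ∑' v, s v ≤ 1 := by
    rw [ENNReal.tsum_prod', ENNReal.tsum_comm]
    calc ∑' b, ∑' a, s (a, b) ≤ ∑' b, μ.map B b := by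
          refine ENNReal.tsum_le_tsum fun b => ?_
          simp only [hs, ENNReal.tsum_mul_left]
          exact mul_le_of_le_one_right' (tsum_cprob_le_one _ _ _ _)
      _ = 1 := PMF.tsum_coe _
  have hle : natEntropy μ A (fun ω => f (B ω)) =
      ∑' v : α × β, μ.map (fun ω => (A ω, B ω)) v *
        surprisal μ A (fun ω => f (B ω)) v.1 (f v.2) :=
    expect_comp μ (fun ω => (A ω, B ω)) (fun v => surprisal μ A (fun ω => f (B ω)) v.1 (f v.2))
  -- The `1` is the total mass of the true law. Together with the mass of `s` on the right it allows
  -- a comparison term by term.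
  have key : natEntropy μ A B + ∑' v, hell (μ.map (fun ω => (A ω, B ω)) v) (s v) + 1 ≤
      natEntropy μ A (fun ω => f (B ω)) + ∑' v, s v := by
    rw [hle, natEntropy_eq_tsum, ← (μ.map (fun ω => (A ω, B ω))).tsum_coe, ← ENNReal.tsum_add,
      ← ENNReal.tsum_add, ← ENNReal.tsum_add]
    refine ENNReal.tsum_le_tsum fun v => ?_
    obtain ⟨a, b⟩ := v
    have hsfin : s (a, b) ≠ ∞ := ENNReal.mul_ne_top (PMF.apply_ne_top _ _) (cprob_ne_top _ _ _ _ _)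
    by_cases hp : μ.map (fun ω => (A ω, B ω)) (a, b) = 0
    · rw [hp, hell_zero_left hsfin]
      simp
    · have hb : μ.map B b ≠ 0 := fun h => hp (by
        have := map_pair_le_right μ A B a b
        rwa [h, nonpos_iff_eq_zero] at this)
      have hc : cprob μ A B a b ≠ 0 := cprob_ne_zero hp
      have hc' : cprob μ A (fun ω => f (B ω)) a (f b) ≠ 0 := by
        refine cprob_ne_zero fun h => hp ?_
        have := map_apply_le_comp μ (fun ω => (A ω, B ω)) (fun v => (v.1, f v.2)) (a, b)
        simp only at this
        rwa [h, nonpos_iff_eq_zero] at this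
      have hp0 := ENNReal.toReal_pos hp (PMF.apply_ne_top _ _)
      have hb0 := ENNReal.toReal_pos hb (PMF.apply_ne_top _ _)
      have hc0 := ENNReal.toReal_pos hc (cprob_ne_top _ _ _ _ _)
      have hc0' := ENNReal.toReal_pos hc' (cprob_ne_top _ _ _ _ _)
      have hsr : (s (a, b)).toReal =
          (μ.map B b).toReal * (cprob μ A (fun ω => f (B ω)) a (f b)).toReal := by
        rw [hs, ENNReal.toReal_mul]
      have hs0 : 0 < (s (a, b)).toReal := by rw [hsr]; positivity
      have hpr : (μ.map (fun ω => (A ω, B ω)) (a, b)).toReal =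
          (μ.map B b).toReal * (cprob μ A B a b).toReal := by
        rw [← mul_cprob, ENNReal.toReal_mul]
      have := add_hell_le hp0 hs0
        (L := -Real.log (cprob μ A B a b).toReal)
        (L' := -Real.log (cprob μ A (fun ω => f (B ω)) a (f b)).toReal) (by
          rw [hpr, hsr, mul_div_mul_left _ _ hb0.ne', Real.log_div hc0.ne' hc0'.ne']; ring)
      have h2 := ENNReal.ofReal_le_ofReal this
      have n1 := neg_log_cprob_nonneg μ A B a b
      have n2 := neg_log_cprob_nonneg μ A (fun ω => f (B ω)) a (f b)
      rw [ENNReal.ofReal_add (by positivity) hp0.le, ENNReal.ofReal_add (by positivity) (by positivity),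
        ENNReal.ofReal_add (by positivity) hs0.le, ENNReal.ofReal_mul hp0.le,
        ENNReal.ofReal_mul hp0.le, ENNReal.ofReal_toReal (PMF.apply_ne_top _ _),
        ENNReal.ofReal_toReal hsfin] at h2
      exact h2
  have : natEntropy μ A B + ∑' v, hell (μ.map (fun ω => (A ω, B ω)) v) (s v) + 1 ≤
      natEntropy μ A (fun ω => f (B ω)) + 1 := key.trans (by gcongr)
  exact (ENNReal.add_le_add_iff_right ENNReal.one_ne_top).1 this

end Info

/-! ### Consequences of Gibbs' inequality: codes and superadditivity -/

namespace Info

variable {Ω α β γ ι κ ν υ σ ψ : Type}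

lemma ofReal_add_one_le {f g r : ℝ} (hf : 0 ≤ f) (hg : 0 ≤ g) (hr : 0 < r)
    (h : f ≤ g + Real.log r) :
    ENNReal.ofReal f + 1 ≤ ENNReal.ofReal g + ENNReal.ofReal r := by
  rw [← ENNReal.ofReal_one, ← ENNReal.ofReal_add hf zero_le_one, ← ENNReal.ofReal_add hg hr.le]
  exact ENNReal.ofReal_le_ofReal (by linarith [Real.log_le_sub_one_of_pos hr])

/-- A code for `B` bounds the information that `B` reveals. -/
theorem natEntropy_le_add_expect (μ : PMF Ω) (A : Ω → α) (B : Ω → β) (C : Ω → γ) (L : β → ℝ)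
    (hL : ∀ b, 0 ≤ L b) (q : β → ℝ≥0∞) (hq : ∑' b, q b ≤ 1)
    (h : ∀ a b c, μ.map (fun ω => (A ω, B ω, C ω)) (a, b, c) ≤
      μ.map (fun ω => (A ω, C ω)) (a, c) * (ENNReal.ofReal (Real.exp (L b)) * q b)) :
    natEntropy μ A C ≤ natEntropy μ A (fun ω => (B ω, C ω)) +
      expect μ (fun ω => ENNReal.ofReal (L (B ω))) := by
  -- `ρ` is the code `q` divided by the conditional law of `B` given `C`, so its mean is at most `∑
  -- q`.
  set ρ : β × γ → ℝ≥0∞ := fun v => q v.1 * μ.map C v.2 / μ.map (fun ω => (B ω, C ω)) v with hρ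
  rw [natEntropy, natEntropy, ← expect_add]
  refine expect_le_of_ratio (r := fun ω => ρ (B ω, C ω)) (fun ω hω => ?_) ?_
  · have hbc := map_apply_ne_zero (fun ω => (B ω, C ω)) hω
    have hc := map_apply_ne_zero C hω
    have hac := map_apply_ne_zero (fun ω => (A ω, C ω)) hω
    have habc := map_apply_ne_zero (fun ω => (A ω, B ω, C ω)) hω
    have hle := h (A ω) (B ω) (C ω)
    have hq0 : q (B ω) ≠ 0 := fun h0 => habc (by
      rw [h0, mul_zero, mul_zero, nonpos_iff_eq_zero] at hle
      exact hle)
    have hq1 : q (B ω) ≠ ∞ :=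
      ne_top_of_le_ne_top ENNReal.one_ne_top ((ENNReal.le_tsum _).trans hq)
    have hle' := ENNReal.toReal_mono (ENNReal.mul_ne_top (PMF.apply_ne_top _ _)
      (ENNReal.mul_ne_top ENNReal.ofReal_ne_top hq1)) hle
    rw [ENNReal.toReal_mul, ENNReal.toReal_mul, ENNReal.toReal_ofReal (Real.exp_pos _).le] at hle'
    have pbc := ENNReal.toReal_pos hbc (PMF.apply_ne_top _ _)
    have pc := ENNReal.toReal_pos hc (PMF.apply_ne_top _ _)
    have pac := ENNReal.toReal_pos hac (PMF.apply_ne_top _ _)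
    have pabc := ENNReal.toReal_pos habc (PMF.apply_ne_top _ _)
    have pq := ENNReal.toReal_pos hq0 hq1
    have hρr : (ρ (B ω, C ω)).toReal = (q (B ω)).toReal * (μ.map C (C ω)).toReal /
        (μ.map (fun ω => (B ω, C ω)) (B ω, C ω)).toReal := by
      rw [hρ, ENNReal.toReal_div, ENNReal.toReal_mul]
    have hρ1 : ρ (B ω, C ω) ≠ ∞ :=
      ENNReal.div_ne_top (ENNReal.mul_ne_top hq1 (PMF.apply_ne_top _ _)) hbc
    rw [← ENNReal.ofReal_toReal hρ1, surprisal, surprisal,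
      ← ENNReal.ofReal_add (neg_log_cprob_nonneg _ _ _ _ _) (hL _)]
    refine ofReal_add_one_le (neg_log_cprob_nonneg _ _ _ _ _)
      (add_nonneg (neg_log_cprob_nonneg _ _ _ _ _) (hL _)) (by rw [hρr]; positivity) ?_
    rw [hρr, cprob, cprob, ENNReal.toReal_div, ENNReal.toReal_div,
      Real.log_div pac.ne' pc.ne', Real.log_div pabc.ne' pbc.ne',
      Real.log_div (by positivity) pbc.ne', Real.log_mul pq.ne' pc.ne']
    have := Real.log_le_log pabc hle'
    rw [Real.log_mul pac.ne' (by positivity), Real.log_mul (Real.exp_pos _).ne' pq.ne',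
      Real.log_exp] at this
    linarith
  · rw [expect_comp μ (fun ω => (B ω, C ω)) ρ]
    calc ∑' v, μ.map (fun ω => (B ω, C ω)) v * ρ v
        ≤ ∑' v : β × γ, q v.1 * μ.map C v.2 := ENNReal.tsum_le_tsum fun v => ENNReal.mul_div_le
      _ ≤ 1 := by
          rw [ENNReal.tsum_prod']
          simp only [ENNReal.tsum_mul_left, PMF.tsum_coe, mul_one]
          exact hq

/-- Superadditivity of information over conditionally independent targets `T s`. -/
theorem natEntropy_add_sum_le [Fintype ι] (μ : PMF Ω) (V : Ω → ν) (B : Ω → β)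
    (fA : ν → α) (fC : υ → γ) (fY : ν → υ) (fT : ν → ι → κ) (h : ι → υ → σ)
    (g : ι → β → υ → (ι → κ) → ψ)
    (hM : ∀ v b, μ.map (fun ω => (V ω, B ω)) (v, b) *
        μ.map (fun ω => (fA (V ω), fC (fY (V ω)))) (fA v, fC (fY v)) ≤
      μ.map V v * μ.map (fun ω => (fA (V ω), B ω, fC (fY (V ω)))) (fA v, b, fC (fY v)))
    (hT : ∀ y t, μ.map (fun ω => (fY (V ω), fT (V ω))) (y, t) ≤ μ.map (fun ω => fY (V ω)) y *
      ∏ s, cprob μ (fun ω => fT (V ω) s) (fun ω => h s (fY (V ω))) (t s) (h s y))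
    (hB : ∀ b y, ∑' t, ∏ s, cprob μ (fun ω => fT (V ω) s)
      (fun ω => g s (B ω) (fY (V ω)) (fT (V ω))) (t s) (g s b y t) ≤ 1) :
    natEntropy μ (fun ω => fA (V ω)) (fun ω => (B ω, fC (fY (V ω)))) +
        ∑ s, natEntropy μ (fun ω => fT (V ω) s) (fun ω => h s (fY (V ω))) ≤
      natEntropy μ (fun ω => fA (V ω)) (fun ω => fC (fY (V ω))) +
        ∑ s, natEntropy μ (fun ω => fT (V ω) s)
          (fun ω => g s (B ω) (fY (V ω)) (fT (V ω))) := by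
  -- `P1` dominates the law of the targets given `Y`. `P2` is the product of the predictions made
  -- with the help of `B`, a subprobability in `t` by `hB`.
  set P1 : υ → (ι → κ) → ℝ≥0∞ := fun y t =>
    ∏ s, cprob μ (fun ω => fT (V ω) s) (fun ω => h s (fY (V ω))) (t s) (h s y) with hP1
  set P2 : β → υ → (ι → κ) → ℝ≥0∞ := fun b y t => ∏ s, cprob μ (fun ω => fT (V ω) s)
      (fun ω => g s (B ω) (fY (V ω)) (fT (V ω))) (t s) (g s b y t) with hP2
  set c1 : ν → β → ℝ≥0∞ := fun v b =>
    cprob μ (fun ω => fA (V ω)) (fun ω => (B ω, fC (fY (V ω)))) (fA v) (b, fC (fY v)) with hc1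
  set c2 : ν → ℝ≥0∞ := fun v =>
    cprob μ (fun ω => fA (V ω)) (fun ω => fC (fY (V ω))) (fA v) (fC (fY v)) with hc2
  set ρ : ν × β → ℝ≥0∞ := fun v => (c2 v.1 / c1 v.1 v.2) *
    (P2 v.2 (fY v.1) (fT v.1) / P1 (fY v.1) (fT v.1)) with hρ
  simp only [natEntropy]
  rw [← expect_sum, ← expect_sum, ← expect_add, ← expect_add]
  refine expect_le_of_ratio (r := fun ω => ρ (V ω, B ω)) (fun ω hω => ?_) ?_
  · have n1 : c1 (V ω) (B ω) ≠ 0 := cprob_ne_zero (map_apply_ne_zero _ hω)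
    have n2 : c2 (V ω) ≠ 0 := cprob_ne_zero (map_apply_ne_zero _ hω)
    have n3 : ∀ s, cprob μ (fun ω => fT (V ω) s) (fun ω => h s (fY (V ω))) (fT (V ω) s)
      (h s (fY (V ω))) ≠ 0 := fun s =>
        cprob_ne_zero (map_apply_ne_zero (fun ω => (fT (V ω) s, h s (fY (V ω)))) hω)
    have n4 : ∀ s, cprob μ (fun ω => fT (V ω) s)
      (fun ω => g s (B ω) (fY (V ω)) (fT (V ω))) (fT (V ω) s)
        (g s (B ω) (fY (V ω)) (fT (V ω))) ≠ 0 := fun s => cprob_ne_zero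
        (map_apply_ne_zero (fun ω => (fT (V ω) s, g s (B ω) (fY (V ω)) (fT (V ω)))) hω)
    have p1 := ENNReal.toReal_pos n1 (cprob_ne_top _ _ _ _ _)
    have p2 := ENNReal.toReal_pos n2 (cprob_ne_top _ _ _ _ _)
    have p3 := fun s => ENNReal.toReal_pos (n3 s) (cprob_ne_top _ _ _ _ _)
    have p4 := fun s => ENNReal.toReal_pos (n4 s) (cprob_ne_top _ _ _ _ _)
    have nP1 : P1 (fY (V ω)) (fT (V ω)) ≠ 0 := Finset.prod_ne_zero_iff.2 fun s _ => n3 s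
    have tP2 : P2 (B ω) (fY (V ω)) (fT (V ω)) ≠ ∞ :=
      ENNReal.prod_ne_top fun s _ => cprob_ne_top _ _ _ _ _
    have hρ1 : ρ (V ω, B ω) ≠ ∞ := ENNReal.mul_ne_top
      (ENNReal.div_ne_top (cprob_ne_top _ _ _ _ _) n1) (ENNReal.div_ne_top tP2 nP1)
    rw [← ENNReal.ofReal_toReal hρ1]
    simp only [surprisal]
    have e1 := neg_log_cprob_nonneg μ (fun ω => fA (V ω)) (fun ω => (B ω, fC (fY (V ω))))
      (fA (V ω)) (B ω, fC (fY (V ω)))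
    have e2 := neg_log_cprob_nonneg μ (fun ω => fA (V ω)) (fun ω => fC (fY (V ω)))
      (fA (V ω)) (fC (fY (V ω)))
    rw [← ENNReal.ofReal_sum_of_nonneg fun s _ => neg_log_cprob_nonneg _ _ _ _ _,
      ← ENNReal.ofReal_sum_of_nonneg fun s _ => neg_log_cprob_nonneg _ _ _ _ _,
      ← ENNReal.ofReal_add e1 (Finset.sum_nonneg fun s _ => neg_log_cprob_nonneg _ _ _ _ _),
      ← ENNReal.ofReal_add e2 (Finset.sum_nonneg fun s _ => neg_log_cprob_nonneg _ _ _ _ _)]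
    have q3 := Finset.prod_pos fun s (_ : s ∈ Finset.univ) => p3 s
    have q4 := Finset.prod_pos fun s (_ : s ∈ Finset.univ) => p4 s
    have hρr : (ρ (V ω, B ω)).toReal = ((c2 (V ω)).toReal / (c1 (V ω) (B ω)).toReal) *
        ((∏ s, (cprob μ (fun ω => fT (V ω) s)
      (fun ω => g s (B ω) (fY (V ω)) (fT (V ω))) (fT (V ω) s)
        (g s (B ω) (fY (V ω)) (fT (V ω)))).toReal) / ∏ s, (cprob μ (fun ω => fT (V ω) s)
        (fun ω => h s (fY (V ω))) (fT (V ω) s) (h s (fY (V ω)))).toReal) := by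
      simp only [hρ, ENNReal.toReal_mul, ENNReal.toReal_div, hP1, hP2, ENNReal.toReal_prod]
    refine ofReal_add_one_le (add_nonneg e1 (Finset.sum_nonneg
        fun s _ => neg_log_cprob_nonneg _ _ _ _ _)) (add_nonneg e2 (Finset.sum_nonneg
        fun s _ => neg_log_cprob_nonneg _ _ _ _ _)) ?_ ?_
    · rw [hρr]
      exact mul_pos (div_pos p2 p1) (div_pos q4 q3)
    · rw [hρr, Real.log_mul (div_pos p2 p1).ne' (div_pos q4 q3).ne', Real.log_div p2.ne' p1.ne',
        Real.log_div q4.ne' q3.ne', Real.log_prod fun s _ => (p4 s).ne',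
        Real.log_prod fun s _ => (p3 s).ne']
      simp only [Finset.sum_neg_distrib]
      simp only [hc1, hc2]
      linarith
  · rw [expect_comp μ (fun ω => (V ω, B ω)) ρ]
    set Φ : υ × (ι → κ) → ℝ≥0∞ := fun w => ∑' b, cprob μ B (fun ω => fC (fY (V ω))) b (fC w.1) *
      (P2 b w.1 w.2 / P1 w.1 w.2) with hΦ
    -- `hM` says that `B` depends on `V` only through `A` and `C`. Hence `c2 / c1` turns the law of
    -- `B` given `V` into its law given `C`, a function of `Y`; after that `B` no longer involves
    -- the targets, and `P2` can be summed over `t`.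
    have step1 : ∀ v b, μ.map (fun ω => (V ω, B ω)) (v, b) * (c2 v / c1 v b) ≤
        μ.map V v * cprob μ B (fun ω => fC (fY (V ω))) b (fC (fY v)) := by
      intro v b
      by_cases h0 : μ.map (fun ω => (V ω, B ω)) (v, b) = 0
      · simp [h0]
      have habc : μ.map (fun ω => (fA (V ω), B ω, fC (fY (V ω)))) (fA v, b, fC (fY v)) ≠ 0 := by
        intro h1
        have := map_apply_le_comp μ (fun ω => (V ω, B ω))
          (fun u => (fA u.1, u.2, fC (fY u.1))) (v, b)
        simp only [h1, nonpos_iff_eq_zero] at this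
        exact h0 this
      have hbc : μ.map (fun ω => (B ω, fC (fY (V ω)))) (b, fC (fY v)) ≠ 0 := fun h1 => habc (by
        have := map_pair_le_right μ (fun ω => fA (V ω)) (fun ω => (B ω, fC (fY (V ω))))
          (fA v) (b, fC (fY v))
        rwa [h1, nonpos_iff_eq_zero] at this)
      have := hM v b
      simp only [hc1, hc2, cprob]
      set x := μ.map (fun ω => (V ω, B ω)) (v, b)
      set y := μ.map (fun ω => (fA (V ω), fC (fY (V ω)))) (fA v, fC (fY v))
      set z := μ.map (fun ω => (fA (V ω), B ω, fC (fY (V ω)))) (fA v, b, fC (fY v))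
      set w := μ.map (fun ω => (B ω, fC (fY (V ω)))) (b, fC (fY v))
      set u := μ.map (fun ω => fC (fY (V ω))) (fC (fY v))
      have hz : z ≠ ∞ := PMF.apply_ne_top _ _
      have hw : w ≠ ∞ := PMF.apply_ne_top _ _
      calc x * (y / u / (z / w)) = (x * y) / z * (w / u) := by
            rw [div_eq_mul_inv (y / u), ENNReal.inv_div (Or.inl hw) (Or.inl hbc)]
            simp only [div_eq_mul_inv]; ring
        _ ≤ (μ.map V v * z) / z * (w / u) := by gcongr
        _ = μ.map V v * (w / u) := by rw [ENNReal.mul_div_cancel_right habc hz]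
    calc ∑' v, μ.map (fun ω => (V ω, B ω)) v * ρ v
        = ∑' v, ∑' b, μ.map (fun ω => (V ω, B ω)) (v, b) * ρ (v, b) := ENNReal.tsum_prod'
      _ ≤ ∑' v, μ.map V v * Φ (fY v, fT v) := by
          refine ENNReal.tsum_le_tsum fun v => ?_
          rw [hΦ, ← ENNReal.tsum_mul_left]
          refine ENNReal.tsum_le_tsum fun b => ?_
          simp only [hρ]
          rw [← mul_assoc, ← mul_assoc]
          exact mul_le_mul_left (step1 v b) _
      _ = ∑' w, μ.map (fun ω => (fY (V ω), fT (V ω))) w * Φ w := by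
          rw [← expect_comp μ V (fun v => Φ (fY v, fT v)),
            ← expect_comp μ (fun ω => (fY (V ω), fT (V ω))) Φ]
      _ ≤ ∑' w : υ × (ι → κ), ∑' b, μ.map (fun ω => fY (V ω)) w.1 *
            (cprob μ B (fun ω => fC (fY (V ω))) b (fC w.1) * P2 b w.1 w.2) := by
          refine ENNReal.tsum_le_tsum fun w => ?_
          rw [hΦ, ← ENNReal.tsum_mul_left]
          refine ENNReal.tsum_le_tsum fun b => ?_
          have := hT w.1 w.2
          calc μ.map (fun ω => (fY (V ω), fT (V ω))) w *
                (cprob μ B (fun ω => fC (fY (V ω))) b (fC w.1) * (P2 b w.1 w.2 / P1 w.1 w.2))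
              = (μ.map (fun ω => (fY (V ω), fT (V ω))) w / P1 w.1 w.2) *
                (cprob μ B (fun ω => fC (fY (V ω))) b (fC w.1) * P2 b w.1 w.2) := by
                  simp only [div_eq_mul_inv]; ring
            _ ≤ _ := by
                gcongr
                exact ENNReal.div_le_of_le_mul this
      _ = ∑' y, μ.map (fun ω => fY (V ω)) y *
            ∑' b, cprob μ B (fun ω => fC (fY (V ω))) b (fC y) * ∑' t, P2 b y t := by
          rw [ENNReal.tsum_prod']
          refine tsum_congr fun y => ?_
          rw [ENNReal.tsum_comm, ← ENNReal.tsum_mul_left]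
          refine tsum_congr fun b => ?_
          simp only [ENNReal.tsum_mul_left]
      _ ≤ ∑' y, μ.map (fun ω => fY (V ω)) y * 1 := by
          refine ENNReal.tsum_le_tsum fun y => ?_
          refine mul_le_mul_right (le_trans (ENNReal.tsum_le_tsum fun b => ?_)
            (tsum_cprob_le_one μ B (fun ω => fC (fY (V ω))) (fC y))) _
          exact mul_le_of_le_one_right' (hB b y)
      _ = 1 := by simp only [mul_one, PMF.tsum_coe]

/-- A product of conditional probabilities that are given in increasing order is a
subprobability. -/
lemma sum_prod_le_one_of_lt [Fintype κ] : ∀ {n : ℕ} (q : Fin n → κ → (Fin n → κ) → ℝ≥0∞),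
    (∀ j a t t', (∀ l, l < j → t l = t' l) → q j a t = q j a t') →
    (∀ j t, ∑ a, q j a t ≤ 1) → ∑ t : Fin n → κ, ∏ j, q j (t j) t ≤ 1
  | 0, _, _, _ => by simp
  | n + 1, q, h1, h2 => by
    rw [← (Fin.consEquiv fun _ => κ).sum_comp, Fintype.sum_prod_type]
    -- The factor of coordinate `0` does not depend on the tail; with the head fixed, the other
    -- factors form a family of the same kind.
    have : ∀ (t0 : Fin (n + 1) → κ) (a : κ), ∑ t : Fin n → κ,
        ∏ j, q j ((Fin.cons a t : Fin (n + 1) → κ) j) (Fin.cons a t) ≤ q 0 a t0 := by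
      intro t0 a
      have hq0 : ∀ t : Fin n → κ, q 0 a (Fin.cons a t) = q 0 a t0 := fun t =>
        h1 0 a _ _ fun l hl => absurd hl (Fin.not_lt_zero l)
      simp only [Fin.prod_univ_succ, Fin.cons_zero, Fin.cons_succ, hq0]
      rw [← Finset.mul_sum]
      refine mul_le_of_le_one_right' ?_
      refine sum_prod_le_one_of_lt (fun j b t => q j.succ b (Fin.cons a t)) ?_ ?_
      · intro j b t t' htt
        refine h1 _ _ _ _ fun l hl => ?_
        refine Fin.cases (fun _ => rfl) (fun l hl => ?_) l hl
        simpa using htt l (Fin.succ_lt_succ_iff.1 hl)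
      · intro j t
        exact h2 _ _
    rcases isEmpty_or_nonempty κ with hκ | ⟨⟨x⟩⟩
    · simp
    · exact (Finset.sum_le_sum fun a _ => this (fun _ => x) a).trans (h2 0 _)

lemma sum_prod_le_one_of_gt [Fintype κ] {n : ℕ} (q : Fin n → κ → (Fin n → κ) → ℝ≥0∞)
    (h1 : ∀ j a t t', (∀ l, j < l → t l = t' l) → q j a t = q j a t')
    (h2 : ∀ j t, ∑ a, q j a t ≤ 1) : ∑ t : Fin n → κ, ∏ j, q j (t j) t ≤ 1 := by
  have := sum_prod_le_one_of_lt (fun j a t => q j.rev a (fun l => t l.rev))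
    (fun j a t t' h => h1 _ _ _ _ fun l hl => h _ (by rwa [Fin.rev_lt_iff]))
    (fun j t => h2 _ _)
  refine le_of_eq_of_le ?_ this
  rw [← (Equiv.arrowCongr Fin.revPerm (Equiv.refl κ)).sum_comp]
  refine Finset.sum_congr rfl fun t _ => ?_
  rw [← Equiv.prod_comp Fin.revPerm]
  simp [Equiv.arrowCongr, Function.comp_def]

end Info

/-! ### Geometry of the Hellinger distance -/

namespace Info

variable {σ τ : Type}

lemma hell_comm (p q : ℝ≥0∞) : hell p q = hell q p := by
  rw [hell, hell, ← neg_sub, neg_sq]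

lemma hell_triangle (p q r : ℝ≥0∞) : hell p r ≤ 2 * hell p q + 2 * hell q r := by
  rw [hell, hell, hell, ← mul_add, ← ENNReal.ofReal_add (sq_nonneg _) (sq_nonneg _),
    ← ENNReal.ofReal_ofNat 2, ← ENNReal.ofReal_mul (by norm_num)]
  refine ENNReal.ofReal_le_ofReal ?_
  nlinarith [sq_nonneg (√p.toReal - √q.toReal - (√q.toReal - √r.toReal))]

lemma hell_mul {r : ℝ≥0∞} (hr : r ≠ ∞) (p q : ℝ≥0∞) : hell (p * r) (q * r) = hell p q * r := by
  rw [hell, hell, ENNReal.toReal_mul, ENNReal.toReal_mul, Real.sqrt_mul ENNReal.toReal_nonneg,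
    Real.sqrt_mul ENNReal.toReal_nonneg, ← sub_mul, mul_pow, Real.sq_sqrt ENNReal.toReal_nonneg,
    ENNReal.ofReal_mul (sq_nonneg _), ENNReal.ofReal_toReal hr]

lemma hell_add {p q : ℝ≥0∞} (hp : p ≠ ∞) (hq : q ≠ ∞) :
    hell p q + ENNReal.ofReal (2 * √(p * q).toReal) = p + q := by
  rw [hell, ← ENNReal.ofReal_add (sq_nonneg _) (by positivity), ENNReal.toReal_mul,
    Real.sqrt_mul ENNReal.toReal_nonneg]
  have : (√p.toReal - √q.toReal) ^ 2 + 2 * (√p.toReal * √q.toReal) = p.toReal + q.toReal := by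
    rw [sub_sq, Real.sq_sqrt ENNReal.toReal_nonneg, Real.sq_sqrt ENNReal.toReal_nonneg]; ring
  rw [this, ENNReal.ofReal_add ENNReal.toReal_nonneg ENNReal.toReal_nonneg,
    ENNReal.ofReal_toReal hp, ENNReal.ofReal_toReal hq]

/-- The (doubled) squared Hellinger distance. -/
def hsq (p q : σ → ℝ≥0∞) : ℝ≥0∞ := ∑' a, hell (p a) (q a)

lemma hsq_comm (p q : σ → ℝ≥0∞) : hsq p q = hsq q p := tsum_congr fun _ => hell_comm _ _

lemma hsq_triangle (p q r : σ → ℝ≥0∞) : hsq p r ≤ 2 * hsq p q + 2 * hsq q r := by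
  simp only [hsq, ← ENNReal.tsum_mul_left, ← ENNReal.tsum_add]
  exact ENNReal.tsum_le_tsum fun a => hell_triangle _ _ _

lemma ne_top_of_tsum_eq_one {p : σ → ℝ≥0∞} (h : ∑' a, p a = 1) (a : σ) : p a ≠ ∞ :=
  ne_top_of_le_ne_top ENNReal.one_ne_top ((ENNReal.le_tsum a).trans h.le)

/-- The cut-and-paste property of the Hellinger distance. -/
lemma hsq_eq_of_mul_eq {p q p' q' : σ → ℝ≥0∞} (hp : ∑' a, p a = 1) (hq : ∑' a, q a = 1)
    (hp' : ∑' a, p' a = 1) (hq' : ∑' a, q' a = 1) (h : ∀ a, p a * q a = p' a * q' a) :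
    hsq p q = hsq p' q' := by
  -- For probability distributions `hsq p q = 2 - 2 ∑ √(p q)`, which sees only the product.
  have key : ∀ {p q : σ → ℝ≥0∞}, ∑' a, p a = 1 → ∑' a, q a = 1 →
      hsq p q + ∑' a, ENNReal.ofReal (2 * √(p a * q a).toReal) = 2 := by
    intro p q hp hq
    rw [hsq, ← ENNReal.tsum_add]
    trans ∑' a, p a + ∑' a, q a
    swap
    · rw [hp, hq, one_add_one_eq_two]
    rw [← ENNReal.tsum_add]
    exact tsum_congr fun a => hell_add (ne_top_of_tsum_eq_one hp a) (ne_top_of_tsum_eq_one hq a)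
  have h1 := key hp hq
  have h2 := key hp' hq'
  simp only [← h] at h2
  have h3 := h1.trans h2.symm
  refine (ENNReal.add_left_inj ?_).1 h3
  exact ne_top_of_le_ne_top ENNReal.ofNat_ne_top (h1 ▸ le_add_self)

/-- Two distributions that differ on an event are far apart. -/
lemma le_hsq_of_gap {p q : σ → ℝ≥0∞} (hp : ∑' a, p a = 1) (hq : ∑' a, q a = 1)
    (e : σ → ℝ≥0∞) (he : ∀ a, e a ≤ 1) {d : ℝ} (hd : 0 < d)
    (h : ∑' a, e a * q a + ENNReal.ofReal d ≤ ∑' a, e a * p a) :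
    ENNReal.ofReal (d ^ 2 / 4) ≤ hsq p q := by
  -- With `x = √p` and `y = √q`, split `x² - y² = (x - y) (x + y)` by the AM-GM inequality. The
  -- weights are such that the part with `(x + y)² ≤ 2 (p + q)` sums to `d / 2`, half of the gap.
  have pt : ∀ a, e a * p a ≤ e a * q a + (ENNReal.ofReal (2 / d) * hell (p a) (q a) +
      ENNReal.ofReal (d / 4) * (p a + q a)) := by
    intro a
    have hpa := ne_top_of_tsum_eq_one hp a
    have hqa := ne_top_of_tsum_eq_one hq a
    have : p a ≤ q a + (ENNReal.ofReal (2 / d) * hell (p a) (q a) +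
        ENNReal.ofReal (d / 4) * (p a + q a)) := by
      have hreal : (p a).toReal ≤ (q a).toReal + (2 / d * (√(p a).toReal - √(q a).toReal) ^ 2 +
          d / 4 * ((p a).toReal + (q a).toReal)) := by
        have h1 := Real.sq_sqrt (ENNReal.toReal_nonneg (a := p a))
        have h2 := Real.sq_sqrt (ENNReal.toReal_nonneg (a := q a))
        set x := √(p a).toReal
        set y := √(q a).toReal
        rw [← h1, ← h2]
        have h3 : (x - y) * (x + y) ≤ 2 / d * (x - y) ^ 2 + d / 8 * (x + y) ^ 2 := by
          have : 0 ≤ (2 / d) * ((x - y) - d / 4 * (x + y)) ^ 2 := by positivity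
          have h4 : (2 / d) * ((x - y) - d / 4 * (x + y)) ^ 2 =
            2 / d * (x - y) ^ 2 + d / 8 * (x + y) ^ 2 - (x - y) * (x + y) := by
              field_simp; ring
          linarith
        nlinarith [mul_nonneg hd.le (sq_nonneg (x - y))]
      have := ENNReal.ofReal_le_ofReal hreal
      rwa [ENNReal.ofReal_add ENNReal.toReal_nonneg (by positivity),
        ENNReal.ofReal_add (by positivity) (by positivity), ENNReal.ofReal_mul (by positivity),
        ENNReal.ofReal_mul (by positivity),
        ENNReal.ofReal_add ENNReal.toReal_nonneg ENNReal.toReal_nonneg,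
        ENNReal.ofReal_toReal hpa, ENNReal.ofReal_toReal hqa] at this
    calc e a * p a ≤ e a * (q a + (ENNReal.ofReal (2 / d) * hell (p a) (q a) +
        ENNReal.ofReal (d / 4) * (p a + q a))) := by gcongr
      _ ≤ _ := by
        rw [mul_add]
        gcongr
        exact mul_le_of_le_one_left' (he a)
  have hsum := ENNReal.tsum_le_tsum pt
  rw [ENNReal.tsum_add, ENNReal.tsum_add, ENNReal.tsum_mul_left, ENNReal.tsum_mul_left,
    ENNReal.tsum_add, hp, hq] at hsum
  have hfin : ∑' a, e a * q a ≠ ∞ := by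
    refine ne_top_of_le_ne_top ENNReal.one_ne_top ?_
    rw [← hq]
    exact ENNReal.tsum_le_tsum fun a => mul_le_of_le_one_left' (he a)
  have h3 := (ENNReal.add_le_add_iff_left hfin).1 (h.trans hsum)
  by_cases htop : hsq p q = ∞
  · simp [htop]
  change _ ≤ ENNReal.ofReal (2 / d) * hsq p q + _ at h3
  rw [← ENNReal.ofReal_toReal htop] at h3 ⊢
  rw [one_add_one_eq_two, ← ENNReal.ofReal_ofNat 2, ← ENNReal.ofReal_mul (by positivity),
    ← ENNReal.ofReal_mul (by positivity), ← ENNReal.ofReal_add (by positivity) (by positivity),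
    ENNReal.ofReal_le_ofReal_iff (by positivity)] at h3
  refine ENNReal.ofReal_le_ofReal ?_
  have h4 : d / 2 ≤ 2 / d * (hsq p q).toReal := by linarith
  have h5 : d * (d / 2) ≤ d * (2 / d * (hsq p q).toReal) := by gcongr
  have h6 : d * (2 / d * (hsq p q).toReal) = 2 * (hsq p q).toReal := by field_simp
  nlinarith

/-! ## Families of distributions that factor over the players -/

/-- Distributions on transcripts, indexed by the `k` input bits, that factor over the players:
`view i t` is the part of `t` on which the factor of player `i` depends. -/
structure Rectangular (k : ℕ) (τ σ : Type) where
  view : Fin k → τ → σ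
  base : τ → ℝ≥0∞
  factor : Fin k → Bool → σ → ℝ≥0∞
  base_ne_top : ∀ t, base t ≠ ∞
  factor_ne_top : ∀ i b c, factor i b c ≠ ∞
  tsum_eq_one : ∀ x : Fin k → Bool, ∑' t, base t * ∏ i, factor i (x i) (view i t) = 1

namespace Rectangular

variable {k : ℕ} (R : Rectangular k τ σ)

/-- The distribution of the transcript on input `x`. -/
def law (x : Fin k → Bool) (t : τ) : ℝ≥0∞ := R.base t * ∏ i, R.factor i (x i) (R.view i t)

/-- The distribution of the view of player `i` on input `x`. -/
def viewLaw (i : Fin k) (x : Fin k → Bool) (c : σ) : ℝ≥0∞ :=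
  open Classical in ∑' t, if R.view i t = c then R.law x t else 0

/-- The part of the probability of a transcript that is due to the players other than `i`. -/
def rest (i : Fin k) (x : Fin k → Bool) (t : τ) : ℝ≥0∞ :=
  R.base t * ∏ l ∈ Finset.univ.erase i, R.factor l (x l) (R.view l t)

/-- The part of the probability of a view of player `i` that is due to the others. -/
def viewRest (i : Fin k) (x : Fin k → Bool) (c : σ) : ℝ≥0∞ :=
  open Classical in ∑' t, if R.view i t = c then R.rest i x t else 0

lemma law_eq (i : Fin k) (x : Fin k → Bool) (t : τ) :
    R.law x t = R.factor i (x i) (R.view i t) * R.rest i x t := by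
  rw [law, rest, ← Finset.mul_prod_erase _ _ (Finset.mem_univ i)]
  ring

lemma rest_ne_top (i : Fin k) (x : Fin k → Bool) (t : τ) : R.rest i x t ≠ ∞ :=
  ENNReal.mul_ne_top (R.base_ne_top t) (ENNReal.prod_ne_top fun _ _ => R.factor_ne_top _ _ _)

lemma rest_update (i : Fin k) (x : Fin k → Bool) (b : Bool) (t : τ) :
    R.rest i (Function.update x i b) t = R.rest i x t := by
  rw [rest, rest]
  congr 1
  refine Finset.prod_congr rfl fun l hl => ?_
  rw [Function.update_of_ne (Finset.ne_of_mem_erase hl)]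

lemma viewRest_update (i : Fin k) (x : Fin k → Bool) (b : Bool) (c : σ) :
    R.viewRest i (Function.update x i b) c = R.viewRest i x c := by
  simp only [viewRest, rest_update]

lemma viewLaw_eq (i : Fin k) (x : Fin k → Bool) (c : σ) :
    R.viewLaw i x c = R.factor i (x i) c * R.viewRest i x c := by
  rw [viewLaw, viewRest, ← ENNReal.tsum_mul_left]
  refine tsum_congr fun t => ?_
  split_ifs with h
  · rw [law_eq R i, h]
  · rw [mul_zero]

lemma tsum_law (x : Fin k → Bool) : ∑' t, R.law x t = 1 := R.tsum_eq_one x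

lemma tsum_viewLaw (i : Fin k) (x : Fin k → Bool) : ∑' c, R.viewLaw i x c = 1 := by
  simp only [viewLaw]
  rw [ENNReal.tsum_comm]
  simpa using R.tsum_law x

/-- `viewRest` is not a probability and may be infinite, but its product with the factor of player
`i` is a probability. So it is infinite only at views that neither bit can produce. -/
lemma viewRest_ne_top {i : Fin k} {x : Fin k → Bool} {c : σ} {b : Bool}
    (h : R.factor i b c ≠ 0) : R.viewRest i x c ≠ ∞ := by
  intro h0
  have h1 := ne_top_of_tsum_eq_one (R.tsum_viewLaw i (Function.update x i b)) c
  rw [viewLaw_eq, viewRest_update, Function.update_self, h0, ENNReal.mul_top h] at h1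
  exact h1 rfl

/-- When only the input of player `i` changes, the change is visible to player `i`. -/
lemma hsq_law_le (i : Fin k) (x : Fin k → Bool) (b b' : Bool) :
    hsq (R.law (Function.update x i b)) (R.law (Function.update x i b')) ≤
      hsq (R.viewLaw i (Function.update x i b)) (R.viewLaw i (Function.update x i b')) := by
  classical
  -- The factors of the other players are unchanged and come out of the Hellinger terms, so the sum
  -- can be grouped by the view of player `i`.
  have h1 : hsq (R.law (Function.update x i b)) (R.law (Function.update x i b')) =
      ∑' c, hell (R.factor i b c) (R.factor i b' c) * R.viewRest i x c := by
    have : ∀ c, hell (R.factor i b c) (R.factor i b' c) * R.viewRest i x c =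
        ∑' t, if R.view i t = c then
          hell (R.factor i b (R.view i t)) (R.factor i b' (R.view i t)) * R.rest i x t else 0 := by
      intro c
      rw [viewRest, ← ENNReal.tsum_mul_left]
      refine tsum_congr fun t => ?_
      by_cases h : R.view i t = c
      · rw [if_pos h, if_pos h, h]
      · rw [if_neg h, if_neg h, mul_zero]
    simp only [this]
    rw [ENNReal.tsum_comm, hsq]
    refine tsum_congr fun t => ?_
    rw [law_eq R i, law_eq R i, rest_update, rest_update, Function.update_self,
      Function.update_self, hell_mul (R.rest_ne_top i x t)]
    simp
  rw [h1, hsq]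
  refine ENNReal.tsum_le_tsum fun c => ?_
  simp only [viewLaw_eq, viewRest_update, Function.update_self]
  by_cases h : R.viewRest i x c = ∞
  · have z : ∀ b, R.factor i b c = 0 := fun b => by
      by_contra hb
      exact R.viewRest_ne_top hb h
    simp [z, hell]
  · rw [hell_mul h]

/-- The distribution of the view of player `i` with input `b`, for uniform inputs of the others. -/
def unifView (i : Fin k) (b : Bool) (c : σ) : ℝ≥0∞ :=
  R.factor i b c * ((2 ^ k : ℝ≥0∞)⁻¹ * ∑ x, R.viewRest i x c)

lemma unifView_eq (i : Fin k) (b : Bool) (c : σ) :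
    R.unifView i b c = (2 ^ k : ℝ≥0∞)⁻¹ * ∑ x, R.viewLaw i (Function.update x i b) c := by
  simp only [unifView, viewLaw_eq, viewRest_update, Function.update_self, ← Finset.mul_sum]
  ring

lemma tsum_unifView (i : Fin k) (b : Bool) : ∑' c, R.unifView i b c = 1 := by
  simp only [unifView_eq, ENNReal.tsum_mul_left]
  rw [Summable.tsum_finsetSum fun _ _ => ENNReal.summable]
  simp only [tsum_viewLaw, Finset.sum_const, Finset.card_univ, Fintype.card_fun, Fintype.card_bool,
    Fintype.card_fin, nsmul_eq_mul, mul_one, Nat.cast_pow, Nat.cast_ofNat]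
  exact ENNReal.inv_mul_cancel (by simp) (by simp)

/-- How much the input of player `i` changes its view when the others have uniform inputs. -/
def inputDist (i : Fin k) : ℝ≥0∞ := hsq (R.unifView i false) (R.unifView i true)

/-- The input in which exactly player `z` has a `0`. -/
def oneZero (z : Fin k) : Fin k → Bool := fun i => decide (i ≠ z)

/-- How much the view of player `i` with input `1` changes when the inputs of the others change
from uniform to exactly one `0`, at player `z`. -/
def modeDist (i z : Fin k) : ℝ≥0∞ := hsq (R.unifView i true) (R.viewLaw i (oneZero z))

lemma oneZero_self_update {i z : Fin k} (h : i ≠ z) :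
    Function.update (oneZero z) i true = oneZero z := by
  rw [Function.update_eq_self_iff]
  simp [oneZero, h]

/-- Let `V0`, `V1` be the views of player `i` for the two columns and `U0`, `U1` its views for
uniform other inputs. They share the factors of player `i`, so `V0 U1 = U0 V1` and cut-and-paste
equates the distances of `V0, U1` and of `U0, V1`. The path `V0, U1, V1` and then the path `U0, U1,
V1` give the coefficients `4` and `6 = 4 + 2`. -/
lemma hsq_twoZeros_le {i z : Fin k} (h : i ≠ z) :
    hsq (R.law (Function.update (oneZero z) i false)) (R.law (oneZero z)) ≤
      4 * R.inputDist i + 6 * R.modeDist i z := by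
  have h0 := R.hsq_law_le i (oneZero z) false true
  rw [oneZero_self_update h] at h0
  refine h0.trans ?_
  set V0 := R.viewLaw i (Function.update (oneZero z) i false) with hV0
  set V1 := R.viewLaw i (oneZero z) with hV1
  have e0 : ∀ c, V0 c = R.factor i false c * R.viewRest i (oneZero z) c := fun c => by
    rw [hV0, viewLaw_eq, viewRest_update, Function.update_self]
  have e1 : ∀ c, V1 c = R.factor i true c * R.viewRest i (oneZero z) c := fun c => by
    rw [hV1, viewLaw_eq]
    simp [oneZero, h]
  have cut : hsq V0 (R.unifView i true) = hsq (R.unifView i false) V1 := by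
    refine hsq_eq_of_mul_eq (R.tsum_viewLaw _ _) (R.tsum_unifView _ _) (R.tsum_unifView _ _)
      (R.tsum_viewLaw _ _) fun c => ?_
    rw [e0, e1, unifView, unifView]
    ring
  have s1 := hsq_triangle V0 (R.unifView i true) V1
  have s2 := hsq_triangle (R.unifView i false) (R.unifView i true) V1
  rw [cut] at s1
  calc hsq V0 V1 ≤ 2 * hsq (R.unifView i false) V1 + 2 * hsq (R.unifView i true) V1 := s1
    _ ≤ 2 * (2 * hsq (R.unifView i false) (R.unifView i true) + 2 * hsq (R.unifView i true) V1) +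
        2 * hsq (R.unifView i true) V1 := by gcongr
    _ = 4 * R.inputDist i + 6 * R.modeDist i z := by rw [inputDist, modeDist]; ring

lemma update_oneZero_comm {i z : Fin k} (h : i ≠ z) :
    Function.update (oneZero z) i false = Function.update (oneZero i) z false := by
  funext l
  by_cases h1 : l = i
  · subst h1
    simp [Function.update_of_ne h, oneZero]
  · by_cases h2 : l = z
    · subst h2
      simp [Function.update_of_ne h1, oneZero]
    · simp [oneZero, h1, h2]

/-- At every player, the columns `1` and `e_iz` together contain the same bits as `e_i` and `e_z`.
So cut-and-paste moves the problem to `e_i` and `e_z`, each of which is one flip away from `e_iz`.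
-/
lemma hsq_ones_le {i z : Fin k} (h : i ≠ z) :
    hsq (R.law fun _ => true) (R.law (Function.update (oneZero z) i false)) ≤
      2 * (4 * R.inputDist i + 6 * R.modeDist i z) +
        2 * (4 * R.inputDist z + 6 * R.modeDist z i) := by
  have cut : hsq (R.law fun _ => true) (R.law (Function.update (oneZero z) i false)) =
      hsq (R.law (oneZero i)) (R.law (oneZero z)) := by
    refine hsq_eq_of_mul_eq (R.tsum_law _) (R.tsum_law _) (R.tsum_law _) (R.tsum_law _) fun t => ?_
    simp only [law]
    rw [mul_mul_mul_comm, mul_mul_mul_comm (R.base t) _ (R.base t), ← Finset.prod_mul_distrib,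
      ← Finset.prod_mul_distrib]
    congr 1
    refine Finset.prod_congr rfl fun l _ => ?_
    by_cases h1 : l = i
    · subst h1
      simp [oneZero, h, mul_comm]
    · simp [oneZero, h1]
  rw [cut]
  refine (hsq_triangle _ (R.law (Function.update (oneZero z) i false)) _).trans ?_
  rw [add_comm]
  gcongr
  · exact R.hsq_twoZeros_le h
  · rw [update_oneZero_comm h, hsq_comm]
    exact R.hsq_twoZeros_le h.symm

/-- With a single player there are no pairs `i ≠ z`, but its view distinguishes the two inputs
directly. -/
lemma hsq_ones_le_of_one (R : Rectangular 1 τ σ) :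
    hsq (R.law fun _ => true) (R.law fun _ => false) ≤ R.inputDist 0 := by
  have h := R.hsq_law_le 0 (fun _ => false) true false
  have e : ∀ (x : Fin 1 → Bool) b, Function.update x 0 b = fun _ => b := fun x b => by
    funext l
    rw [Subsingleton.elim l 0, Function.update_self]
  have e2 : ∀ b, R.unifView 0 b = R.viewLaw 0 fun _ => b := by
    intro b
    funext c
    rw [unifView_eq]
    simp only [e, Finset.sum_const, Finset.card_univ, Fintype.card_fun, Fintype.card_bool,
      Fintype.card_fin, nsmul_eq_mul, ← mul_assoc]
    rw [Nat.cast_pow, Nat.cast_ofNat, ENNReal.inv_mul_cancel (by simp) (by simp), one_mul]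
  rw [e, e] at h
  rw [inputDist, e2, e2, hsq_comm (R.viewLaw 0 fun _ => false)]
  exact h

/-- If the input `1, …, 1` is far from all others, then there is much information about the
inputs or about the mode. -/
theorem card_mul_le [NeZero k] (g : ℝ≥0∞)
    (hg : ∀ x : Fin k → Bool, x ≠ (fun _ => true) → g ≤ hsq (R.law fun _ => true) (R.law x)) :
    (k : ℝ≥0∞) * k * g ≤
      48 * (k * ∑ i, R.inputDist i + ∑ i, ∑ z ∈ Finset.univ.erase i, R.modeDist i z) := by
  rcases Nat.lt_or_ge k 2 with hk | hk
  · have hk1 : k = 1 := by have := NeZero.ne k; omega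
    subst hk1
    have h1 := (hg (fun _ => false) (fun h => by simpa using congrFun h 0)).trans
      R.hsq_ones_le_of_one
    simp only [Nat.cast_one, one_mul, Finset.univ_unique, Finset.sum_singleton]
    calc g ≤ 1 * (R.inputDist default + 0) := by simpa using h1
      _ ≤ _ := by gcongr <;> simp
  · set A := ∑ i, R.inputDist i with hA
    set B := ∑ i, ∑ z ∈ Finset.univ.erase i, R.modeDist i z with hB
    have hB' : B = ∑ i, ∑ z ∈ Finset.univ.erase i, R.modeDist z i := by
      rw [hB, Finset.sum_comm' (t' := Finset.univ) (s' := fun z => Finset.univ.erase z)]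
      simp [eq_comm]
    have hA1 : ((k - 1 : ℕ) : ℝ≥0∞) * A =
        ∑ i, ∑ z ∈ Finset.univ.erase i, R.inputDist i := by
      simp [hA, Finset.mul_sum, Finset.card_erase_of_mem]
    have hA2 : ((k - 1 : ℕ) : ℝ≥0∞) * A =
        ∑ i, ∑ z ∈ Finset.univ.erase i, R.inputDist z := by
      rw [hA1, Finset.sum_comm' (t' := Finset.univ) (s' := fun z => Finset.univ.erase z)]
      simp [eq_comm]
    -- Sum of `hsq_ones_le` over ordered pairs: each `inputDist` occurs `2 (k - 1)` times with
    -- coefficient `8`, each `modeDist` twice with coefficient `12`.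
    have hsum : ((k : ℝ≥0∞) * (k - 1 : ℕ)) * g ≤ 16 * ((k - 1 : ℕ) * A) + 24 * B := by
      calc ((k : ℝ≥0∞) * (k - 1 : ℕ)) * g =
          ∑ i : Fin k, ∑ z ∈ Finset.univ.erase i, g := by
            simp [Finset.card_erase_of_mem, mul_assoc]
        _ ≤ ∑ i : Fin k, ∑ z ∈ Finset.univ.erase i,
              (8 * R.inputDist i + 12 * R.modeDist i z + 8 * R.inputDist z +
                12 * R.modeDist z i) := by
            refine Finset.sum_le_sum fun i _ => Finset.sum_le_sum fun z hz => ?_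
            have hiz : i ≠ z := (Finset.ne_of_mem_erase hz).symm
            refine ((hg _ fun h => ?_).trans (R.hsq_ones_le hiz)).trans (le_of_eq (by ring))
            simpa using congrFun h i
        _ = 8 * ((k - 1 : ℕ) * A) + 12 * B + 8 * ((k - 1 : ℕ) * A) + 12 * B := by
            nth_rw 2 [hA2]
            nth_rw 1 [hA1]
            nth_rw 2 [hB']
            simp only [hB, Finset.sum_add_distrib, Finset.mul_sum]
        _ = _ := by ring
    have hk2 : (k : ℝ≥0∞) ≤ 2 * (k - 1 : ℕ) := by
      have : k ≤ 2 * (k - 1) := by omega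
      exact_mod_cast this
    calc (k : ℝ≥0∞) * k * g ≤ k * (2 * (k - 1 : ℕ)) * g := by gcongr
      _ = 2 * ((k : ℝ≥0∞) * (k - 1 : ℕ) * g) := by ring
      _ ≤ 2 * (16 * ((k - 1 : ℕ) * A) + 24 * B) := by gcongr
      _ = 32 * ((k - 1 : ℕ) * A) + 48 * B := by ring
      _ ≤ 48 * (k * A) + 48 * B := by
          gcongr
          · norm_num
          · omega
      _ = _ := by ring

end Rectangular
end Info

/-! ### Information about a fair bit -/

namespace Info

variable {Ω α β γ : Type}

lemma map_apply_injective (μ : PMF Ω) (A : Ω → α) {e : α → β} (he : Function.Injective e) (a : α) :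
    μ.map (fun ω => e (A ω)) (e a) = μ.map A a := by
  classical
  rw [map_apply_comp μ A e, tsum_eq_single a]
  · simp
  · intro b hb
    rw [if_neg fun h => hb (he h)]

/-- A lower bound for the information that `C` reveals about a fair bit `A`. -/
lemma natEntropy_add_sum_hsq_le (μ : PMF Ω) (A : Ω → Bool) (C : Ω → β) (D : Ω → γ) (S : Finset γ)
    (θ : ℝ≥0∞) (hθ : θ ≠ 0) (hθ' : θ ≠ ∞) (F : γ → Bool → β → ℝ≥0∞)
    (hF : ∀ d ∈ S, ∀ b c, μ.map (fun ω => (A ω, C ω, D ω)) (b, c, d) = F d b c * θ)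
    (hF1 : ∀ d ∈ S, ∀ b, ∑' c, F d b c = 1) :
    natEntropy μ A (fun ω => (C ω, D ω)) + θ / 2 * ∑ d ∈ S, hsq (F d false) (F d true) ≤
      natEntropy μ A D := by
  classical
  refine le_trans (add_le_add le_rfl ?_)
    (natEntropy_add_hell_le μ A (fun ω => (C ω, D ω)) (fun b => b.2))
  have hcd : ∀ d ∈ S, ∀ c, μ.map (fun ω => (C ω, D ω)) (c, d) = (F d false c + F d true c) * θ := by
    intro d hd c
    rw [← tsum_map_pair_left μ A, tsum_fintype, Fintype.sum_bool, hF d hd, hF d hd]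
    ring
  have had : ∀ d ∈ S, ∀ b, μ.map (fun ω => (A ω, D ω)) (b, d) = θ := by
    intro d hd b
    rw [← tsum_map_pair_left μ C]
    have : ∀ c, μ.map (fun ω => (C ω, A ω, D ω)) (c, b, d) = F d b c * θ := fun c => by
      rw [← hF d hd]
      exact map_apply_injective μ (fun ω => (A ω, C ω, D ω))
        (e := fun v => (v.2.1, v.1, v.2.2))
        (fun v w h => by simp only [Prod.mk.injEq] at h; ext <;> simp_all) (b, c, d)
    simp only [this, ENNReal.tsum_mul_right, hF1 d hd, one_mul]
  have hd : ∀ d ∈ S, μ.map D d = 2 * θ := by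
    intro d hd
    rw [← tsum_map_pair_left μ A, tsum_fintype, Fintype.sum_bool, had d hd, had d hd, two_mul]
  have hc : ∀ d ∈ S, ∀ b, cprob μ A D b d = 2⁻¹ := by
    intro d hds b
    rw [cprob, had d hds, hd d hds, ENNReal.div_eq_inv_mul,
      ENNReal.mul_inv (Or.inl (by simp)) (Or.inl (by simp)), mul_assoc,
      ENNReal.inv_mul_cancel hθ hθ', mul_one]
  set f : Bool × β × γ → ℝ≥0∞ := fun v => hell (μ.map (fun ω => (A ω, C ω, D ω)) v)
        (μ.map (fun ω => (C ω, D ω)) v.2 * cprob μ A D v.1 v.2.2) with hf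
  change _ ≤ ∑' v, f v
  have h1 : ∑' v, f v = ∑' d, ∑' c, ∑ b, f (b, c, d) := by
    rw [ENNReal.tsum_prod', ENNReal.tsum_comm, ENNReal.tsum_prod', ENNReal.tsum_comm]
    simp only [tsum_fintype]
  rw [h1, Finset.mul_sum]
  refine le_trans ?_ (ENNReal.sum_le_tsum S)
  refine Finset.sum_le_sum fun d hds => ?_
  rw [hsq, ← ENNReal.tsum_mul_left]
  refine ENNReal.tsum_le_tsum fun c => ?_
  rw [Fintype.sum_bool]
  have hfb : ∀ b, f (b, c, d) = hell (F d b c) ((F d false c + F d true c) * 2⁻¹) * θ := by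
    intro b
    simp only [hf]
    rw [hF d hds, hcd d hds, hc d hds, mul_right_comm, hell_mul hθ']
  rw [hfb, hfb, ← add_mul]
  -- Given `d`, the comparison law of `C` is the midpoint of the two conditional laws; their
  -- distance is bounded by a path through the midpoint.
  have ht := hell_triangle (F d false c) ((F d false c + F d true c) * 2⁻¹) (F d true c)
  rw [hell_comm ((F d false c + F d true c) * 2⁻¹) (F d true c), ← mul_add] at ht
  calc θ / 2 * hell (F d false c) (F d true c)
      ≤ θ / 2 * (2 * (hell (F d false c) ((F d false c + F d true c) * 2⁻¹) +
          hell (F d true c) ((F d false c + F d true c) * 2⁻¹))) := by gcongr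
    _ = _ := by
        rw [← mul_assoc, ENNReal.div_mul_cancel (by simp) (by simp)]
        ring

end Info

/-! ### The hard distribution: products and one-coordinate marginals -/

namespace HardDist

open Info

variable {α β : Type} [Fintype α]

lemma iid_apply (p : PMF α) (n : ℕ) (w : Fin n → α) : iid p n w = ∏ j, p (w j) := rfl

lemma sum_prod_pi {n : ℕ} (f : Fin n → α → ℝ≥0∞) :
    ∑ w : Fin n → α, ∏ j, f j (w j) = ∏ j, ∑ a, f j a := by
  classical
  exact (Fintype.prod_sum f).symm

lemma map_apply_sum [DecidableEq β] (p : PMF α) (f : α → β) (b : β) :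
    p.map f b = ∑ a, if b = f a then p a else 0 := by
  rw [PMF.map_apply, tsum_fintype]
  refine Finset.sum_congr rfl fun a _ => ?_
  by_cases h : b = f a
  · rw [if_pos h, if_pos h]
  · rw [if_neg h, if_neg h]

lemma map_iid_apply (p : PMF α) (n : ℕ) (g : α → β) (y : Fin n → β) :
    (iid p n).map (fun w j => g (w j)) y = ∏ j, p.map g (y j) := by
  classical
  simp only [map_apply_sum]
  rw [← sum_prod_pi]
  refine Finset.sum_congr rfl fun w _ => ?_
  rw [iid_apply]
  split_ifs with h
  · refine Finset.prod_congr rfl fun j _ => ?_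
    rw [h, if_pos rfl]
  · obtain ⟨j, hj⟩ := Function.ne_iff.1 h
    exact (Finset.prod_eq_zero (Finset.mem_univ j) (if_neg hj)).symm

lemma map_iid_eval (p : PMF α) {n : ℕ} (j : Fin n) : (iid p n).map (fun w => w j) = p := by
  classical
  ext a
  rw [map_apply_sum]
  have : ∀ w : Fin n → α, (if a = w j then iid p n w else 0) =
      ∏ l, if l = j then (if a = w l then p (w l) else 0) else p (w l) := by
    intro w
    rw [iid_apply]
    split_ifs with h
    · refine Finset.prod_congr rfl fun l _ => ?_
      split_ifs with h1 h2
      · rfl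
      · exact absurd (h1 ▸ h) h2
      · rfl
    · refine (Finset.prod_eq_zero (Finset.mem_univ j) ?_).symm
      rw [if_pos rfl, if_neg h]
  simp only [this]
  rw [sum_prod_pi (fun l b => if l = j then (if a = b then p b else 0) else p b),
    Finset.prod_eq_single j]
  · simp
  · intro l _ hl
    simp only [if_neg hl]
    rw [← tsum_fintype (L := .unconditional _), p.tsum_coe]
  · simp

/-- The probability that player `i` has the bit `b` in a coordinate with mode `m` and special
player `z`. -/
def bitProb {k : ℕ} (m : Bool) (z i : Fin k) (b : Bool) : ℝ≥0∞ :=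
  if m then (if b = decide (i ≠ z) then 1 else 0) else 2⁻¹

lemma sum_bitProb {k : ℕ} (m : Bool) (z i : Fin k) : ∑ b, bitProb m z i b = 1 := by
  cases m
  · simp [bitProb, ENNReal.mul_inv_cancel]
  · simp [bitProb]

lemma bitProb_ne_top {k : ℕ} (m : Bool) (z i : Fin k) (b : Bool) : bitProb m z i b ≠ ∞ := by
  unfold bitProb
  split_ifs <;> simp

lemma bitsGiven_apply {k : ℕ} (m : Bool) (z : Fin k) (x : Fin k → Bool) :
    bitsGiven k m z x = ∏ i, bitProb m z i (x i) := by
  classical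
  cases m
  · simp only [bitsGiven, bitProb, Bool.false_eq_true, if_false, PMF.uniformOfFintype_apply,
      Finset.prod_const, Finset.card_univ, Fintype.card_fun, Fintype.card_bool, Fintype.card_fin]
    rw [Nat.cast_pow, ENNReal.inv_pow, Nat.cast_ofNat]
  · simp only [bitsGiven, bitProb, if_true, PMF.pure_apply, Finset.prod_ite_zero, Finset.mem_univ,
      forall_true_left, Finset.prod_const_one, funext_iff]

lemma xi_apply {k : ℕ} [NeZero k] (x : Fin k → Bool) (m : Bool) (z : Fin k) :
    xi k (x, m, z) = mode m * (k : ℝ≥0∞)⁻¹ * ∏ i, bitProb m z i (x i) := by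
  classical
  simp only [xi, PMF.bind_apply, PMF.map_apply, PMF.uniformOfFintype_apply, tsum_fintype,
    Fintype.card_fin, Prod.mk.injEq]
  rw [Finset.sum_eq_single m, Finset.sum_eq_single z, Finset.sum_eq_single x, bitsGiven_apply]
  · simp [mul_assoc]
  · intro y _ hy
    simp [hy.symm]
  · simp
  · intro y _ hy
    simp [hy.symm]
  · simp
  · intro y _ hy
    simp [hy.symm]
  · simp

lemma mode_false : mode false = 2 / 3 := by simp [mode, PMF.ofFintype_apply]

lemma mode_true : mode true = 1 / 3 := by simp [mode, PMF.ofFintype_apply]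

lemma mode_ne_zero (m : Bool) : mode m ≠ 0 := by
  cases m
  · simp [mode_false]
  · simp [mode_true]

lemma sum_prod_bitProb {k : ℕ} (m : Bool) (z : Fin k) :
    ∑ x : Fin k → Bool, ∏ i, bitProb m z i (x i) = 1 := by
  rw [sum_prod_pi (fun i => bitProb m z i)]
  exact Finset.prod_eq_one fun i _ => sum_bitProb m z i

lemma map_xi_snd {k : ℕ} [NeZero k] (u : Bool × Fin k) :
    (xi k).map Prod.snd u = mode u.1 * (k : ℝ≥0∞)⁻¹ := by
  classical
  obtain ⟨m, z⟩ := u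
  rw [map_apply_sum, Fintype.sum_prod_type]
  simp only [Finset.sum_ite_eq, Finset.mem_univ, if_true, xi_apply]
  rw [← Finset.mul_sum, sum_prod_bitProb, mul_one]

lemma map_xi_bit {k : ℕ} [NeZero k] (i : Fin k) (b : Bool) (u : Bool × Fin k) :
    (xi k).map (fun v => (v.1 i, v.2)) (b, u) =
      mode u.1 * (k : ℝ≥0∞)⁻¹ * bitProb u.1 u.2 i b := by
  classical
  obtain ⟨m, z⟩ := u
  rw [map_apply_sum, Fintype.sum_prod_type]
  have : ∀ x : Fin k → Bool, (∑ y : Bool × Fin k,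
      if (b, (m, z)) = (x i, y) then xi k (x, y) else 0) = mode m * (k : ℝ≥0∞)⁻¹ *
        ∏ l, if l = i then (if b = x l then bitProb m z l (x l) else 0)
          else bitProb m z l (x l) := by
    intro x
    simp only [Prod.mk.injEq]
    by_cases h : b = x i
    · simp only [h, true_and]
      have h2 : ∀ l, (if l = i then (if x i = x l then bitProb m z l (x l) else 0)
          else bitProb m z l (x l)) = bitProb m z l (x l) := by
        intro l
        by_cases hl : l = i
        · subst hl; simp
        · simp [hl]
      simp only [h2, ← xi_apply]
      rw [Finset.sum_eq_single (m, z)]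
      · simp
      · rintro ⟨m', z'⟩ _ hy
        rw [if_neg (fun h => hy h.symm)]
      · simp
    · simp only [h, false_and, if_false, Finset.sum_const_zero]
      rw [Finset.prod_eq_zero (Finset.mem_univ i), mul_zero]
      simp [h]
  simp only [this]
  rw [← Finset.mul_sum, sum_prod_pi (fun l a => if l = i then (if b = a then bitProb m z l a else 0)
          else bitProb m z l a), Finset.prod_eq_single i]
  · simp
  · intro l _ hl
    simp only [if_neg hl]
    exact sum_bitProb m z l
  · simp

end HardDist

/-! ### The rectangle property of transcripts -/

namespace Coordinator

variable {k : ℕ} {D : Type}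

namespace Strategy

variable (S : Strategy k D)

/-- The probability of the coordinator's moves in a transcript. -/
def coordPart : History k → ℝ≥0∞
  | [] => 1
  | (i, m, _) :: h => coordPart h * S.coord h (Sum.inr (i, m))

/-- The probability of the moves of player `i` with input `x` on its channel. -/
def playerPart (i : Fin k) (x : D) : Channel → ℝ≥0∞
  | [] => 1
  | (m, r) :: c => playerPart i x c * S.player i x c m r

lemma coordPart_ne_top : ∀ h : History k, S.coordPart h ≠ ∞
  | [] => by simp [coordPart]
  | (i, m, _) :: h => ENNReal.mul_ne_top (coordPart_ne_top h) (PMF.apply_ne_top _ _)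

lemma playerPart_ne_top (i : Fin k) (x : D) : ∀ c : Channel, S.playerPart i x c ≠ ∞
  | [] => by simp [playerPart]
  | (m, r) :: c => ENNReal.mul_ne_top (playerPart_ne_top i x c) (PMF.apply_ne_top _ _)

/-- A player's move depends only on its own input and channel, so the moves can be regrouped by
player; the coordinator's moves do not depend on the input. -/
lemma reach_eq (X : Fin k → D) : ∀ h : History k,
    S.reach X h = S.coordPart h * ∏ i, S.playerPart i (X i) (chan i h)
  | [] => by simp [reach, coordPart, chan, playerPart]
  | (i, m, r) :: h => by
    rw [reach, coordPart, reach_eq X h]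
    have h1 : ∀ l, S.playerPart l (X l) (chan l ((i, m, r) :: h)) =
        S.playerPart l (X l) (chan l h) *
          if i = l then S.player l (X l) (chan l h) m r else 1 := by
      intro l
      by_cases hl : i = l
      · simp [chan, hl, playerPart]
      · simp [chan, hl]
    simp only [h1, Finset.prod_mul_distrib, Finset.prod_ite_eq, Finset.mem_univ, if_true]
    ring

end Strategy
end Coordinator

/-! ### Joint distribution of the triples and the extended transcript -/

namespace HardDist

open Info Coordinator

variable {n k : ℕ}

/-- Passage from columns to rows: `H` sees only the inputs, so the remaining components can be
summed out column by column. -/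
lemma sum_coordinates {β : Type} [Fintype β] (φ : Fin n → (Fin k → Bool) × β → ℝ≥0∞)
    (H : (Fin k → Fin n → Bool) → ℝ≥0∞) :
    ∑ w : Fin n → (Fin k → Bool) × β, (∏ l, φ l (w l)) * H (fun i j => (w j).1 i) =
      ∑ X : Fin k → Fin n → Bool, (∏ l, ∑ b, φ l (fun i => X i l, b)) * H X := by
  let e : (Fin k → Fin n → Bool) × (Fin n → β) ≃ (Fin n → (Fin k → Bool) × β) :=
    { toFun := fun v j => (fun i => v.1 i j, v.2 j)
      invFun := fun w => (fun i j => (w j).1 i, fun j => (w j).2)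
      left_inv := fun _ => rfl
      right_inv := fun _ => rfl }
  rw [← e.sum_comp, Fintype.sum_prod_type]
  refine Finset.sum_congr rfl fun X _ => ?_
  rw [← sum_prod_pi (fun l b => φ l (fun i => X i l, b)), Finset.sum_mul]
  rfl

/-- The distribution of the bit of player `i` at position `l`, given what the extended transcript
says about it and given that its bit at position `j` is `b`. -/
def weight (j : Fin n) (i : Fin k) (b : Bool) (m : Fin n → Bool) (z : Fin n → Fin k)
    (y : Fin n → Bool) (l : Fin n) (a : Bool) : ℝ≥0∞ :=
  if l < j then bitProb (m l) (z l) i a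
  else if l = j then (if a = b then 1 else 0) else (if a = y l then 1 else 0)

lemma weight_ne_top (j : Fin n) (i : Fin k) (b : Bool) (m : Fin n → Bool) (z : Fin n → Fin k)
    (y : Fin n → Bool) (l : Fin n) (a : Bool) : weight j i b m z y l a ≠ ∞ := by
  unfold weight
  split_ifs <;> simp [bitProb_ne_top]

variable [NeZero k]

/-- The inputs of the players in a sequence of triples. -/
def inputs (w : Fin n → (Fin k → Bool) × Bool × Fin k) : Fin k → Fin n → Bool :=
  fun i j => (w j).1 i

/-- The joint distribution of the triples, the transcript and the output. -/
def full (P : Protocol k (Fin n → Bool)) :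
    PMF ((Fin n → (Fin k → Bool) × Bool × Fin k) × (History k × Bool)) :=
  (eta n k).bind fun w => (P.law (inputs w)).map fun t => (w, t)

variable (P : Protocol k (Fin n → Bool))

lemma joint_zeta : P.joint (zeta n k) = (full P).map fun ω => (inputs ω.1, ω.2.1) := by
  rw [Protocol.joint, zeta, full, PMF.bind_map, PMF.map_bind]
  congr 1
  funext w
  rw [PMF.map_comp]
  rfl

lemma map_full {α : Type} (f : (Fin n → (Fin k → Bool) × Bool × Fin k) × (History k × Bool) → α) :
    (full P).map f = (eta n k).bind fun w => (P.law (inputs w)).map fun t => f (w, t) := by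
  rw [full, PMF.map_bind]
  congr 1
  funext w
  rw [PMF.map_comp]
  rfl

lemma map_full_fst {α : Type} (f : (Fin n → (Fin k → Bool) × Bool × Fin k) → α) :
    (full P).map (fun ω => f ω.1) = (eta n k).map f := by
  rw [map_full, ← PMF.bind_pure_comp]
  congr 1
  funext w
  exact PMF.map_const (P.law (inputs w)) (f w)

/-- Given the inputs, the transcript is independent of everything else. -/
lemma map_full_pair {α β : Type} (f : (Fin n → (Fin k → Bool) × Bool × Fin k) → α)
    (g : History k × Bool → β) (v : Fin n → (Fin k → Bool) × Bool × Fin k)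
    (hf : ∀ w, f w = f v → inputs w = inputs v) (b : β) :
    (full P).map (fun ω => (f ω.1, g ω.2)) (f v, b) =
      (eta n k).map f (f v) * (P.law (inputs v)).map g b := by
  classical
  rw [map_full, PMF.bind_apply, map_apply_sum, tsum_fintype, Finset.sum_mul]
  refine Finset.sum_congr rfl fun w _ => ?_
  by_cases h : f v = f w
  · rw [if_pos h, ← hf w h.symm, h]
    congr 1
    exact map_apply_injective (P.law (inputs w)) g (e := Prod.mk (f w))
      (fun _ _ h => (Prod.mk.inj h).2) b
  · rw [if_neg h, zero_mul]
    convert mul_zero _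
    rw [PMF.map_apply]
    refine ENNReal.tsum_eq_zero.2 fun t => if_neg fun h1 => h (Prod.mk.inj h1).1

/-! ### The transcript extended by the other coordinates -/

/-- The part of a sequence before position `j`. -/
def maskLt (j : Fin n) (m : Fin n → Bool) : Fin n → Bool := fun l => if l < j then m l else false

/-- The part of a sequence after position `j`. -/
def maskGt (j : Fin n) (x : Fin n → Bool) : Fin n → Bool := fun l => if j < l then x l else false

/-- The part of a sequence outside of position `j`. -/
def maskNe (j : Fin n) (z : Fin n → Fin k) : Fin n → Fin k := fun l => if l ≠ j then z l else 0

/-- The view of a player: earlier modes, special players of other coordinates, later input bits of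
the player, and its channel. -/
abbrev View (n k : ℕ) : Type := (Fin n → Bool) × (Fin n → Fin k) × (Fin n → Bool) × Channel

/-- The transcript and output, extended by the earlier modes, the special players of the other
coordinates, and the later input bits. -/
abbrev Ext (n k : ℕ) : Type :=
  (Fin n → Bool) × (Fin n → Fin k) × (Fin k → Fin n → Bool) × (History k × Bool)

/-- The extended transcript for coordinate `j`. -/
def ext (j : Fin n) (ω : (Fin n → (Fin k → Bool) × Bool × Fin k) × (History k × Bool)) :
    Ext n k :=
  (maskLt j fun l => (ω.1 l).2.1, maskNe j fun l => (ω.1 l).2.2,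
    fun i => maskGt j (inputs ω.1 i), ω.2)

/-- The view of player `i` in an extended transcript. -/
def view (i : Fin k) (t : Ext n k) : View n k := (t.1, t.2.1, t.2.2.1 i, chan i t.2.2.2.1)

/-- The factor of player `i` in the distribution of the extended transcript. -/
def playerFactor (j : Fin n) (i : Fin k) (b : Bool) (c : View n k) : ℝ≥0∞ :=
  ∑ s : Fin n → Bool, (∏ l, weight j i b c.1 c.2.1 c.2.2.1 l (s l)) *
    P.playerPart i s c.2.2.2

/-- The probability of what the extended transcript says about position `l`, not counting the
input bits that it does not show. -/
def publicWeight (j : Fin n) (m : Fin n → Bool) (z : Fin n → Fin k) (y : Fin k → Fin n → Bool)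
    (l : Fin n) : ℝ≥0∞ :=
  if l < j then (if ∀ i, y i l = false then mode (m l) * (k : ℝ≥0∞)⁻¹ else 0)
  -- At `j` itself every mask leaves its default value.
  else if l = j then (if m l = false ∧ z l = 0 ∧ ∀ i, y i l = false then 1 else 0)
  -- After `j` the mode is masked and summed out, while the column and its special player are
  -- visible.
  else (if m l = false then ∑ m', xi k (fun i => y i l, m', z l) else 0)

/-- The common factor in the distribution of the extended transcript. -/
def baseFactor (j : Fin n) (t : Ext n k) : ℝ≥0∞ :=
  (∏ l, publicWeight j t.1 t.2.1 t.2.2.1 l) *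
    (P.coordPart t.2.2.2.1 * P.coord t.2.2.2.1 (Sum.inl t.2.2.2.2))

/-- The conditions on position `l` for an extended transcript. -/
def Matches (j : Fin n) (v : (Fin k → Bool) × Bool × Fin k) (m : Fin n → Bool) (z : Fin n → Fin k)
    (y : Fin k → Fin n → Bool) (l : Fin n) (u : (Fin k → Bool) × Bool × Fin k) : Prop :=
  (l = j → u = v) ∧ (if l < j then u.2.1 else false) = m l ∧ (if l ≠ j then u.2.2 else 0) = z l ∧
    ∀ i, (if j < l then u.1 i else false) = y i l

lemma matches_iff (j : Fin n) (v : (Fin k → Bool) × Bool × Fin k) (t : Ext n k)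
    (w : Fin n → (Fin k → Bool) × Bool × Fin k) (t' : History k × Bool) :
    (v, t) = (w j, ext j (w, t')) ↔
      t' = t.2.2.2 ∧ ∀ l, Matches j v t.1 t.2.1 t.2.2.1 l (w l) := by
  obtain ⟨m, z, y, t0⟩ := t
  simp only [ext, Prod.mk.injEq, Matches, maskLt, maskGt, maskNe, inputs, funext_iff, forall_and,
    forall_eq]
  constructor
  · rintro ⟨h1, h2, h3, h4, h5⟩
    exact ⟨h5.symm, h1.symm, fun l => (h2 l).symm, fun l => (h3 l).symm, fun l i => (h4 i l).symm⟩
  · rintro ⟨h5, h1, h2, h3, h4⟩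
    exact ⟨h1.symm, fun l => (h2 l).symm, fun l => (h3 l).symm, fun i l => (h4 l i).symm, h5.symm⟩

-- Before `j` mode and special player are prescribed and the bits are independent; at `j` the whole
-- triple is prescribed; after `j` the column is prescribed and the mode is free. In each case the
-- dependence on `x` is a product over the players.
open Classical in
lemma sum_matches (j : Fin n) (v : (Fin k → Bool) × Bool × Fin k) (m : Fin n → Bool)
    (z : Fin n → Fin k) (y : Fin k → Fin n → Bool) (l : Fin n) (x : Fin k → Bool) :
    ∑ u : Bool × Fin k, (if Matches j v m z y l (x, u) then xi k (x, u) else 0) =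
      (if l = j then xi k v else 1) * publicWeight j m z y l *
        ∏ i, weight j i (v.1 i) m z (y i) l (x i) := by
  rcases lt_trichotomy l j with h | h | h
  · have hne := h.ne
    simp only [Matches, publicWeight, weight, h, hne, if_true, if_false, ne_eq, not_false_eq_true,
      not_lt_of_gt h, false_imp_iff, true_and, one_mul]
    by_cases hy : ∀ i, y i l = false
    · rw [if_pos hy, Finset.sum_eq_single (m l, z l)]
      · rw [if_pos ⟨rfl, rfl, fun i => (hy i).symm⟩, xi_apply]
      · rintro ⟨m', z'⟩ _ hu
        rw [if_neg]
        rintro ⟨h1, h2, _⟩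
        exact hu (Prod.ext h1 h2)
      · simp
    · rw [if_neg hy, zero_mul]
      refine Finset.sum_eq_zero fun u _ => if_neg ?_
      rintro ⟨_, _, h3⟩
      exact hy fun i => (h3 i).symm
  · subst h
    simp only [Matches, publicWeight, weight, lt_irrefl, if_true, if_false, ne_eq, not_true,
      true_imp_iff]
    by_cases hy : m l = false ∧ z l = 0 ∧ ∀ i, y i l = false
    · rw [if_pos hy, mul_one]
      by_cases hx : x = v.1
      · rw [Finset.prod_eq_one fun i _ => if_pos (congrFun hx i), mul_one,
          Finset.sum_eq_single v.2]
        · rw [if_pos ⟨Prod.ext hx rfl, hy.1.symm, hy.2.1.symm, fun i => (hy.2.2 i).symm⟩, hx]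
        · intro u _ hu
          rw [if_neg fun h => hu (congrArg Prod.snd h.1)]
        · simp
      · obtain ⟨i, hi⟩ := Function.ne_iff.1 hx
        rw [Finset.prod_eq_zero (Finset.mem_univ i) (if_neg hi), mul_zero]
        exact Finset.sum_eq_zero fun u _ => if_neg fun h => hx (congrArg Prod.fst h.1)
    · rw [if_neg hy, mul_zero, zero_mul]
      refine Finset.sum_eq_zero fun u _ => if_neg ?_
      rintro ⟨_, h1, h2, h3⟩
      exact hy ⟨h1.symm, h2.symm, fun i => (h3 i).symm⟩
  · have hne := h.ne'
    simp only [Matches, publicWeight, weight, h, hne, if_true, if_false, ne_eq, not_false_eq_true,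
      not_lt_of_gt h, false_imp_iff, true_and, one_mul]
    by_cases hm : m l = false
    · rw [if_pos hm]
      by_cases hx : x = fun i => y i l
      · rw [Finset.prod_eq_one fun i _ => if_pos (congrFun hx i), mul_one, Fintype.sum_prod_type]
        refine Finset.sum_congr rfl fun m' _ => ?_
        rw [Finset.sum_eq_single (z l), if_pos ⟨hm.symm, rfl, fun i => congrFun hx i⟩, hx]
        · intro z' _ hz
          exact if_neg fun h => hz h.2.1
        · simp
      · obtain ⟨i, hi⟩ := Function.ne_iff.1 hx
        rw [Finset.prod_eq_zero (Finset.mem_univ i) (if_neg hi), mul_zero]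
        exact Finset.sum_eq_zero fun u _ => if_neg fun h => hx (funext h.2.2)
    · rw [if_neg hm, zero_mul]
      exact Finset.sum_eq_zero fun u _ => if_neg fun h => hm h.1.symm

/-- Both the weights of the hidden bits and the transcript probability are products over the
players, so the sum over all inputs becomes a product of sums over single rows. Apart from `xi k v`,
only the column `v.1` enters. -/
lemma map_full_ext (j : Fin n) (v : (Fin k → Bool) × Bool × Fin k) (t : Ext n k) :
    (full P).map (fun ω => (ω.1 j, ext j ω)) (v, t) =
      xi k v * (baseFactor P j t * ∏ i, playerFactor P j i (v.1 i) (view i t)) := by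
  classical
  rw [map_full, PMF.bind_apply, tsum_fintype]
  have h1 : ∀ w : Fin n → (Fin k → Bool) × Bool × Fin k,
      eta n k w * (P.law (inputs w)).map (fun t' => (w j, ext j (w, t'))) (v, t) =
      (∏ l, if Matches j v t.1 t.2.1 t.2.2.1 l (w l) then xi k (w l) else 0) *
        P.prob (inputs w) t.2.2.2 := by
    intro w
    rw [PMF.map_apply]
    by_cases h : ∀ l, Matches j v t.1 t.2.1 t.2.2.1 l (w l)
    · rw [tsum_eq_single t.2.2.2]
      · rw [if_pos ((matches_iff j v t w _).2 ⟨rfl, h⟩)]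
        simp only [h, if_true]
        rfl
      · intro t' ht'
        exact if_neg fun h' => ht' ((matches_iff j v t w _).1 h').1
    · obtain ⟨l, hl⟩ := not_forall.1 h
      rw [Finset.prod_eq_zero (Finset.mem_univ l) (if_neg hl), zero_mul]
      refine mul_eq_zero_of_right _ (ENNReal.tsum_eq_zero.2 fun t' => if_neg fun h' => ?_)
      exact h ((matches_iff j v t w _).1 h').2
  simp only [h1]
  have h2 := sum_coordinates (n := n) (k := k)
    (fun l u => if Matches j v t.1 t.2.1 t.2.2.1 l u then xi k u else 0)
    (fun X => P.prob X t.2.2.2)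
  refine Eq.trans h2 ?_
  simp only [sum_matches, Finset.prod_mul_distrib, Finset.prod_ite_eq', Finset.mem_univ, if_true]
  have h3 : ∀ X : Fin k → Fin n → Bool,
      xi k v * (∏ l, publicWeight j t.1 t.2.1 t.2.2.1 l) *
        (∏ l, ∏ i, weight j i (v.1 i) t.1 t.2.1 (t.2.2.1 i) l (X i l)) * P.prob X t.2.2.2 =
      xi k v * baseFactor P j t * ∏ i, ((∏ l, weight j i (v.1 i) t.1 t.2.1 (t.2.2.1 i) l (X i l)) *
        P.playerPart i (X i) (chan i t.2.2.2.1)) := by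
    intro X
    rw [Finset.prod_comm, Finset.prod_mul_distrib, Strategy.prob, Strategy.reach_eq, baseFactor]
    ring
  simp only [h3]
  rw [← Finset.mul_sum, mul_assoc]
  congr 2
  exact sum_prod_pi (fun i (s : Fin n → Bool) =>
    (∏ l, weight j i (v.1 i) t.1 t.2.1 (t.2.2.1 i) l (s l)) *
        P.playerPart i s (chan i t.2.2.2.1))

lemma xi_ne_top (v : (Fin k → Bool) × Bool × Fin k) : xi k v ≠ ∞ := PMF.apply_ne_top _ _

lemma xi_false (x : Fin k → Bool) (z : Fin k) :
    xi k (x, false, z) = 2 * (3 * k : ℝ≥0∞)⁻¹ * (2 ^ k : ℝ≥0∞)⁻¹ := by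
  rw [xi_apply, mode_false]
  simp only [bitProb, Bool.false_eq_true, if_false, Finset.prod_const, Finset.card_univ,
    Fintype.card_fin]
  rw [ENNReal.inv_pow, ENNReal.mul_inv (Or.inl (by simp)) (Or.inl (by simp)), div_eq_mul_inv]
  ring

lemma xi_false_ne_zero (x : Fin k → Bool) (z : Fin k) : xi k (x, false, z) ≠ 0 := by
  rw [xi_false]
  simp [ENNReal.mul_eq_top]

lemma xi_true (x : Fin k → Bool) (z : Fin k) :
    xi k (x, true, z) = if x = Rectangular.oneZero z then (3 * k : ℝ≥0∞)⁻¹ else 0 := by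
  rw [xi_apply, mode_true]
  simp only [bitProb, if_true, Finset.prod_ite_zero, Finset.mem_univ, forall_true_left,
    Finset.prod_const_one, funext_iff, Rectangular.oneZero]
  split_ifs
  · rw [ENNReal.mul_inv (Or.inl (by simp)) (Or.inl (by simp)), one_div, mul_one]
  · rw [mul_zero]

lemma map_full_eval (j : Fin n) : (full P).map (fun ω => ω.1 j) = xi k := by
  rw [map_full_fst P (fun w => w j)]
  exact map_iid_eval _ j

lemma publicWeight_ne_top (j : Fin n) (m : Fin n → Bool) (z : Fin n → Fin k)
    (y : Fin k → Fin n → Bool) (l : Fin n) : publicWeight j m z y l ≠ ∞ := by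
  unfold publicWeight
  split_ifs
  · exact ENNReal.mul_ne_top (PMF.apply_ne_top _ _) (by simp [NeZero.ne k])
  · simp
  · simp
  · simp
  · exact ENNReal.sum_ne_top.2 fun m' _ => xi_ne_top _
  · simp

/-- The distributions of the extended transcript, given the input bits of coordinate `j`. -/
def rect (j : Fin n) : Rectangular k (Ext n k) (View n k) where
  view := view
  base := baseFactor P j
  factor := playerFactor P j
  base_ne_top t := ENNReal.mul_ne_top (ENNReal.prod_ne_top fun l _ => publicWeight_ne_top _ _ _ _ _)
    (ENNReal.mul_ne_top (P.coordPart_ne_top _) (PMF.apply_ne_top _ _))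
  factor_ne_top i b c := ENNReal.sum_ne_top.2 fun s _ => ENNReal.mul_ne_top
    (ENNReal.prod_ne_top fun l _ => weight_ne_top _ _ _ _ _ _ _ _) (P.playerPart_ne_top _ _ _)
  tsum_eq_one x := by
    -- With mode `0` every column has positive probability, so the total mass can be read off by
    -- conditioning on it.
    have h := tsum_map_pair_left (full P) (ext j) (fun ω => ω.1 j) (x, false, 0)
    rw [map_full_eval] at h
    have h1 : ∀ t, (full P).map (fun ω => (ext j ω, ω.1 j)) (t, x, false, 0) =
        xi k (x, false, 0) * (baseFactor P j t * ∏ i, playerFactor P j i (x i) (view i t)) := by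
      intro t
      rw [← map_full_ext P j (x, false, 0) t]
      exact map_apply_injective (full P) (fun ω => (ω.1 j, ext j ω)) Prod.swap_injective
        ((x, false, 0), t)
    simp only [h1, ENNReal.tsum_mul_left] at h
    exact (ENNReal.mul_right_inj (xi_false_ne_zero x 0) (xi_ne_top _)).1 (h.trans (mul_one _).symm)

lemma map_full_law (j : Fin n) (v : (Fin k → Bool) × Bool × Fin k) (t : Ext n k) :
    (full P).map (fun ω => (ω.1 j, ext j ω)) (v, t) = xi k v * (rect P j).law v.1 t :=
  map_full_ext P j v t

/-- The joint distribution of a coordinate and the view of a player. -/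
lemma map_full_view (j : Fin n) (i : Fin k) (v : (Fin k → Bool) × Bool × Fin k) (c : View n k) :
    (full P).map (fun ω => (ω.1 j, view i (ext j ω))) (v, c) =
      xi k v * (rect P j).viewLaw i v.1 c := by
  classical
  rw [map_apply_comp (full P) (fun ω => (ω.1 j, ext j ω)) (fun u => (u.1, view i u.2)),
    ENNReal.tsum_prod', tsum_eq_single v]
  · rw [Rectangular.viewLaw, ← ENNReal.tsum_mul_left]
    refine tsum_congr fun t => ?_
    rw [map_full_law]
    by_cases h : view i t = c
    · rw [if_pos (by rw [h]), if_pos (show (rect P j).view i t = c from h)]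
    · rw [if_neg (fun h' => h (Prod.mk.inj h').2),
        if_neg (show ¬ (rect P j).view i t = c from h), mul_zero]
  · intro u hu
    simp [hu]

end HardDist

/-! ### One coordinate: revealed information and the gap in the output -/

namespace HardDist

open Info Coordinator

section

variable {α : Type} [Fintype α]

lemma sum_iid_forall (p : PMF α) {n : ℕ} (c : Fin n → α → Prop) [∀ l a, Decidable (c l a)] :
    ∑ w : Fin n → α, (if ∀ l, c l (w l) then iid p n w else 0) =
      ∏ l, ∑ a, if c l a then p a else 0 := by
  rw [← sum_prod_pi (fun l a => if c l a then p a else 0)]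
  refine Finset.sum_congr rfl fun w _ => ?_
  split_ifs with h
  · rw [iid_apply]
    exact Finset.prod_congr rfl fun l _ => (if_pos (h l)).symm
  · obtain ⟨l, hl⟩ := not_forall.1 h
    exact (Finset.prod_eq_zero (Finset.mem_univ l) (if_neg hl)).symm

/-- Overwriting position `i` by `b` reaches every `x` with `x i = b` exactly twice. -/
lemma two_mul_sum_ite {k : ℕ} (i : Fin k) (b : Bool) (F : (Fin k → Bool) → ℝ≥0∞) :
    2 * ∑ x : Fin k → Bool, (if x i = b then F x else 0) =
      ∑ x : Fin k → Bool, F (Function.update x i b) := by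
  let e : Equiv.Perm (Fin k → Bool) := Function.Involutive.toPerm
    (fun x => Function.update x i (!(x i))) (fun x => by simp)
  have h1 : ∑ x : Fin k → Bool, (if x i = b then 0 else F (Function.update x i b)) =
      ∑ x : Fin k → Bool, (if x i = b then F x else 0) := by
    rw [← Equiv.sum_comp e]
    refine Finset.sum_congr rfl fun x _ => ?_
    have he : e x = Function.update x i (!(x i)) := rfl
    rw [he, Function.update_self, Function.update_idem]
    by_cases h : x i = b
    · rw [if_neg (by simp [h]), if_pos h, ← h, Function.update_eq_self]
    · rw [if_pos (by revert h; cases x i <;> cases b <;> simp), if_neg h]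
  rw [two_mul]
  nth_rw 2 [← h1]
  rw [← Finset.sum_add_distrib]
  refine Finset.sum_congr rfl fun x _ => ?_
  by_cases h : x i = b
  · rw [if_pos h, if_pos h, add_zero, ← h, Function.update_eq_self]
  · rw [if_neg h, if_neg h, zero_add]

end

variable {n k : ℕ} [NeZero k] (P : Protocol k (Fin n → Bool))

/-! ### The information about one coordinate -/

lemma map_full_view_comp {α : Type} [DecidableEq α] (j : Fin n) (i : Fin k)
    (φ : (Fin k → Bool) × Bool × Fin k → α) (a : α) (c : View n k) :
    (full P).map (fun ω => (φ (ω.1 j), view i (ext j ω))) (a, c) =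
      ∑ v, if φ v = a then xi k v * (rect P j).viewLaw i v.1 c else 0 := by
  classical
  rw [map_apply_comp (full P) (fun ω => (ω.1 j, view i (ext j ω))) (fun u => (φ u.1, u.2)),
    ENNReal.tsum_prod', tsum_fintype]
  refine Finset.sum_congr rfl fun v _ => ?_
  rw [tsum_eq_single c, map_full_view]
  · by_cases h : φ v = a
    · rw [if_pos (by rw [h]), if_pos h]
    · rw [if_neg fun h' => h (Prod.mk.inj h').1, if_neg h]
  · intro c' hc
    rw [if_neg fun h' => hc (Prod.mk.inj h').2]

/-- `Pr[X_i = b, M = 0, Z = z] = 2 / (3k) · 1 / 2 = 1 / (3k)`, and given this event the other bits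
are uniform. -/
lemma bit_map_eq (j : Fin n) (i : Fin k) (z : Fin k) (b : Bool) (c : View n k) :
    (full P).map (fun ω => ((ω.1 j).1 i, view i (ext j ω), (ω.1 j).2)) (b, c, (false, z)) =
      (rect P j).unifView i b c * (3 * k : ℝ≥0∞)⁻¹ := by
  have h := map_apply_injective (full P)
    (fun ω => (((ω.1 j).1 i, (ω.1 j).2), view i (ext j ω)))
    (e := fun v : (Bool × Bool × Fin k) × View n k => (v.1.1, v.2, v.1.2))
    (fun v w h => by simp only [Prod.mk.injEq] at h; ext <;> simp_all) ((b, (false, z)), c)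
  rw [h, map_full_view_comp P j i (fun v => (v.1 i, v.2)), Fintype.sum_prod_type]
  have h1 : ∀ x : Fin k → Bool, (∑ u : Bool × Fin k, if ((x i, u) : Bool × Bool × Fin k) =
      (b, false, z) then xi k (x, u) * (rect P j).viewLaw i x c else 0) =
      2 * (3 * k : ℝ≥0∞)⁻¹ * (2 ^ k : ℝ≥0∞)⁻¹ *
        if x i = b then (rect P j).viewLaw i x c else 0 := by
    intro x
    rw [Finset.sum_eq_single (false, z), xi_false]
    · by_cases hx : x i = b
      · rw [if_pos hx, if_pos (by rw [hx])]
      · rw [if_neg hx, if_neg (fun h' => hx (Prod.mk.inj h').1), mul_zero]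
    · intro u _ hu
      rw [if_neg (fun h' => hu (Prod.mk.inj h').2)]
    · simp
  simp only [h1]
  rw [← Finset.mul_sum, Rectangular.unifView_eq, ← two_mul_sum_ite i b fun x => (rect P j).viewLaw i x c]
  ring

/-- This is the purpose of the weights `2/3` and `1/3`: with `X_i = 1` and `Z = z ≠ i` both modes
have probability `1 / (3k)`. Mode `0` makes the other bits uniform, mode `1` makes the column
`oneZero z`. -/
lemma mode_map_eq (j : Fin n) {i z : Fin k} (hiz : i ≠ z) (m : Bool) (c : View n k) :
    (full P).map (fun ω => ((ω.1 j).2.1, view i (ext j ω), ((ω.1 j).1 i, (ω.1 j).2.2)))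
        (m, c, (true, z)) =
      (if m then (rect P j).viewLaw i (Rectangular.oneZero z) c
        else (rect P j).unifView i true c) * (3 * k : ℝ≥0∞)⁻¹ := by
  cases m
  · rw [if_neg (by simp), ← bit_map_eq P j i z]
    exact map_apply_injective (full P) (fun ω => ((ω.1 j).1 i, view i (ext j ω), (ω.1 j).2))
      (e := fun v : Bool × View n k × Bool × Fin k => (v.2.2.1, v.2.1, v.1, v.2.2.2))
      (fun v w h => by simp only [Prod.mk.injEq] at h; ext <;> simp_all) (true, c, (false, z))
  · have h := map_apply_injective (full P)
      (fun ω => (((ω.1 j).1 i, (ω.1 j).2), view i (ext j ω)))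
      (e := fun v : (Bool × Bool × Fin k) × View n k => (v.1.2.1, v.2, v.1.1, v.1.2.2))
      (fun v w h => by simp only [Prod.mk.injEq] at h; ext <;> simp_all) ((true, (true, z)), c)
    rw [if_pos rfl, h, map_full_view_comp P j i (fun v => (v.1 i, v.2)), Fintype.sum_prod_type,
      Finset.sum_eq_single (Rectangular.oneZero z), Finset.sum_eq_single (true, z), xi_true,
      if_pos rfl, if_pos, mul_comm]
    · simp [Rectangular.oneZero, hiz]
    · intro u _ hu
      rw [if_neg (fun h' => hu (Prod.mk.inj h').2)]
    · simp
    · intro x _ hx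
      refine Finset.sum_eq_zero fun u _ => ?_
      by_cases hu : u = (true, z)
      · rw [hu, xi_true, if_neg hx, zero_mul, ite_self]
      · exact if_neg fun h' => hu (Prod.mk.inj h').2
    · simp

omit [NeZero k] in
lemma three_mul_inv_ne_zero : (3 * k : ℝ≥0∞)⁻¹ ≠ 0 :=
  ENNReal.inv_ne_zero.2 (ENNReal.mul_ne_top (by simp) (by simp))

lemma three_mul_inv_ne_top : (3 * k : ℝ≥0∞)⁻¹ ≠ ∞ := by
  simp [NeZero.ne k]

lemma bit_information (j : Fin n) (i : Fin k) :
    natEntropy (full P) (fun ω => (ω.1 j).1 i) (fun ω => (view i (ext j ω), (ω.1 j).2)) +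
        (3 * k : ℝ≥0∞)⁻¹ / 2 * (k * (rect P j).inputDist i) ≤
      natEntropy (full P) (fun ω => (ω.1 j).1 i) (fun ω => (ω.1 j).2) := by
  classical
  have h := natEntropy_add_sum_hsq_le (full P) (fun ω => (ω.1 j).1 i)
    (fun ω => view i (ext j ω)) (fun ω => (ω.1 j).2)
    (Finset.univ.image fun z : Fin k => (false, z)) _ three_mul_inv_ne_zero three_mul_inv_ne_top
    (fun _ b c => (rect P j).unifView i b c)
    (fun d hd b c => by
      obtain ⟨z, _, rfl⟩ := Finset.mem_image.1 hd
      exact bit_map_eq P j i z b c)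
    (fun d _ b => (rect P j).tsum_unifView i b)
  -- With mode `0` the view does not depend on the special player, so all `k` values of `z`
  -- contribute equally.
  rw [Finset.sum_const, Finset.card_image_of_injective _ (Prod.mk_right_injective false),
    Finset.card_univ, Fintype.card_fin, nsmul_eq_mul] at h
  exact h

lemma mode_information (j : Fin n) (i : Fin k) :
    natEntropy (full P) (fun ω => (ω.1 j).2.1)
          (fun ω => (view i (ext j ω), ((ω.1 j).1 i, (ω.1 j).2.2))) +
        (3 * k : ℝ≥0∞)⁻¹ / 2 * ∑ z ∈ Finset.univ.erase i, (rect P j).modeDist i z ≤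
      natEntropy (full P) (fun ω => (ω.1 j).2.1) (fun ω => ((ω.1 j).1 i, (ω.1 j).2.2)) := by
  classical
  have h := natEntropy_add_sum_hsq_le (full P) (fun ω => (ω.1 j).2.1)
    (fun ω => view i (ext j ω)) (fun ω => ((ω.1 j).1 i, (ω.1 j).2.2))
    ((Finset.univ.erase i).image fun z : Fin k => (true, z)) _ three_mul_inv_ne_zero
    three_mul_inv_ne_top
    (fun d m c => if m then (rect P j).viewLaw i (Rectangular.oneZero d.2) c
        else (rect P j).unifView i true c)
    (fun d hd m c => by
      obtain ⟨z, hz, rfl⟩ := Finset.mem_image.1 hd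
      exact mode_map_eq P j (Finset.ne_of_mem_erase hz).symm m c)
    (fun d _ m => by
      cases m
      · simpa using (rect P j).tsum_unifView i true
      · simpa using (rect P j).tsum_viewLaw i (Rectangular.oneZero d.2))
  rw [Finset.sum_image fun _ _ _ _ h => (Prod.mk.inj h).2] at h
  simpa [Rectangular.modeDist] using h

/-! ### The output of the protocol tells the input `1, …, 1` apart -/

/-- The probability that a coordinate is all ones. -/
def onesProb (k : ℕ) [NeZero k] : ℝ≥0∞ :=
  ∑ v : (Fin k → Bool) × Bool × Fin k, if ∀ i, v.1 i = true then xi k v else 0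

/-- Mode `1` always puts a `0` at the special player, so only mode `0` contributes. -/
lemma onesProb_le : onesProb k ≤ 2 / 3 * (2 ^ k : ℝ≥0∞)⁻¹ := by
  rw [onesProb, Fintype.sum_prod_type, Finset.sum_eq_single (fun _ => true), Fintype.sum_prod_type,
    Fintype.sum_bool]
  · have h1 : ∀ z : Fin k, (fun _ : Fin k => true) ≠ Rectangular.oneZero z := fun z h => by
      simpa [Rectangular.oneZero] using congrFun h z
    simp only [implies_true, if_true, xi_true, h1, if_false, Finset.sum_const_zero, zero_add,
      xi_false, Finset.sum_const, Finset.card_univ, Fintype.card_fin, nsmul_eq_mul]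
    rw [ENNReal.mul_inv (Or.inl (by simp)) (Or.inl (by simp)), div_eq_mul_inv]
    have : (k : ℝ≥0∞) * (k : ℝ≥0∞)⁻¹ = 1 := ENNReal.mul_inv_cancel (by simp [NeZero.ne k]) (by simp)
    calc (k : ℝ≥0∞) * (2 * (3⁻¹ * (k : ℝ≥0∞)⁻¹) * (2 ^ k)⁻¹) =
        ((k : ℝ≥0∞) * (k : ℝ≥0∞)⁻¹) * (2 * 3⁻¹ * (2 ^ k)⁻¹) := by ring
      _ ≤ _ := by rw [this, one_mul]
  · intro x _ hx
    refine Finset.sum_eq_zero fun u _ => if_neg fun h => hx (funext h)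
  · simp

/-- The probability that a coordinate is not all ones. -/
def notOnesProb (k : ℕ) [NeZero k] : ℝ≥0∞ :=
  ∑ v : (Fin k → Bool) × Bool × Fin k, if ∀ i, v.1 i = true then 0 else xi k v

lemma onesProb_add : onesProb k + notOnesProb k = 1 := by
  rw [onesProb, notOnesProb, ← Finset.sum_add_distrib, ← (xi k).tsum_coe, tsum_fintype]
  refine Finset.sum_congr rfl fun v _ => ?_
  split_ifs <;> simp

/-- The probability that no coordinate after `j` is all ones. -/
def laterProb (k : ℕ) [NeZero k] (j : Fin n) : ℝ≥0∞ := ∏ l, if j < l then notOnesProb k else 1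

/-- No coordinate after `j` is all ones. -/
def LaterGood (j : Fin n) (X : Fin k → Fin n → Bool) : Prop := ∀ l, j < l → ¬ ∀ i, X i l = true

open Classical in
lemma sum_laterGood (j : Fin n) (v : (Fin k → Bool) × Bool × Fin k) :
    ∑ w : Fin n → (Fin k → Bool) × Bool × Fin k,
      (if w j = v ∧ LaterGood j (inputs w) then eta n k w else 0) = xi k v * laterProb k j := by
  have h := sum_iid_forall (xi k) (n := n)
    (fun l u => (l = j → u = v) ∧ (j < l → ¬ ∀ i, u.1 i = true))
  have h1 : ∀ w : Fin n → (Fin k → Bool) × Bool × Fin k,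
      (w j = v ∧ LaterGood j (inputs w)) ↔
        ∀ l, (l = j → w l = v) ∧ (j < l → ¬ ∀ i, (w l).1 i = true) := by
    intro w
    simp only [forall_and, forall_eq]
    rfl
  simp only [h1]
  refine h.trans ?_
  have h2 : ∀ l, (∑ u : (Fin k → Bool) × Bool × Fin k,
      if (l = j → u = v) ∧ (j < l → ¬ ∀ i, u.1 i = true) then xi k u else 0) =
      (if l = j then xi k v else 1) * (if j < l then notOnesProb k else 1) := by
    intro l
    rcases lt_trichotomy l j with hl | hl | hl
    · simp only [hl.ne, not_lt_of_gt hl, false_imp_iff, and_true, if_true, if_false, one_mul]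
      rw [← tsum_fintype (L := .unconditional _), (xi k).tsum_coe]
    · simp [hl]
    · simp only [hl.ne', hl, false_imp_iff, true_and, true_imp_iff, if_true, if_false, one_mul,
        ite_not, notOnesProb]
  rw [Finset.prod_congr rfl fun l _ => h2 l, Finset.prod_mul_distrib, laterProb]
  simp

open Classical in
lemma sum_laterGood_ones {j l₀ : Fin n} (hl₀ : l₀ < j) (v : (Fin k → Bool) × Bool × Fin k) :
    ∑ w : Fin n → (Fin k → Bool) × Bool × Fin k,
      (if w j = v ∧ LaterGood j (inputs w) ∧ (∀ i, inputs w i l₀ = true) then eta n k w else 0) =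
        xi k v * laterProb k j * onesProb k := by
  have h := sum_iid_forall (xi k) (n := n)
    (fun l u => (l = j → u = v) ∧ (j < l → ¬ ∀ i, u.1 i = true) ∧ (l = l₀ → ∀ i, u.1 i = true))
  have h1 : ∀ w : Fin n → (Fin k → Bool) × Bool × Fin k,
      (w j = v ∧ LaterGood j (inputs w) ∧ (∀ i, inputs w i l₀ = true)) ↔
        ∀ l, (l = j → w l = v) ∧ (j < l → ¬ ∀ i, (w l).1 i = true) ∧
          (l = l₀ → ∀ i, (w l).1 i = true) := by
    intro w
    simp only [forall_and, forall_eq]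
    rfl
  simp only [h1]
  refine h.trans ?_
  have h2 : ∀ l, (∑ u : (Fin k → Bool) × Bool × Fin k,
      if (l = j → u = v) ∧ (j < l → ¬ ∀ i, u.1 i = true) ∧ (l = l₀ → ∀ i, u.1 i = true)
        then xi k u else 0) =
      (if l = j then xi k v else 1) * (if j < l then notOnesProb k else 1) *
        (if l = l₀ then onesProb k else 1) := by
    intro l
    rcases lt_trichotomy l j with hl | hl | hl
    · by_cases h0 : l = l₀
      · subst h0
        simp [hl.ne, not_lt_of_gt hl, onesProb]
      · simp only [hl.ne, h0, not_lt_of_gt hl, false_imp_iff, and_true, if_true, if_false, one_mul]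
        rw [← tsum_fintype (L := .unconditional _), (xi k).tsum_coe]
    · have h0 : l ≠ l₀ := fun h => by rw [← h, hl] at hl₀; exact lt_irrefl _ hl₀
      simp only [hl, hl ▸ h0]
      simp
    · have h0 : l ≠ l₀ := fun h => by rw [← h] at hl₀; exact lt_asymm hl hl₀
      simp only [hl.ne', hl, h0, false_imp_iff, true_and, and_true, true_imp_iff, if_true, if_false,
        one_mul, mul_one, ite_not, notOnesProb]
  rw [Finset.prod_congr rfl fun l _ => h2 l, Finset.prod_mul_distrib, Finset.prod_mul_distrib,
    laterProb]
  simp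

/-- The event that the output is `true` and no later coordinate is all ones. -/
def outEvent (j : Fin n) (t : Ext n k) : ℝ≥0∞ :=
  open Classical in if t.2.2.2.2 = true ∧ LaterGood j t.2.2.1 then 1 else 0

omit [NeZero k] in
lemma outEvent_le_one (j : Fin n) (t : Ext n k) : outEvent j t ≤ 1 := by
  unfold outEvent
  split_ifs <;> simp

omit [NeZero k] in
lemma laterGood_maskGt (j : Fin n) (X : Fin k → Fin n → Bool) :
    LaterGood j (fun i => maskGt j (X i)) ↔ LaterGood j X := by
  refine forall_congr' fun l => ?_
  refine imp_congr_right fun hl => ?_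
  simp [maskGt, hl]

open Classical in
/-- The probability of the output event in terms of the output probabilities of the protocol. -/
lemma tsum_outEvent (j : Fin n) (v : (Fin k → Bool) × Bool × Fin k) :
    xi k v * ∑' t, outEvent j t * (rect P j).law v.1 t =
      ∑ w : Fin n → (Fin k → Bool) × Bool × Fin k,
        (if w j = v ∧ LaterGood j (inputs w) then eta n k w else 0) *
          (P.law (inputs w)).map Prod.snd true := by
  have h1 : xi k v * ∑' t, outEvent j t * (rect P j).law v.1 t =
      ∑' u, (full P).map (fun ω => (ω.1 j, ext j ω)) u * (if u.1 = v then outEvent j u.2 else 0) := by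
    refine Eq.symm (ENNReal.tsum_prod'.trans ?_)
    rw [tsum_eq_single v, ← ENNReal.tsum_mul_left]
    · refine tsum_congr fun t => ?_
      rw [map_full_law, if_pos rfl]
      ring
    · intro u hu
      simp [hu]
  rw [h1, ← expect_comp (full P) (fun ω => (ω.1 j, ext j ω))
    (fun u => if u.1 = v then outEvent j u.2 else 0), expect, ENNReal.tsum_prod', tsum_fintype]
  refine Finset.sum_congr rfl fun w _ => ?_
  have h2 : ∀ t, full P (w, t) = eta n k w * P.law (inputs w) t := by
    intro t
    have e1 : (full P).map (fun ω => (ω.1, ω.2)) = full P := PMF.map_id _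
    have e2 : (eta n k).map (fun w => w) = eta n k := PMF.map_id _
    have e3 : (P.law (inputs w)).map (fun t => t) = P.law (inputs w) := PMF.map_id _
    have := map_full_pair P (fun w => w) (fun t => t) w (fun _ h => by rw [h]) t
    rwa [e1, e2, e3] at this
  rw [PMF.map_apply, ← ENNReal.tsum_mul_left]
  refine tsum_congr fun t => ?_
  rw [h2]
  simp only [outEvent, ext, laterGood_maskGt, eq_comm (a := true)]
  by_cases ha : w j = v <;> by_cases hb : LaterGood j (inputs w) <;> by_cases hc : t.2 = true <;>
    simp [ha, hb, hc]

variable {P} {δ : ℝ}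

omit [NeZero k] in
lemma output_le_of_disj_false (hP : P.HasError (disj n k) δ)
    {X : Fin k → Fin n → Bool} (h : disj n k X = false) :
    (P.law X).map Prod.snd true ≤ ENNReal.ofReal δ := by
  simpa only [h, Bool.not_false] using hP X

omit [NeZero k] in
lemma one_le_output_of_disj_true (hP : P.HasError (disj n k) δ)
    {X : Fin k → Fin n → Bool} (h : disj n k X = true) :
    1 ≤ (P.law X).map Prod.snd true + ENNReal.ofReal δ := by
  have h1 := hP X
  rw [h, Bool.not_true] at h1
  rw [← ((P.law X).map Prod.snd).tsum_coe, tsum_fintype, Fintype.sum_bool]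
  gcongr

/-- A column of ones at `j` makes the correct answer `true` whatever the other columns are, so each
such input loses at most `δ`. -/
lemma laterProb_le (hP : P.HasError (disj n k) δ) (j : Fin n) :
    laterProb k j ≤ ∑' t, outEvent j t * (rect P j).law (fun _ => true) t +
      laterProb k j * ENNReal.ofReal δ := by
  classical
  have h0 := xi_false_ne_zero (k := k) (fun _ => true) 0
  have h1 := tsum_outEvent P j (fun _ => true, false, 0)
  refine (ENNReal.mul_le_mul_iff_right h0 (xi_ne_top _)).1 ?_
  rw [mul_add, h1, ← mul_assoc, ← sum_laterGood, Finset.sum_mul, ← Finset.sum_add_distrib]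
  refine Finset.sum_le_sum fun w _ => ?_
  rw [← mul_add]
  by_cases hw : w j = (fun _ => true, false, 0) ∧ LaterGood j (inputs w)
  · refine le_mul_of_one_le_right' (one_le_output_of_disj_true hP ?_)
    simp only [disj, decide_eq_true_eq]
    exact ⟨j, fun i => by rw [inputs, hw.1]⟩
  · rw [if_neg hw, zero_mul]

/-- If neither column `j` nor a later one is all ones, the output `true` is an error unless one of
the `j` earlier columns is all ones. These cannot be seen in the extended transcript and are handled
by a union bound. -/
lemma outEvent_law_le (hP : P.HasError (disj n k) δ) (j : Fin n)
    {x : Fin k → Bool} (hx : x ≠ fun _ => true) :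
    ∑' t, outEvent j t * (rect P j).law x t ≤
      laterProb k j * (ENNReal.ofReal δ + j * onesProb k) := by
  classical
  have h0 := xi_false_ne_zero (k := k) x 0
  have h1 := tsum_outEvent P j (x, false, 0)
  refine (ENNReal.mul_le_mul_iff_right h0 (xi_ne_top _)).1 ?_
  rw [h1]
  set v : (Fin k → Bool) × Bool × Fin k := (x, false, 0)
  calc ∑ w : Fin n → (Fin k → Bool) × Bool × Fin k,
        (if w j = v ∧ LaterGood j (inputs w) then eta n k w else 0) *
          (P.law (inputs w)).map Prod.snd true
      ≤ ∑ w : Fin n → (Fin k → Bool) × Bool × Fin k,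
        ((if w j = v ∧ LaterGood j (inputs w) then eta n k w else 0) * ENNReal.ofReal δ +
          ∑ l ∈ Finset.univ.filter (· < j),
            if w j = v ∧ LaterGood j (inputs w) ∧ (∀ i, inputs w i l = true)
              then eta n k w else 0) := by
        refine Finset.sum_le_sum fun w _ => ?_
        by_cases hw : w j = v ∧ LaterGood j (inputs w)
        · rw [if_pos hw]
          by_cases hd : disj n k (inputs w) = false
          · exact le_add_right (mul_le_mul_right (output_le_of_disj_false hP hd) _)
          · rw [Bool.not_eq_false] at hd
            obtain ⟨l, hl⟩ : ∃ l, ∀ i, inputs w i l = true := by simpa [disj] using hd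
            have hlj : l < j := by
              rcases lt_trichotomy l j with h | h | h
              · exact h
              · exfalso
                apply hx
                funext i
                have := hl i
                rw [h, inputs, hw.1] at this
                exact this
              · exact absurd hl (hw.2 l h)
            refine le_add_left (le_trans ?_ (Finset.single_le_sum (fun _ _ => zero_le)
              (Finset.mem_filter.2 ⟨Finset.mem_univ l, hlj⟩)))
            rw [if_pos ⟨hw.1, hw.2, hl⟩]
            exact mul_le_of_le_one_right' (PMF.coe_le_one _ _)
        · rw [if_neg hw, zero_mul]
          exact zero_le
    _ = xi k v * (laterProb k j * (ENNReal.ofReal δ + j * onesProb k)) := by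
        rw [Finset.sum_add_distrib, ← Finset.sum_mul, sum_laterGood, Finset.sum_comm,
          Finset.sum_congr rfl fun l hl => sum_laterGood_ones (Finset.mem_filter.1 hl).2 v,
          Finset.sum_const]
        have : (Finset.univ.filter (· < j)).card = (j : ℕ) := by
          rw [← Fin.card_Iio j]
          congr 1
          ext l
          simp
        rw [this, nsmul_eq_mul]
        ring

end HardDist

/-! ### Mutual information in terms of `natEntropy` -/

namespace Info

variable {Ω α β γ : Type}

lemma natEntropy_comp_injective (μ : PMF Ω) (A : Ω → α) (B : Ω → β) {e : β → γ}
    (he : Function.Injective e) :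
    natEntropy μ A (fun ω => e (B ω)) = natEntropy μ A B := by
  have h : ∀ a b, cprob μ A (fun ω => e (B ω)) a (e b) = cprob μ A B a b := by
    intro a b
    rw [cprob, cprob, map_apply_injective μ B he]
    congr 1
    exact map_apply_injective μ (fun ω => (A ω, B ω)) (e := fun v => (v.1, e v.2))
      (fun v w h => Prod.ext (Prod.mk.inj h).1 (he (Prod.mk.inj h).2)) (a, b)
  simp only [natEntropy, surprisal, h]

lemma mutualInfo_eq [Fintype α] (μ : PMF Ω) (A : Ω → α) (B : Ω → β) :
    mutualInfo μ A B * Real.log 2 =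
      (natEntropy μ A fun _ => ()).toReal - (natEntropy μ A fun ω => (B ω, ())).toReal := by
  rw [mutualInfo, entropy_eq, condEntropy_eq, ← sub_div,
    div_mul_cancel₀ _ (Real.log_pos one_lt_two).ne',
    natEntropy_comp_injective μ A B (e := fun b => (b, ())) (fun _ _ h => (Prod.mk.inj h).1)]

lemma condMutualInfo_eq [Fintype α] (μ : PMF Ω) (A : Ω → α) (B : Ω → β) (C : Ω → γ) :
    condMutualInfo μ A B C * Real.log 2 =
      (natEntropy μ A C).toReal - (natEntropy μ A fun ω => (B ω, C ω)).toReal := by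
  rw [condMutualInfo, condEntropy_eq, condEntropy_eq, ← sub_div,
    div_mul_cancel₀ _ (Real.log_pos one_lt_two).ne']

end Info

/-! ### Superadditivity over the coordinates -/

namespace HardDist

open Info Coordinator

variable {n k : ℕ} [NeZero k] (P : Protocol k (Fin n → Bool))

lemma map_full_coord {α : Type} (φ : (Fin k → Bool) × Bool × Fin k → α) (j : Fin n) :
    (full P).map (fun ω => φ (ω.1 j)) = (xi k).map φ := by
  rw [← map_full_eval P j, PMF.map_comp]
  rfl

/-- As `fA` and `fC` determine the inputs, the transcript has the same conditional law given them as
given all triples; stated without division. -/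
lemma markov {α β γ : Type} (fA : (Fin n → (Fin k → Bool) × Bool × Fin k) → α)
    (fC : (Fin n → (Fin k → Bool) × Bool × Fin k) → γ) (g : History k × Bool → β)
    (hf : ∀ w v, fA w = fA v → fC w = fC v → inputs w = inputs v)
    (v : Fin n → (Fin k → Bool) × Bool × Fin k) (b : β) :
    (full P).map (fun ω => (ω.1, g ω.2)) (v, b) *
        (full P).map (fun ω => (fA ω.1, fC ω.1)) (fA v, fC v) =
      (full P).map (fun ω => ω.1) v *
        (full P).map (fun ω => (fA ω.1, g ω.2, fC ω.1)) (fA v, b, fC v) := by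
  have h1 := map_full_pair P (fun w => w) g v (fun w h => by rw [h]) b
  have h2 := map_full_pair P (fun w => (fA w, fC w)) g v
    (fun w h => hf w v (Prod.mk.inj h).1 (Prod.mk.inj h).2) b
  have h3 := map_apply_injective (full P) (fun ω => ((fA ω.1, fC ω.1), g ω.2))
    (e := fun u : (α × γ) × β => (u.1.1, u.2, u.1.2))
    (fun v w h => by simp only [Prod.mk.injEq] at h; ext <;> simp_all) ((fA v, fC v), b)
  rw [h1, h3, h2, map_full_fst P (fun w => (fA w, fC w)), map_full_fst P (fun w => w)]
  ring

lemma cprob_bit (j : Fin n) (i : Fin k) (b : Bool) (u : Bool × Fin k) :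
    cprob (full P) (fun ω => (ω.1 j).1 i) (fun ω => (ω.1 j).2) b u = bitProb u.1 u.2 i b := by
  rw [cprob, map_full_coord P (fun v => (v.1 i, v.2)), map_full_coord P Prod.snd, map_xi_bit,
    map_xi_snd]
  rw [mul_comm]
  exact ENNReal.mul_div_cancel_right (mul_ne_zero (mode_ne_zero _) (by simp))
    (ENNReal.mul_ne_top (PMF.apply_ne_top _ _) (by simp [NeZero.ne k]))

/-- The transcript reveals information on the inputs, coordinate by coordinate. -/
lemma superadditivity_bits :
    natEntropy (full P) (fun ω => inputs ω.1) (fun ω => (ω.2.1, ())) +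
        ∑ s : Fin k × Fin n,
          natEntropy (full P) (fun ω => (ω.1 s.2).1 s.1) (fun ω => (ω.1 s.2).2) ≤
      natEntropy (full P) (fun ω => inputs ω.1) (fun _ => ()) +
        ∑ s : Fin k × Fin n, natEntropy (full P) (fun ω => (ω.1 s.2).1 s.1)
          (fun ω => (view s.1 (ext s.2 ω), (ω.1 s.2).2)) := by
  have h := natEntropy_add_sum_le (full P) (fun ω => ω.1) (fun ω => ω.2.1) inputs (fun _ => ())
    (fun w j => (w j).2) (fun w (s : Fin k × Fin n) => (w s.2).1 s.1) (fun s y => y s.2)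
    (fun s b y t => ((maskLt s.2 (fun l => (y l).1), maskNe s.2 (fun l => (y l).2),
      maskGt s.2 (fun l => t (s.1, l)), chan s.1 b), y s.2))
  refine h ?_ ?_ ?_ <;> clear h
  · intro v b
    exact (markov P inputs (fun _ => ()) Prod.fst (fun w v h _ => h) v b).le
  -- Given all modes and special players, the input bits are independent.
  · intro y t
    have hY : (full P).map (fun ω => fun j => (ω.1 j).2) y =
        ∏ j, (mode (y j).1 * (k : ℝ≥0∞)⁻¹) := by
      rw [map_full_fst P (fun w j => (w j).2), eta, map_iid_apply (xi k) n Prod.snd]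
      simp only [map_xi_snd]
    have hYT := map_apply_injective (full P) (fun ω => ω.1)
      (e := fun w : Fin n → (Fin k → Bool) × Bool × Fin k =>
        ((fun j => (w j).2, fun s => (w s.2).1 s.1) : (Fin n → Bool × Fin k) × (Fin k × Fin n → Bool)))
      (fun v w h => by
        obtain ⟨h1, h2⟩ := Prod.mk.inj h
        funext j
        exact Prod.ext (funext fun i => congrFun h2 (i, j)) (congrFun h1 j))
      (fun j => (fun i => t (i, j), y j))
    refine le_of_eq (hYT.trans ?_)
    rw [hY, map_full_fst P (fun w => w)]
    have e2 : (eta n k).map (fun w => w) = eta n k := PMF.map_id _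
    simp only [e2, cprob_bit]
    rw [eta, iid_apply, Fintype.prod_prod_type, Finset.prod_comm, ← Finset.prod_mul_distrib]
    exact Finset.prod_congr rfl fun j _ => xi_apply _ _ _
  -- For each player the prediction of bit `j` uses only its later bits, so the product is a chain
  -- in decreasing order of `j`.
  · intro b y
    rw [tsum_fintype, ← (Equiv.curry (Fin k) (Fin n) Bool).symm.sum_comp]
    simp only [Fintype.prod_prod_type]
    refine le_of_eq_of_le (sum_prod_pi (fun i (t : Fin n → Bool) => ∏ j, cprob (full P)
      (fun ω => (ω.1 j).1 i) (fun ω => (view i (ext j ω), (ω.1 j).2)) (t j)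
        ((maskLt j (fun l => (y l).1), maskNe j (fun l => (y l).2), maskGt j t, chan i b), y j))) ?_
    refine Finset.prod_le_one' fun i _ => ?_
    refine sum_prod_le_one_of_gt (fun j a t => cprob (full P)
      (fun ω => (ω.1 j).1 i) (fun ω => (view i (ext j ω), (ω.1 j).2)) a
        ((maskLt j (fun l => (y l).1), maskNe j (fun l => (y l).2), maskGt j t, chan i b), y j)) ?_ ?_
    · intro j a t t' h
      have : maskGt j t = maskGt j t' := by
        funext l
        unfold maskGt
        split_ifs with hl
        · exact h l hl
        · rfl
      simp only [this]
    · intro j t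
      exact (tsum_fintype _).symm.le.trans (tsum_cprob_le_one _ _ _ _)

/-- The channel of a player reveals information on the modes, coordinate by coordinate. -/
lemma superadditivity_modes (i : Fin k) :
    natEntropy (full P) (fun ω => fun l : {l : Fin k // l ≠ i} => inputs ω.1 l)
          (fun ω => (chan i ω.2.1, inputs ω.1 i)) +
        ∑ j : Fin n, natEntropy (full P) (fun ω => (ω.1 j).2.1)
          (fun ω => ((ω.1 j).1 i, (ω.1 j).2.2)) ≤
      natEntropy (full P) (fun ω => fun l : {l : Fin k // l ≠ i} => inputs ω.1 l)
          (fun ω => inputs ω.1 i) +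
        ∑ j : Fin n, natEntropy (full P) (fun ω => (ω.1 j).2.1)
          (fun ω => (view i (ext j ω), ((ω.1 j).1 i, (ω.1 j).2.2))) := by
  have h := natEntropy_add_sum_le (full P) (fun ω => ω.1) (fun ω => chan i ω.2.1)
    (fun w => fun l : {l : Fin k // l ≠ i} => inputs w l) (fun y j => (y j).1)
    (fun w j => ((w j).1 i, (w j).2.2)) (fun w j => (w j).2.1) (fun j y => y j)
    (fun j b y t => ((maskLt j t, maskNe j (fun l => (y l).2), maskGt j (fun l => (y l).1), b),
      y j))
  refine h ?_ ?_ ?_ <;> clear h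
  · intro v b
    refine (markov P (fun w => fun l : {l : Fin k // l ≠ i} => inputs w l) (fun w => inputs w i)
      (fun t => chan i t.1) (fun w v h1 h2 => ?_) v b).le
    funext l
    by_cases hl : l = i
    · rw [hl, h2]
    · exact congrFun h1 ⟨l, hl⟩
  -- The triples are independent, so given the bits of player `i` and the special players the modes
  -- are independent, each depending on its own coordinate.
  · intro y t
    have hY : (full P).map (fun ω => fun j => ((ω.1 j).1 i, (ω.1 j).2.2)) y =
        ∏ j, (xi k).map (fun v => (v.1 i, v.2.2)) (y j) := by
      rw [map_full_fst P (fun w j => ((w j).1 i, (w j).2.2)), eta,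
        map_iid_apply (xi k) n (fun v => (v.1 i, v.2.2))]
    have hYT : (full P).map (fun ω => ((fun j => ((ω.1 j).1 i, (ω.1 j).2.2)),
        fun j => (ω.1 j).2.1)) (y, t) =
          ∏ j, (xi k).map (fun v => (v.2.1, (v.1 i, v.2.2))) (t j, y j) := by
      rw [← map_iid_apply (xi k) n (fun v => (v.2.1, (v.1 i, v.2.2))) (fun j => (t j, y j)),
        ← eta, ← map_full_fst P (fun w j => ((w j).2.1, ((w j).1 i, (w j).2.2)))]
      exact map_apply_injective (full P)
        (fun ω => fun j => ((ω.1 j).2.1, ((ω.1 j).1 i, (ω.1 j).2.2)))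
        (e := fun u : Fin n → Bool × Bool × Fin k => ((fun j => (u j).2), fun j => (u j).1))
        (fun u u' h => funext fun j => Prod.ext (congrFun (Prod.mk.inj h).2 j)
          (congrFun (Prod.mk.inj h).1 j)) (fun j => (t j, y j))
    refine le_of_eq ?_
    rw [hYT, hY, ← Finset.prod_mul_distrib]
    refine Finset.prod_congr rfl fun j _ => ?_
    rw [← map_full_coord P (fun v => (v.1 i, v.2.2)) j, mul_cprob,
      ← map_full_coord P (fun v => (v.2.1, (v.1 i, v.2.2))) j]
  -- The prediction of mode `j` uses only earlier modes, so the product is a chain in increasing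
  -- order of `j`.
  · intro b y
    rw [tsum_fintype]
    refine sum_prod_le_one_of_lt (fun j a t => cprob (full P)
      (fun ω => (ω.1 j).2.1) (fun ω => (view i (ext j ω), ((ω.1 j).1 i, (ω.1 j).2.2))) a
        ((maskLt j t, maskNe j (fun l => (y l).2), maskGt j (fun l => (y l).1), b), y j)) ?_ ?_
    · intro j a t t' h
      have : maskLt j t = maskLt j t' := by
        funext l
        unfold maskLt
        split_ifs with hl
        · exact h l hl
        · rfl
      simp only [this]
    · intro j t
      exact (tsum_fintype _).symm.le.trans (tsum_cprob_le_one _ _ _ _)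

/-! ### The lower bound for the information cost -/

lemma add_le_of_add_le_of_forall {ι : Type} [Fintype ι] {a b : ℝ≥0∞} {f g e : ι → ℝ≥0∞}
    (h : a + ∑ s, f s ≤ b + ∑ s, g s) (hg : ∀ s, g s ≠ ∞) (he : ∀ s, g s + e s ≤ f s) :
    a + ∑ s, e s ≤ b := by
  have h1 : a + ∑ s, e s + ∑ s, g s ≤ b + ∑ s, g s := by
    refine le_trans ?_ h
    rw [add_assoc, ← Finset.sum_add_distrib]
    gcongr with s
    rw [add_comm]
    exact he s
  exact (ENNReal.add_le_add_iff_right (ENNReal.sum_ne_top.2 fun s _ => hg s)).1 h1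

/-- The information about coordinate `j` that is revealed to the coordinator and the players. -/
def coordInfo (j : Fin n) : ℝ≥0∞ :=
  (3 * k : ℝ≥0∞)⁻¹ / 2 * (k * ∑ i, (rect P j).inputDist i +
    ∑ i, ∑ z ∈ Finset.univ.erase i, (rect P j).modeDist i z)

/-- The coordinator's information pays for the `inputDist` terms, that of player `i` for the terms
`modeDist i z`; the factor `Real.log 2` converts bits to nats. -/
lemma sum_coordInfo_le :
    ENNReal.toReal (∑ j, coordInfo P j) ≤ P.infoCost (zeta n k) * Real.log 2 := by
  have h1 := add_le_of_add_le_of_forall (superadditivity_bits P)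
    (fun s => natEntropy_ne_top _ _ _) (fun s => bit_information P s.2 s.1)
  have h2 := fun i => add_le_of_add_le_of_forall (superadditivity_modes P i)
    (fun s => natEntropy_ne_top _ _ _) (fun j => mode_information P j i)
  have t1 := ENNReal.toReal_mono (natEntropy_ne_top _ _ _) h1
  have f1 := ne_top_of_le_ne_top (natEntropy_ne_top _ _ _) (le_add_self.trans h1)
  have t2 := fun i => ENNReal.toReal_mono (natEntropy_ne_top _ _ _) (h2 i)
  have f2 := fun i => ne_top_of_le_ne_top (natEntropy_ne_top _ _ _) (le_add_self.trans (h2 i))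
  rw [ENNReal.toReal_add (natEntropy_ne_top _ _ _) f1] at t1
  simp only [fun i => ENNReal.toReal_add (natEntropy_ne_top (full P)
    (fun ω => fun l : {l : Fin k // l ≠ i} => inputs ω.1 l)
          (fun ω => (chan i ω.2.1, inputs ω.1 i))) (f2 i)] at t2
  have hsum : ∑ j, coordInfo P j =
      (∑ s : Fin k × Fin n, (3 * k : ℝ≥0∞)⁻¹ / 2 * (k * (rect P s.2).inputDist s.1)) +
      ∑ i, ∑ j, (3 * k : ℝ≥0∞)⁻¹ / 2 *
        ∑ z ∈ Finset.univ.erase i, (rect P j).modeDist i z := by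
    rw [Fintype.sum_prod_type, Finset.sum_comm,
      Finset.sum_comm (f := fun i j => (3 * k : ℝ≥0∞)⁻¹ / 2 *
        ∑ z ∈ Finset.univ.erase i, (rect P j).modeDist i z), ← Finset.sum_add_distrib]
    refine Finset.sum_congr rfl fun j _ => ?_
    simp only [coordInfo, mul_add, Finset.mul_sum]
  rw [hsum, ENNReal.toReal_add f1 (ENNReal.sum_ne_top.2 fun i _ => f2 i),
    ENNReal.toReal_sum fun i _ => f2 i, Protocol.infoCost, add_mul, Finset.sum_mul,
    mutualInfo_eq]
  refine add_le_add ?_ (Finset.sum_le_sum fun i _ => ?_)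
  · rw [joint_zeta, natEntropy_map, natEntropy_map]
    linarith
  · rw [condMutualInfo_eq, joint_zeta, natEntropy_map, natEntropy_map]
    linarith [t2 i]

/-- Bernoulli's inequality, written without subtraction and proved by adding one coordinate at a
time. -/
lemma one_le_laterProb_add (j : Fin n) : 1 ≤ laterProb k j + n * onesProb k := by
  have h : ∀ s : Finset (Fin n), (∏ l ∈ s, (if j < l then notOnesProb k else 1)) ≤ 1 ∧
      1 ≤ (∏ l ∈ s, if j < l then notOnesProb k else 1) + s.card * onesProb k := by
    have hno : notOnesProb k ≤ 1 := onesProb_add (k := k) ▸ le_add_self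
    intro s
    induction s using Finset.induction_on with
    | empty => simp
    | insert a s ha ih =>
      rw [Finset.prod_insert ha, Finset.card_insert_of_notMem ha]
      set p := ∏ l ∈ s, if j < l then notOnesProb k else 1
      refine ⟨mul_le_one' (by split_ifs <;> simp [hno]) ih.1, ih.2.trans ?_⟩
      have : p ≤ (if j < a then notOnesProb k else 1) * p + onesProb k := by
        split_ifs
        · calc p = notOnesProb k * p + onesProb k * p := by
                rw [← add_mul, add_comm, onesProb_add, one_mul]
            _ ≤ notOnesProb k * p + onesProb k := by
                gcongr
                exact mul_le_of_le_one_right' ih.1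
        · rw [one_mul]
          exact le_self_add
      calc p + s.card * onesProb k ≤
          ((if j < a then notOnesProb k else 1) * p + onesProb k) + s.card * onesProb k := by gcongr
        _ = _ := by push_cast; ring
  simpa [laterProb] using (h Finset.univ).2

/-- Since `onesProb k ≤ (2/3) 2⁻ᵏ`, the bound on `n` gives `laterProb k j ≥ 1/3`, and the bound on
`j` gives `j * onesProb k ≤ (1 - 2δ) / 2`. The output event thus has gap at least `(1/3) (1 - 2δ) /
2 = d`. The factor `288 = 48 · 3 · 2` comes from `card_mul_le` and the weight `(3k)⁻¹ / 2`. -/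
lemma coordInfo_ge {δ : ℝ} (hδ : 0 < δ) (hδ' : δ < 1 / 2) (hP : P.HasError (disj n k) δ)
    (hn : n ≤ 2 ^ k) (j : Fin n) (hj : (j : ℝ) ≤ (1 - 2 * δ) / 2 * 2 ^ k) :
    (k : ℝ≥0∞) * ENNReal.ofReal (((1 - 2 * δ) / 6) ^ 2 / 4 / 288) ≤ coordInfo P j := by
  set d : ℝ := (1 - 2 * δ) / 6 with hd
  have hd0 : 0 < d := by rw [hd]; linarith
  have hpow : (0 : ℝ) < 2 ^ k := by positivity
  have hr : onesProb k ≤ ENNReal.ofReal (2 / 3 * (2 ^ k)⁻¹) := by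
    refine onesProb_le.trans (le_of_eq ?_)
    rw [ENNReal.ofReal_mul (by norm_num), ENNReal.ofReal_inv_of_pos hpow,
      ENNReal.ofReal_pow (by norm_num), ENNReal.ofReal_div_of_pos (by norm_num),
      ENNReal.ofReal_ofNat, ENNReal.ofReal_ofNat]
  have hlater : ENNReal.ofReal (1 / 3) ≤ laterProb k j := by
    have h1 := one_le_laterProb_add (k := k) j
    have h2 : (n : ℝ≥0∞) * onesProb k ≤ ENNReal.ofReal (2 / 3) := by
      calc (n : ℝ≥0∞) * onesProb k ≤ ENNReal.ofReal (2 ^ k) * ENNReal.ofReal (2 / 3 * (2 ^ k)⁻¹) := by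
            gcongr
            rw [← ENNReal.ofReal_natCast]
            exact ENNReal.ofReal_le_ofReal (by exact_mod_cast hn)
        _ = ENNReal.ofReal (2 / 3) := by
            rw [← ENNReal.ofReal_mul hpow.le]
            congr 1
            field_simp
    have h3 : ENNReal.ofReal (1 / 3) + ENNReal.ofReal (2 / 3) ≤
        laterProb k j + ENNReal.ofReal (2 / 3) := by
      rw [← ENNReal.ofReal_add (by norm_num) (by norm_num)]
      norm_num
      exact h1.trans (add_le_add le_rfl (by simpa using h2))
    exact (ENNReal.add_le_add_iff_right ENNReal.ofReal_ne_top).1 h3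
  have hlater1 : laterProb k j ≤ 1 := by
    have hno : notOnesProb k ≤ 1 := onesProb_add (k := k) ▸ le_add_self
    exact Finset.prod_le_one' fun l _ => by split_ifs <;> simp [hno]
  have hjr : (j : ℝ≥0∞) * onesProb k ≤ ENNReal.ofReal ((1 - 2 * δ) / 2) := by
    calc (j : ℝ≥0∞) * onesProb k ≤
        ENNReal.ofReal ((1 - 2 * δ) / 2 * 2 ^ k) * ENNReal.ofReal (2 / 3 * (2 ^ k)⁻¹) := by
          gcongr
          rw [← ENNReal.ofReal_natCast]
          exact ENNReal.ofReal_le_ofReal hj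
      _ ≤ ENNReal.ofReal ((1 - 2 * δ) / 2) := by
          rw [← ENNReal.ofReal_mul (by nlinarith)]
          refine ENNReal.ofReal_le_ofReal ?_
          have : (1 - 2 * δ) / 2 * 2 ^ k * (2 / 3 * (2 ^ k)⁻¹) = (1 - 2 * δ) / 3 := by
            field_simp
          rw [this]
          linarith
  have hgap : ∀ x : Fin k → Bool, x ≠ (fun _ => true) →
      ENNReal.ofReal (d ^ 2 / 4) ≤ hsq ((rect P j).law fun _ => true) ((rect P j).law x) := by
    intro x hx
    refine le_hsq_of_gap ((rect P j).tsum_law _) ((rect P j).tsum_law _) (outEvent j)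
      (outEvent_le_one j) hd0 ?_
    have h1 := laterProb_le hP j
    have h2 := outEvent_law_le hP j hx
    have hδfin : laterProb k j * ENNReal.ofReal δ ≠ ∞ :=
      ENNReal.mul_ne_top (ne_top_of_le_ne_top ENNReal.one_ne_top hlater1) ENNReal.ofReal_ne_top
    refine (ENNReal.add_le_add_iff_right hδfin).1 (le_trans ?_ h1)
    calc ∑' t, outEvent j t * (rect P j).law x t + ENNReal.ofReal d +
          laterProb k j * ENNReal.ofReal δ
        ≤ laterProb k j * (ENNReal.ofReal δ + ENNReal.ofReal ((1 - 2 * δ) / 2)) +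
          laterProb k j * ENNReal.ofReal (3 * d) + laterProb k j * ENNReal.ofReal δ := by
          gcongr
          · exact h2.trans (by gcongr)
          · calc ENNReal.ofReal d = ENNReal.ofReal (1 / 3) * ENNReal.ofReal (3 * d) := by
                  rw [← ENNReal.ofReal_mul (by norm_num)]
                  congr 1
                  ring
              _ ≤ _ := by gcongr
      _ = laterProb k j * ENNReal.ofReal (δ + (1 - 2 * δ) / 2 + 3 * d + δ) := by
          rw [ENNReal.ofReal_add (by linarith) hδ.le, ENNReal.ofReal_add (by linarith) (by linarith),
            ENNReal.ofReal_add hδ.le (by linarith)]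
          ring
      _ = laterProb k j := by
          rw [show δ + (1 - 2 * δ) / 2 + 3 * d + δ = 1 by rw [hd]; ring, ENNReal.ofReal_one, mul_one]
  have hmain := (rect P j).card_mul_le _ hgap
  have hk0 : (k : ℝ≥0∞) ≠ 0 := by simp [NeZero.ne k]
  have hkt : (k : ℝ≥0∞) ≠ ∞ := by simp
  rw [coordInfo]
  set T := (k : ℝ≥0∞) * ∑ i, (rect P j).inputDist i +
    ∑ i, ∑ z ∈ Finset.univ.erase i, (rect P j).modeDist i z
  have e1 : ENNReal.ofReal (d ^ 2 / 4 / 288) = ENNReal.ofReal (d ^ 2 / 4) * (288 : ℝ≥0∞)⁻¹ := by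
    rw [ENNReal.ofReal_div_of_pos (by norm_num), ENNReal.ofReal_ofNat, div_eq_mul_inv]
  have e2 : (288 : ℝ≥0∞)⁻¹ = (48 : ℝ≥0∞)⁻¹ * (3 : ℝ≥0∞)⁻¹ * 2⁻¹ := by
    rw [← ENNReal.mul_inv (Or.inl (by simp)) (Or.inl (by simp)),
      ← ENNReal.mul_inv (Or.inl (by finiteness)) (Or.inl (by norm_num))]
    norm_num
  calc (k : ℝ≥0∞) * ENNReal.ofReal (d ^ 2 / 4 / 288)
      = (3 * k : ℝ≥0∞)⁻¹ / 2 * (48⁻¹ * (k * k * ENNReal.ofReal (d ^ 2 / 4))) := by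
        rw [e1, e2, ENNReal.mul_inv (Or.inl (by simp)) (Or.inl (by simp)), div_eq_mul_inv _ (2 : ℝ≥0∞)]
        calc (k : ℝ≥0∞) * (ENNReal.ofReal (d ^ 2 / 4) * (48⁻¹ * 3⁻¹ * 2⁻¹))
            = ((k : ℝ≥0∞)⁻¹ * k) * (k * (ENNReal.ofReal (d ^ 2 / 4) * (48⁻¹ * 3⁻¹ * 2⁻¹))) := by
              rw [ENNReal.inv_mul_cancel hk0 hkt, one_mul]
          _ = _ := by ring
    _ ≤ (3 * k : ℝ≥0∞)⁻¹ / 2 * (48⁻¹ * (48 * T)) := by gcongr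
    _ = (3 * k : ℝ≥0∞)⁻¹ / 2 * T := by
        rw [← mul_assoc 48⁻¹, ENNReal.inv_mul_cancel (by simp) (by simp), one_mul]

/-- The constant in the lower bound. -/
def lowerConst (δ : ℝ) : ℝ := (1 - 2 * δ) / 2 * (((1 - 2 * δ) / 6) ^ 2 / 4 / 288)

lemma lowerConst_pos {δ : ℝ} (hδ' : δ < 1 / 2) : 0 < lowerConst δ := by
  have : 0 < 1 - 2 * δ := by linarith
  unfold lowerConst
  positivity

theorem lowerConst_mul_le_infoCost {δ : ℝ} (hδ : 0 < δ) (hδ' : δ < 1 / 2)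
    (hP : P.HasError (disj n k) δ) (hn : n ≤ 2 ^ k) :
    lowerConst δ * n * k ≤ P.infoCost (zeta n k) * Real.log 2 := by
  refine le_trans ?_ (sum_coordInfo_le P)
  set ε : ℝ := (1 - 2 * δ) / 2 with hε
  set q : ℝ := ((1 - 2 * δ) / 6) ^ 2 / 4 / 288 with hq
  have hε0 : 0 < ε := by rw [hε]; linarith
  have hε1 : ε < 1 := by rw [hε]; linarith
  have hq0 : 0 ≤ q := by positivity
  have hfin : ∑ j, coordInfo P j ≠ ∞ := by
    refine ENNReal.sum_ne_top.2 fun j _ => ?_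
    have h := fun i => bit_information P j i
    have h' := fun i => mode_information P j i
    have fi : ∀ i, (3 * k : ℝ≥0∞)⁻¹ / 2 * (k * (rect P j).inputDist i) ≠ ∞ := fun i =>
      ne_top_of_le_ne_top (natEntropy_ne_top _ _ _) (le_add_self.trans (h i))
    have fm : ∀ i, (3 * k : ℝ≥0∞)⁻¹ / 2 * ∑ z ∈ Finset.univ.erase i, (rect P j).modeDist i z ≠ ∞ :=
      fun i => ne_top_of_le_ne_top (natEntropy_ne_top _ _ _) (le_add_self.trans (h' i))
    rw [coordInfo, mul_add, Finset.mul_sum, Finset.mul_sum, Finset.mul_sum]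
    exact ENNReal.add_ne_top.2
      ⟨ENNReal.sum_ne_top.2 fun i _ => fi i, ENNReal.sum_ne_top.2 fun i _ => fm i⟩
  -- The first `m` coordinates are exactly those with `j < ε n`, hence `j ≤ ε 2 ^ k`; this is a
  -- fraction of at least `ε` of all coordinates.
  set m := ⌈ε * n⌉₊ with hm
  have hmn : m ≤ n := Nat.ceil_le.2 (by nlinarith [Nat.cast_nonneg (α := ℝ) n])
  have hlow : ENNReal.ofReal (m * (k * q)) ≤ ∑ j, coordInfo P j := by
    have hcard : (Finset.univ.filter fun j : Fin n => (j : ℕ) < m).card = m := by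
      rw [Fin.card_filter_val_lt, min_eq_right hmn]
    calc ENNReal.ofReal (m * (k * q))
        = ∑ j ∈ Finset.univ.filter fun j : Fin n => (j : ℕ) < m, (k : ℝ≥0∞) * ENNReal.ofReal q := by
          rw [Finset.sum_const, hcard, nsmul_eq_mul, ENNReal.ofReal_mul (by positivity),
            ENNReal.ofReal_mul (by positivity), ENNReal.ofReal_natCast, ENNReal.ofReal_natCast]
      _ ≤ ∑ j ∈ Finset.univ.filter fun j : Fin n => (j : ℕ) < m, coordInfo P j := by
          refine Finset.sum_le_sum fun j hj => coordInfo_ge P hδ hδ' hP hn j ?_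
          have h1 : ((j : ℕ) : ℝ) < ε * n := Nat.lt_ceil.1 (Finset.mem_filter.1 hj).2
          have h2 : (n : ℝ) ≤ 2 ^ k := by exact_mod_cast hn
          exact h1.le.trans (mul_le_mul_of_nonneg_left h2 hε0.le)
      _ ≤ ∑ j, coordInfo P j := Finset.sum_le_univ_sum_of_nonneg fun _ => zero_le
  have h1 := (ENNReal.ofReal_le_iff_le_toReal hfin).1 hlow
  refine le_trans ?_ h1
  have h2 : ε * n ≤ m := Nat.le_ceil _
  calc lowerConst δ * n * k = (ε * n) * (k * q) := by rw [lowerConst]; ring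
    _ ≤ m * (k * q) := by gcongr

end HardDist

/-! ### Kraft's inequality and information cost versus communication -/

namespace Coordinator

section Tree

variable {α β : Type}

lemma ENNReal_tsum_sum (f : α ⊕ β → ℝ≥0∞) :
    ∑' s, f s = ∑' a, f (Sum.inl a) + ∑' b, f (Sum.inr b) :=
  Summable.tsum_sum ENNReal.summable ENNReal.summable

lemma tsum_list (f : List α → ℝ≥0∞) : ∑' l, f l = f [] + ∑' l, ∑' a, f (a :: l) := by
  let e : Unit ⊕ (List α × α) ≃ List α :=
    { toFun := fun s => s.elim (fun _ => []) (fun v => v.2 :: v.1)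
      invFun := fun l => match l with
        | [] => Sum.inl ()
        | a :: l => Sum.inr (l, a)
      left_inv := fun s => by rcases s with _ | ⟨l, a⟩ <;> rfl
      right_inv := fun l => by cases l <;> rfl }
  rw [← e.tsum_eq, ENNReal_tsum_sum, ENNReal.tsum_prod']
  simp [e]

/-- A weight that is at least the sum of the weights of the children and of the weight of
stopping bounds the total weight of stopping. -/
lemma tsum_le_one_of_tree (f g : List α → ℝ≥0∞) (h0 : f [] ≤ 1)
    (h : ∀ l, ∑' a, f (a :: l) + g l ≤ f l) : ∑' l, g l ≤ 1 := by
  classical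
  -- `F N` is the weight present at depth `N` and `G N` the weight that stops there; `F (N + 1) + G
  -- N ≤ F N` telescopes.
  set F : ℕ → ℝ≥0∞ := fun N => ∑' l : List α, if l.length = N then f l else 0 with hF
  set G : ℕ → ℝ≥0∞ := fun N => ∑' l : List α, if l.length = N then g l else 0 with hG
  have hstep : ∀ N, F (N + 1) + G N ≤ F N := by
    intro N
    have h1 : F (N + 1) = ∑' l : List α, if l.length = N then ∑' a, f (a :: l) else 0 := by
      simp only [hF]
      rw [tsum_list]
      simp only [List.length_nil, List.length_cons, Nat.add_right_cancel_iff]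
      rw [if_neg (by omega), zero_add]
      refine tsum_congr fun l => ?_
      split_ifs <;> simp
    rw [h1, hG, ← ENNReal.tsum_add]
    refine ENNReal.tsum_le_tsum fun l => ?_
    split_ifs
    · exact h l
    · simp
  have hF0 : F 0 ≤ 1 := by
    simp only [hF]
    rw [tsum_list]
    simpa using h0
  have hpart : ∀ N, ∑ i ∈ Finset.range N, G i + F N ≤ 1 := by
    intro N
    induction N with
    | zero => simpa using hF0
    | succ N ih =>
      rw [Finset.sum_range_succ, add_assoc, add_comm (G N)]
      exact (add_le_add le_rfl (hstep N)).trans ih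
  have hsum : ∑' l, g l = ∑' N, G N := by
    simp only [hG]
    rw [ENNReal.tsum_comm]
    refine tsum_congr fun l => ?_
    rw [tsum_eq_single l.length]
    · simp
    · intro N hN
      rw [if_neg (Ne.symm hN)]
  rw [hsum]
  exact ENNReal.tsum_le_of_sum_range_le fun N => le_self_add.trans (hpart N)

/-- Kraft's inequality for prefix-free sets of bit strings. -/
lemma tsum_prefixFree_le_one (S : Set (List Bool)) [DecidablePred (· ∈ S)]
    (hS : ∀ r ∈ S, ∀ r' ∈ S, r <+: r' → r = r') :
    ∑' r : List Bool, (if r ∈ S then (2⁻¹ : ℝ≥0∞) ^ r.length else 0) ≤ 1 := by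
  classical
  -- Lists grow at the head, but words are extended at the end; reversal reconciles the two.
  let e : List Bool ≃ List Bool := ⟨List.reverse, List.reverse, List.reverse_reverse,
    List.reverse_reverse⟩
  rw [← e.tsum_eq]
  -- A node has weight `2⁻¹ ^ length` until a word of `S` has been passed, and `0` afterwards.
  refine tsum_le_one_of_tree
    (fun l => if ∃ r ∈ S, r <+: l.reverse ∧ r ≠ l.reverse then 0 else (2⁻¹ : ℝ≥0∞) ^ l.length) _ ?_ ?_
  · simp
  · intro l
    have he : e l = l.reverse := rfl
    rw [he, List.length_reverse, tsum_fintype]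
    by_cases h1 : ∃ r ∈ S, r <+: l.reverse ∧ r ≠ l.reverse
    · obtain ⟨r, hr, hpre, hne⟩ := h1
      have h2 : ∀ a : Bool, ∃ r ∈ S, r <+: (a :: l).reverse ∧ r ≠ (a :: l).reverse := by
        intro a
        rw [List.reverse_cons]
        refine ⟨r, hr, hpre.trans (List.prefix_append _ _), fun h => ?_⟩
        have := hpre.length_le
        rw [h] at this
        simp at this
      have h3 : l.reverse ∉ S := fun h => hne (hS r hr _ h hpre)
      simp only [h2, if_true, h3, if_false, Finset.sum_const_zero, zero_add]
      exact zero_le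
    · by_cases h3 : l.reverse ∈ S
      · have h2 : ∀ a : Bool, ∃ r ∈ S, r <+: (a :: l).reverse ∧ r ≠ (a :: l).reverse := by
          intro a
          rw [List.reverse_cons]
          refine ⟨l.reverse, h3, List.prefix_append _ _, fun h => ?_⟩
          have := congrArg List.length h
          simp at this
        rw [if_neg h1, if_pos h3, Finset.sum_eq_zero fun a _ => if_pos (h2 a), zero_add]
      · simp only [h1, h3, if_false, add_zero]
        calc ∑ a : Bool, (if ∃ r ∈ S, r <+: (a :: l).reverse ∧ r ≠ (a :: l).reverse then 0
              else (2⁻¹ : ℝ≥0∞) ^ (a :: l).length)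
            ≤ ∑ _a : Bool, (2⁻¹ : ℝ≥0∞) ^ (l.length + 1) := by
              refine Finset.sum_le_sum fun a _ => ?_
              split_ifs
              · exact zero_le
              · simp
          _ = (2⁻¹ : ℝ≥0∞) ^ l.length := by
              rw [Fintype.sum_bool, pow_succ, ← mul_add, ENNReal.inv_two_add_inv_two, mul_one]

end Tree

variable {k : ℕ} {D : Type}

/-- The number of bits on a channel. -/
def chanBits (c : Channel) : ℕ := (c.map fun e => e.1.length + e.2.length).sum

lemma sum_chanBits : ∀ h : History k, ∑ i, chanBits (chan i h) = bits h
  | [] => by simp [chanBits, chan, bits]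
  | (i, m, r) :: h => by
    have h1 : ∀ l, chanBits (chan l ((i, m, r) :: h)) =
        (if i = l then m.length + r.length else 0) + chanBits (chan l h) := by
      intro l
      by_cases hl : i = l
      · simp [chan, chanBits, hl]
      · simp [chan, chanBits, hl]
    simp only [h1, Finset.sum_add_distrib, Finset.sum_ite_eq, Finset.mem_univ, if_true,
      sum_chanBits h]
    simp [bits]

namespace Strategy

variable (S : Strategy k D)

/-- The replies that player `i` may send on some input. -/
def replies (i : Fin k) (c : Channel) (m : List Bool) : Set (List Bool) :=
  {r | ∃ x, S.player i x c m r ≠ 0}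

/-- The messages that the coordinator may send to player `i`. -/
def queries (i : Fin k) (c : Channel) : Set (List Bool) :=
  {m | ∃ h, chan i h = c ∧ S.coord h (Sum.inr (i, m)) ≠ 0}

open Classical in
/-- The weight of a message, according to its length. -/
def replyWeight (i : Fin k) (c : Channel) (m r : List Bool) : ℝ≥0∞ :=
  if r ∈ S.replies i c m then 2⁻¹ ^ r.length else 0

open Classical in
/-- The weight of a message of the coordinator, according to its length. -/
def queryWeight (i : Fin k) (c : Channel) (m : List Bool) : ℝ≥0∞ :=
  if m ∈ S.queries i c then 2⁻¹ ^ m.length else 0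

lemma tsum_replyWeight_le_one (i : Fin k) (c : Channel) (m : List Bool) :
    ∑' r, S.replyWeight i c m r ≤ 1 := by
  classical
  refine tsum_prefixFree_le_one _ ?_
  rintro r ⟨x, hx⟩ r' ⟨x', hx'⟩
  exact S.player_prefix_free i x x' c m r r' hx hx'

lemma tsum_queryWeight_le_one (i : Fin k) (c : Channel) : ∑' m, S.queryWeight i c m ≤ 1 := by
  classical
  refine tsum_prefixFree_le_one _ ?_
  rintro m ⟨h, hc, hm⟩ m' ⟨h', hc', hm'⟩
  exact S.coord_prefix_free i h h' m m' (hc.trans hc'.symm) hm hm'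

/-- The weight of a transcript in which the players' moves are replaced by a code. -/
def codeReach : History k → ℝ≥0∞
  | [] => 1
  | (i, m, r) :: h =>
    codeReach h * S.coord h (Sum.inr (i, m)) * S.replyWeight i (chan i h) m r

/-- The weight of a channel according to its length. -/
def codeChan (lam : ℝ≥0∞) (i : Fin k) : Channel → ℝ≥0∞
  | [] => 1
  | (m, r) :: c => codeChan lam i c * (lam * (S.queryWeight i c m * S.replyWeight i c m r))

lemma two_pow_mul_inv (n : ℕ) : (2 : ℝ≥0∞) ^ n * 2⁻¹ ^ n = 1 := by
  rw [← mul_pow, ENNReal.mul_inv_cancel (by simp) (by simp), one_pow]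

/-- The coordinator's moves keep their true probabilities, as these are the same for all inputs;
only the replies need the code. -/
lemma reach_le (X : Fin k → D) : ∀ h : History k, S.reach X h ≤ 2 ^ bits h * S.codeReach h
  | [] => by simp [reach, codeReach, bits]
  | (i, m, r) :: h => by
    have hb : bits ((i, m, r) :: h) = bits h + (m.length + r.length) := by simp [bits, add_comm]
    have h1 : S.player i (X i) (chan i h) m r ≤
        2 ^ (m.length + r.length) * S.replyWeight i (chan i h) m r := by
      by_cases h0 : S.player i (X i) (chan i h) m r = 0
      · rw [h0]; exact zero_le
      · rw [replyWeight, if_pos ⟨_, h0⟩, pow_add, mul_assoc, two_pow_mul_inv, mul_one]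
        exact (PMF.coe_le_one _ _).trans (one_le_pow₀ (by norm_num))
    rw [reach, codeReach, hb, pow_add]
    calc S.reach X h * S.coord h (Sum.inr (i, m)) * S.player i (X i) (chan i h) m r
        ≤ (2 ^ bits h * S.codeReach h) * S.coord h (Sum.inr (i, m)) *
          (2 ^ (m.length + r.length) * S.replyWeight i (chan i h) m r) := by
          gcongr
          exact reach_le X h
      _ = _ := by ring

lemma tsum_codeReach_le_one :
    ∑' h, S.codeReach h * ∑ b, S.coord h (Sum.inl b) ≤ 1 := by
  refine tsum_le_one_of_tree S.codeReach _ (by simp [codeReach]) fun h => ?_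
  have h1 := (S.coord h).tsum_coe
  rw [ENNReal_tsum_sum, tsum_fintype, ENNReal.tsum_prod', add_comm] at h1
  calc ∑' a, S.codeReach (a :: h) + S.codeReach h * ∑ b, S.coord h (Sum.inl b)
      = S.codeReach h * (∑' i, ∑' m, S.coord h (Sum.inr (i, m)) *
          ∑' r, S.replyWeight i (chan i h) m r + ∑ b, S.coord h (Sum.inl b)) := by
        rw [mul_add]
        congr 1
        simp only [ENNReal.tsum_prod', codeReach, mul_assoc, ENNReal.tsum_mul_left]
    _ ≤ S.codeReach h * (∑' i, ∑' m, S.coord h (Sum.inr (i, m)) + ∑ b, S.coord h (Sum.inl b)) := by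
        refine mul_le_mul_right (add_le_add (ENNReal.tsum_le_tsum fun i =>
          ENNReal.tsum_le_tsum fun m => ?_) le_rfl) _
        exact mul_le_of_le_one_right' (S.tsum_replyWeight_le_one _ _ _)
    _ = S.codeReach h := by rw [h1, mul_one]

/-- One possible channel may extend another, so the code needs an end marker: each round continues
with weight `lam` and stops with weight `1 - lam`. -/
lemma tsum_codeChan_le_one {lam : ℝ≥0∞} (hlam : lam ≤ 1) (i : Fin k) :
    ∑' c, S.codeChan lam i c * (1 - lam) ≤ 1 := by
  refine tsum_le_one_of_tree (S.codeChan lam i) _ (by simp [codeChan]) fun c => ?_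
  calc ∑' a, S.codeChan lam i (a :: c) + S.codeChan lam i c * (1 - lam)
      = S.codeChan lam i c * (lam * ∑' m, S.queryWeight i c m * ∑' r, S.replyWeight i c m r +
          (1 - lam)) := by
        rw [mul_add]
        congr 1
        simp only [ENNReal.tsum_prod', codeChan, ENNReal.tsum_mul_left]
    _ ≤ S.codeChan lam i c * (lam * 1 + (1 - lam)) := by
        refine mul_le_mul_right (add_le_add (mul_le_mul_right ?_ _) le_rfl) _
        refine (ENNReal.tsum_le_tsum fun m => ?_).trans (S.tsum_queryWeight_le_one i c)
        exact mul_le_of_le_one_right' (S.tsum_replyWeight_le_one _ _ _)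
    _ = S.codeChan lam i c := by rw [mul_one, add_tsub_cancel_of_le hlam, mul_one]

/-- For player `i` the queries must be coded too, since they can carry information about the other
inputs. Queries are nonempty, so there are at most as many rounds as bits, and the factor `lam⁻¹`
per round may be charged to each bit. -/
lemma one_le_codeChan {lam : ℝ≥0∞} (hlam : lam ≤ 1) (hlam0 : lam ≠ 0) (i : Fin k)
    (X : Fin k → D) : ∀ h : History k, S.reach X h ≠ 0 →
      1 ≤ (2 * lam⁻¹) ^ chanBits (chan i h) * S.codeChan lam i (chan i h)
  | [], _ => by simp [chan, chanBits, codeChan]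
  | (i', m, r) :: h, hr => by
    rw [reach] at hr
    have hr1 : S.reach X h ≠ 0 := fun h0 => hr (by rw [h0, zero_mul, zero_mul])
    have hr2 : S.coord h (Sum.inr (i', m)) ≠ 0 := fun h0 => hr (by rw [h0, mul_zero, zero_mul])
    have hr3 : S.player i' (X i') (chan i' h) m r ≠ 0 := fun h0 => hr (by rw [h0, mul_zero])
    have ih := one_le_codeChan hlam hlam0 i X h hr1
    by_cases hi : i' = i
    · subst hi
      have hc : chan i' ((i', m, r) :: h) = (m, r) :: chan i' h := by simp [chan]
      have hb : chanBits ((m, r) :: chan i' h) = chanBits (chan i' h) + (m.length + r.length) := by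
        simp [chanBits, add_comm]
      rw [hc, hb, codeChan, queryWeight, replyWeight, if_pos ⟨_, rfl, hr2⟩, if_pos ⟨_, hr3⟩, pow_add]
      obtain ⟨p, hp⟩ : ∃ p, m.length + r.length = p + 1 := by
        have := List.length_pos_iff.2 (S.coord_ne_nil _ _ _ hr2)
        exact ⟨m.length + r.length - 1, by omega⟩
      have hstep : 1 ≤ (2 * lam⁻¹) ^ (m.length + r.length) *
          (lam * (2⁻¹ ^ m.length * 2⁻¹ ^ r.length)) := by
        rw [← pow_add, mul_pow, hp]
        calc (1 : ℝ≥0∞) ≤ lam⁻¹ ^ p := one_le_pow₀ (ENNReal.one_le_inv.2 hlam)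
          _ = (2 ^ (p + 1) * 2⁻¹ ^ (p + 1)) * (lam⁻¹ ^ p * (lam⁻¹ * lam)) := by
              rw [two_pow_mul_inv, ENNReal.inv_mul_cancel hlam0
                (ne_top_of_le_ne_top ENNReal.one_ne_top hlam), one_mul, mul_one]
          _ = _ := by ring
      calc (1 : ℝ≥0∞) = 1 * 1 := (one_mul 1).symm
        _ ≤ ((2 * lam⁻¹) ^ chanBits (chan i' h) * S.codeChan lam i' (chan i' h)) *
            ((2 * lam⁻¹) ^ (m.length + r.length) *
              (lam * (2⁻¹ ^ m.length * 2⁻¹ ^ r.length))) := mul_le_mul' ih hstep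
        _ = _ := by ring
    · have hc : chan i ((i', m, r) :: h) = chan i h := by simp [chan, hi]
      rw [hc]
      exact ih

end Strategy

namespace Protocol

open Info

variable (P : Protocol k D) (ζ : PMF (Fin k → D))

lemma map_joint_fst : (P.joint ζ).map (fun ω => ω.1) = ζ := by
  rw [joint, PMF.map_bind]
  conv_rhs => rw [← PMF.bind_pure ζ]
  congr 1
  funext X
  rw [PMF.map_comp]
  exact PMF.map_const _ _

lemma joint_apply (X : Fin k → D) (h : History k) :
    P.joint ζ (X, h) = ζ X * ∑ b, P.prob X (h, b) := by
  classical
  rw [joint, PMF.bind_apply, tsum_eq_single X]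
  · congr 1
    rw [PMF.map_apply, ENNReal.tsum_prod', tsum_eq_single h]
    · simp [tsum_fintype]
      rfl
    · intro h' hh
      simp [hh.symm]
  · intro X' hX
    convert mul_zero _
    rw [PMF.map_apply]
    exact ENNReal.tsum_eq_zero.2 fun t => if_neg fun h1 => hX (Prod.mk.inj h1).1.symm

lemma exists_of_joint_ne_zero {X : Fin k → D} {h : History k} (hne : P.joint ζ (X, h) ≠ 0) :
    ∃ b, (h, b) ∈ (P.law X).support ∧ P.reach X h ≠ 0 := by
  rw [joint_apply] at hne
  obtain ⟨b, -, hb⟩ := Finset.exists_ne_zero_of_sum_ne_zero (right_ne_zero_of_mul hne)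
  exact ⟨b, (PMF.mem_support_iff _ _).2 hb, left_ne_zero_of_mul hb⟩

lemma ofReal_exp_log_mul {a : ℝ} (ha : 0 < a) (n : ℕ) :
    ENNReal.ofReal (Real.exp (Real.log a * n)) = ENNReal.ofReal a ^ n := by
  rw [mul_comm, Real.exp_nat_mul, Real.exp_log ha, ENNReal.ofReal_pow ha.le]

/-- The information revealed to the coordinator is at most the number of bits. -/
lemma natEntropy_le_transcript :
    natEntropy (P.joint ζ) (fun ω => ω.1) (fun _ => ()) ≤
      natEntropy (P.joint ζ) (fun ω => ω.1) (fun ω => (ω.2, ())) +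
        expect (P.joint ζ) (fun ω => ENNReal.ofReal (Real.log 2 * bits ω.2)) := by
  refine natEntropy_le_add_expect (P.joint ζ) (fun ω => ω.1) (fun ω => ω.2) (fun _ => ())
    (fun h => Real.log 2 * bits h) (fun h => by positivity) 
    (fun h => P.codeReach h * ∑ b, P.coord h (Sum.inl b)) P.tsum_codeReach_le_one ?_
  intro X h _
  have h1 := map_apply_injective (P.joint ζ) (fun ω => ω)
    (e := fun ω : (Fin k → D) × History k => (ω.1, ω.2, ()))
    (fun v w h => by simp only [Prod.mk.injEq] at h; ext1 <;> simp_all) (X, h)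
  have e2 : (P.joint ζ).map (fun ω => ω) = P.joint ζ := PMF.map_id _
  rw [h1, e2, map_pair_unit, map_joint_fst, joint_apply, ofReal_exp_log_mul two_pos,
    ENNReal.ofReal_ofNat]
  gcongr
  simp only [Strategy.prob]
  rw [← Finset.mul_sum, ← mul_assoc]
  gcongr
  exact P.reach_le X h

/-- The information revealed to player `i` is at most about the number of bits on its channel. -/
lemma natEntropy_le_channel {s : ℝ} (hs : 0 < s) (i : Fin k) :
    natEntropy (P.joint ζ) (fun ω => fun l : {l : Fin k // l ≠ i} => ω.1 l) (fun ω => ω.1 i) ≤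
      natEntropy (P.joint ζ) (fun ω => fun l : {l : Fin k // l ≠ i} => ω.1 l)
          (fun ω => (chan i ω.2, ω.1 i)) +
        expect (P.joint ζ) (fun ω => ENNReal.ofReal
          (s + Real.log (2 * (1 - Real.exp (-s))⁻¹) * chanBits (chan i ω.2))) := by
  have he0 : Real.exp (-s) < 1 := by
    rw [← Real.exp_zero]
    exact Real.exp_lt_exp.2 (by linarith)
  have he1 : 0 < 1 - Real.exp (-s) := by linarith
  have he2 := Real.exp_pos (-s)
  -- `l` is the weight of continuing; stopping then has weight `exp (-s)` and costs exactly `s`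
  -- nats.
  set l : ℝ := 1 - Real.exp (-s) with hl
  have hinv : 1 ≤ l⁻¹ := (one_le_inv₀ he1).2 (by linarith)
  have hlog : 0 ≤ Real.log (2 * l⁻¹) := Real.log_nonneg (by linarith)
  have hlam1 : ENNReal.ofReal l ≤ 1 := by
    rw [← ENNReal.ofReal_one]
    exact ENNReal.ofReal_le_ofReal (by linarith)
  have hlam0 : ENNReal.ofReal l ≠ 0 := by simpa using he1
  refine natEntropy_le_add_expect (P.joint ζ) (fun ω => fun l : {l : Fin k // l ≠ i} => ω.1 l)
    (fun ω => chan i ω.2) (fun ω => ω.1 i) (fun c => s + Real.log (2 * l⁻¹) * chanBits c)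
    (fun c => by positivity)
    (fun c => P.codeChan (ENNReal.ofReal l) i c * (1 - ENNReal.ofReal l))
    (P.tsum_codeChan_le_one hlam1 i) ?_
  intro a c x
  by_cases h0 : (P.joint ζ).map (fun ω => ((fun l : {l : Fin k // l ≠ i} => ω.1 l), chan i ω.2,
      ω.1 i)) (a, c, x) = 0
  · rw [h0]; exact zero_le
  obtain ⟨⟨X, h⟩, hω, heq⟩ := (PMF.mem_support_map_iff _ _ _).1 ((PMF.mem_support_iff _ _).2 h0)
  obtain ⟨b, -, hreach⟩ := P.exists_of_joint_ne_zero ζ ((PMF.mem_support_iff _ _).1 hω)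
  have hc : chan i h = c := (Prod.mk.inj (Prod.mk.inj heq).2).1
  have h1 := P.one_le_codeChan hlam1 hlam0 i X h hreach
  rw [hc] at h1
  have h2 : 1 ≤ ENNReal.ofReal (Real.exp (s + Real.log (2 * l⁻¹) * chanBits c)) *
      (P.codeChan (ENNReal.ofReal l) i c * (1 - ENNReal.ofReal l)) := by
    have h3 : ENNReal.ofReal (Real.exp s) * (1 - ENNReal.ofReal l) = 1 := by
      rw [← ENNReal.ofReal_one, ← ENNReal.ofReal_sub _ he1.le, ← ENNReal.ofReal_mul
        (Real.exp_pos s).le, hl, sub_sub_cancel, ← Real.exp_add, add_neg_cancel, Real.exp_zero]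
    rw [Real.exp_add, ENNReal.ofReal_mul (Real.exp_pos _).le, ofReal_exp_log_mul (by positivity),
      ENNReal.ofReal_mul zero_le_two, ENNReal.ofReal_ofNat, ENNReal.ofReal_inv_of_pos he1]
    calc (1 : ℝ≥0∞) ≤ (2 * (ENNReal.ofReal l)⁻¹) ^ chanBits c * P.codeChan (ENNReal.ofReal l) i c := h1
      _ = (ENNReal.ofReal (Real.exp s) * (1 - ENNReal.ofReal l)) *
          ((2 * (ENNReal.ofReal l)⁻¹) ^ chanBits c * P.codeChan (ENNReal.ofReal l) i c) := by
          rw [h3, one_mul]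
      _ = _ := by ring
  refine le_trans ?_ (le_mul_of_one_le_right' h2)
  exact map_apply_le_comp (P.joint ζ) (fun ω => ((fun l : {l : Fin k // l ≠ i} => ω.1 l),
    chan i ω.2, ω.1 i)) (fun v => (v.1, v.2.2)) (a, c, x)

/-- The transcript costs `log 2` nats per bit. A channel costs `log (2 / (1 - exp (-s)))` per bit
and `s` for its end marker. Channel bits add up to all bits, but the end marker is paid for `k`
times, even on silent channels. -/
theorem infoCost_mul_log_le [Fintype D] {s : ℝ} (hs : 0 < s) {N : ℕ}
    (hN : ∀ X, ∀ t ∈ (P.law X).support, bits t.1 ≤ N) :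
    P.infoCost ζ * Real.log 2 ≤
      N * (Real.log 2 + Real.log (2 * (1 - Real.exp (-s))⁻¹)) + k * s := by
  have he0 : Real.exp (-s) < 1 := by
    rw [← Real.exp_zero]
    exact Real.exp_lt_exp.2 (by linarith)
  have he1 : 0 < 1 - Real.exp (-s) := by linarith
  have he2 := Real.exp_pos (-s)
  set Λ : ℝ := Real.log (2 * (1 - Real.exp (-s))⁻¹) with hΛ
  have hinv : 1 ≤ (1 - Real.exp (-s))⁻¹ := (one_le_inv₀ he1).2 (by linarith)
  have hΛ0 : 0 ≤ Λ := Real.log_nonneg (by linarith)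
  have hbits : ∀ ω, P.joint ζ ω ≠ 0 → bits ω.2 ≤ N := by
    rintro ⟨X, h⟩ hω
    obtain ⟨b, hb, -⟩ := P.exists_of_joint_ne_zero ζ hω
    exact hN X _ hb
  have h1 : natEntropy (P.joint ζ) (fun ω => ω.1) (fun _ => ()) ≤
      natEntropy (P.joint ζ) (fun ω => ω.1) (fun ω => (ω.2, ())) +
        ENNReal.ofReal (Real.log 2 * N) := by
    refine (P.natEntropy_le_transcript ζ).trans (add_le_add le_rfl ?_)
    rw [← expect_const (P.joint ζ) (ENNReal.ofReal (Real.log 2 * N))]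
    refine expect_mono fun ω hω => ENNReal.ofReal_le_ofReal ?_
    have : (bits ω.2 : ℝ) ≤ N := by exact_mod_cast hbits ω hω
    gcongr
  set E : Fin k → ℝ≥0∞ := fun i => expect (P.joint ζ) (fun ω => ENNReal.ofReal
    (s + Λ * chanBits (chan i ω.2))) with hE
  have hsumE : ∑ i, E i ≤ ENNReal.ofReal (k * s + Λ * N) := by
    rw [hE, ← expect_sum, ← expect_const (P.joint ζ) (ENNReal.ofReal (k * s + Λ * N))]
    refine expect_mono fun ω hω => ?_
    rw [← ENNReal.ofReal_sum_of_nonneg fun i _ => by positivity]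
    refine ENNReal.ofReal_le_ofReal ?_
    rw [Finset.sum_add_distrib, ← Finset.mul_sum, ← Nat.cast_sum, sum_chanBits]
    have : (bits ω.2 : ℝ) ≤ N := by exact_mod_cast hbits ω hω
    simp only [Finset.sum_const, Finset.card_univ, Fintype.card_fin, nsmul_eq_mul]
    gcongr
  have hEtop : ∑ i, E i ≠ ∞ := ne_top_of_le_ne_top ENNReal.ofReal_ne_top hsumE
  have hEi : ∀ i, E i ≠ ∞ := fun i => ENNReal.sum_ne_top.1 hEtop i (Finset.mem_univ i)
  have t1 := ENNReal.toReal_mono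
    (ENNReal.add_ne_top.2 ⟨natEntropy_ne_top _ _ _, ENNReal.ofReal_ne_top⟩) h1
  rw [ENNReal.toReal_add (natEntropy_ne_top _ _ _) ENNReal.ofReal_ne_top,
    ENNReal.toReal_ofReal (by positivity)] at t1
  have t2 : ∀ i, condMutualInfo (P.joint ζ)
      (fun ω => fun l : {l : Fin k // l ≠ i} => ω.1 l) (fun ω => chan i ω.2) (fun ω => ω.1 i) *
        Real.log 2 ≤ (E i).toReal := by
    intro i
    have := ENNReal.toReal_mono
      (ENNReal.add_ne_top.2 ⟨natEntropy_ne_top _ _ _, hEi i⟩) (P.natEntropy_le_channel ζ hs i)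
    rw [ENNReal.toReal_add (natEntropy_ne_top _ _ _) (hEi i)] at this
    rw [condMutualInfo_eq]
    linarith
  have t3 : ∑ i, (E i).toReal ≤ k * s + Λ * N := by
    rw [← ENNReal.toReal_sum fun i _ => hEi i]
    exact ENNReal.toReal_le_of_le_ofReal (by positivity) hsumE
  rw [infoCost, add_mul, mutualInfo_eq, Finset.sum_mul]
  have t4 := Finset.sum_le_sum fun i (_ : i ∈ Finset.univ) => t2 i
  linarith

end Protocol
end Coordinator
end

/-! ### The main theorem: choice of the constants -/

theorem mainTheorem1 :
    ∃ a : ℝ, 0 < a ∧ ∀ δ : ℝ, 0 < δ → δ < 1 / 2 →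
      ∃ c : ℝ, 0 < c ∧ ∀ (n k : ℕ) [NeZero k], 1 ≤ n → a * Real.logb 2 n ≤ k →
        ((c * n * k : ℝ) : EReal) ≤ Coordinator.IC (HardDist.zeta n k) δ (disj n k) ∧
        ENNReal.ofReal (c * n * k) ≤ (Coordinator.CC δ (disj n k) : ℝ≥0∞) := by
  -- With `a = 1` the hypothesis on `k` says `n ≤ 2 ^ k`.
  refine ⟨1, one_pos, fun δ hδ hδ' => ?_⟩
  have hl := HardDist.lowerConst_pos hδ'
  set l := HardDist.lowerConst δ with hl_def
  set Γ : ℝ := Real.log 2 + Real.log (2 * (1 - Real.exp (-(l / 2)))⁻¹) with hΓ_def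
  have hΓ : 0 < Γ := by
    have he : Real.exp (-(l / 2)) < 1 := by
      rw [← Real.exp_zero]
      exact Real.exp_lt_exp.2 (by linarith)
    have he' := Real.exp_pos (-(l / 2))
    have hinv : 1 ≤ (1 - Real.exp (-(l / 2)))⁻¹ :=
      (one_le_inv₀ (by linarith)).2 (by linarith)
    exact add_pos_of_pos_of_nonneg (Real.log_pos one_lt_two) (Real.log_nonneg (by linarith))
  -- The first bound serves the information cost, the second the communication, where each bit
  -- accounts for at most `Γ` nats and half of the lower bound is given away.
  refine ⟨min l (l / (2 * Γ)), lt_min hl (by positivity), fun n k _ hn hnk => ?_⟩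
  set c := min l (l / (2 * Γ)) with hc_def
  have hc : 0 < c := lt_min hl (by positivity)
  have hn0 : (0 : ℝ) < n := by exact_mod_cast hn
  have hn1 : (1 : ℝ) ≤ n := by exact_mod_cast hn
  have hpow : n ≤ 2 ^ k := by
    rw [one_mul, Real.logb_le_iff_le_rpow one_lt_two hn0, Real.rpow_natCast] at hnk
    exact_mod_cast hnk
  have hlog2 : Real.log 2 < 1 := Real.log_two_lt_d9.trans (by norm_num)
  constructor
  · refine le_iInf₂ fun P hP => EReal.coe_le_coe_iff.2 ?_
    have h := HardDist.lowerConst_mul_le_infoCost P hδ hδ' hP hpow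
    have h0 : 0 ≤ P.infoCost (HardDist.zeta n k) := by
      by_contra! hneg
      have := mul_neg_of_neg_of_pos hneg (Real.log_pos one_lt_two)
      have : 0 ≤ l * n * k := by positivity
      linarith
    calc c * n * k ≤ l * n * k := by gcongr; exact min_le_left _ _
      _ ≤ P.infoCost (HardDist.zeta n k) * Real.log 2 := h
      _ ≤ P.infoCost (HardDist.zeta n k) := mul_le_of_le_one_right h0 hlog2.le
  · have key : ((⌈c * n * k⌉₊ : ℕ) : ℕ∞) ≤ Coordinator.CC δ (disj n k) := by
      refine le_iInf₂ fun P hP => ?_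
      obtain htop | ⟨N, hN⟩ := (em (P.cost = ⊤)).imp_right ENat.ne_top_iff_exists.1
      · rw [htop]
        exact le_top
      have hbits : ∀ X, ∀ t ∈ (P.law X).support, Coordinator.bits t.1 ≤ N := by
        intro X t ht
        have h : (Coordinator.bits t.1 : ℕ∞) ≤ P.cost :=
          le_iSup_of_le X (le_iSup₂_of_le t ht le_rfl)
        rw [← hN] at h
        exact_mod_cast h
      rw [← hN, Nat.cast_le, Nat.ceil_le]
      have h1 := HardDist.lowerConst_mul_le_infoCost P hδ hδ' hP hpow
      -- With `s = l / 2` the additive term `k s` is at most half of `l n k`, because `n ≥ 1`.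
      have h2 := P.infoCost_mul_log_le (HardDist.zeta n k) (half_pos hl) hbits
      have h3 : (k : ℝ) * (l / 2) ≤ l * n * k / 2 := by
        nlinarith [mul_nonneg (mul_nonneg hl.le k.cast_nonneg) (sub_nonneg.2 hn1)]
      have h4 : l * n * k ≤ N * (2 * Γ) := by linarith
      calc c * n * k ≤ l / (2 * Γ) * n * k := by gcongr; exact min_le_right _ _
        _ = l * n * k / (2 * Γ) := by ring
        _ ≤ N := (div_le_iff₀ (by positivity)).2 h4
    calc ENNReal.ofReal (c * n * k) ≤ ENNReal.ofReal (⌈c * n * k⌉₊ : ℕ) :=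
          ENNReal.ofReal_le_ofReal (Nat.le_ceil _)
      _ = (((⌈c * n * k⌉₊ : ℕ) : ℕ∞) : ℝ≥0∞) := by simp
      _ ≤ (Coordinator.CC δ (disj n k) : ℝ≥0∞) := ENat.toENNReal_le.2 key
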